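/- **Setting.** Let $T>0$, let $\Omega\subset\mathbb R^3$ be a bounded open set (for instance a bounded Lipschitz domain) with diameter $d_\Omega$, and let $D\subset\Omega\times[0,T]$ be measurable, with time slices $D_t=\{x:(x,t)\in D\}$. Let $\mathbf b=\mathbf b(x)$ and $\mathbf a=\mathbf a(x,t)$ be measurable real symmetric $3\times3$ matrix functions such that, for some $\gamma>0$, $\gamma^{-1}|\xi|^2\le \mathbf b\xi\cdot\xi\le\gamma|\xi|^2$ on $\Omega$ and $\gamma^{-1}|\xi|^2\le \mathbf a\xi\cdot\xi\le\gamma|\xi|^2$ on $\Omega\times[0,T]$ for all $\xi\in\mathbb R^3$, and $\mathbf a=\mathbf b$ on $(\Omega\times[0,T])\setminus D$. Assume (H0b): there is $\delta_1>0$ such that $\mathbf b^{-1}-\mathbf a^{-1}\ge\delta_1$ and $\mathbf b-\mathbf a\le-\delta_1$ in $D$, in the sense of quadratic forms. Extend $\mathbf b$ by the identity matrix outside $\Omega$, write $\mathcal L_{\mathbf a}=\partial_t-\mathrm{div}(\mathbf a\nabla\,\cdot)$, $\mathcal L_{\mathbf b}=\partial_t-\mathrm{div}(\mathbf b\nabla\,\cdot)$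 ($\mathrm{div}$ and $\nabla$ in $x$ only), and let $G_y(x,t)$ be the fundamental solution of $\mathcal L_{\mathbf b}$ in $\mathbb R^3\times\mathbb R$: $\mathcal L_{\mathbf b}G_y=\delta_{(y,0)}$, $G_y=0$ for $t<0$. (Precisely, $G$ is jointly measurable and for every $f\in L^2(\mathbb R^3)$ the function $\int G_y(x,t)f(y)\,dy$, $t>0$, is the finite-energy weak solution of $\mathcal L_{\mathbf b}U=0$, $U|_{t=0}=f$.) Let $t\mapsto y(t)\in\mathbb R^3\setminus\overline{D_t}$ be Lipschitz on $[0,T]$, extended by $y(t)=y(0)$ for $t\le0$ and $y(t)=y(T)$ for $t\ge T$. Let $\theta\in(0,T)$, $\mu>0$, $\tau>0$, $M_0(r)=|1-r|\,1_{|r|\le1}$, $m_\tau(x,t)=M_0(\tau|x-y(t)|)$, and $$u_\tau(x,t)=\int_{\mathbb R}\int_{\mathbb R^3}e^{\tau^2(s+T)}e^{-\tau\mu|s-\theta|}m_\tau(z,s)G_z(x,t-s)\,dz\,ds,$$ $$u^*_\tau(x,t)=\int_{\mathbb R}\int_{\mathbb R^3}e^{-\tau^2(T+s)}e^{-\tau\mu|s-\theta|}m_\tau(z,s)G_z(x,s-t)\,dz\,ds,$$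 $$P_\tau(x,t)=\int_0^\infty\int_{\mathbb R^3}e^{-\tau^2s}m_\tau(z,t)G_z(x,s)\,dz\,ds,$$ $$q_\tau=e^{-\tau^2(T+t)}u_\tau-e^{-\tau\mu|t-\theta|}P_\tau,\qquad q^*_\tau=e^{\tau^2(T+t)}u^*_\tau-e^{-\tau\mu|t-\theta|}P_\tau .$$ For $v_0\in L^2(\Omega)$ let $v_\tau\in L^2(0,T;H^1(\Omega))\cap C([0,T];L^2(\Omega))$ be a weak solution of $\mathcal L_{\mathbf a}v_\tau=\mathcal L_{\mathbf b}u_\tau$ in $\Omega\times(0,T)$, $v_\tau=u_\tau$ on $\partial\Omega\times(0,T)$ (i.e. $v_\tau-u_\tau\in L^2(0,T;H^1_0(\Omega))$), $v_\tau|_{t=0}=v_0$. Put $w_\tau=v_\tau-u_\tau$ and $$I_\infty(\tau)=\int_{\Omega\times[0,T]}(\mathbf a-\mathbf b)\nabla v_\tau\cdot\nabla u_\tau^*\,dx\,dt+\int_\Omega\big[w_\tau u_\tau^*\big]_0^T\,dx .$$ **Statement.** There is a constant $C\ge1$, depending only on $T$, $\Omega$, $D$, $\mathbf a$, $\mathbf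 b$ (hence not on $\tau,\mu,\theta$, the curve $y$ or $v_0$), such that for all $\mu>0$, all $\tau>\mu+1$, all $\theta\in(0,T)$ and all $y$, $v_0$, $v_\tau$ as above: $u_\tau,u_\tau^*\in L^2(0,T;H^1(\Omega))\cap C([0,T];L^2(\Omega))$, $P_\tau\in L^2(0,T;H^1(\Omega))$, and $$I_\infty(\tau)\le C\int_D e^{-2\tau\mu|t-\theta|}|\nabla P_\tau|^2\,dx\,dt+C\int_D\big(|\nabla q_\tau|^2+|\nabla q^*_\tau|^2\big)\,dx\,dt+10\big(\|v_0\|^2_{L^2(\Omega)}+d_\Omega\big)e^{-\tau\mu\min(T-\theta,\theta)},$$ $$I_\infty(\tau)\ge \frac1C\int_D e^{-2\tau\mu|t-\theta|}|\nabla P_\tau|^2\,dx\,dt-C\int_D\big(|\nabla q_\tau|^2+|\nabla q^*_\tau|^2\big)\,dx\,dt-10\big(\|v_0\|^2_{L^2(\Omega)}+d_\Omega\big)e^{-\tau\mu\min(T-\theta,\theta)}.$$ -/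

import Mathlib

open MeasureTheory Set Filter Topology
open scoped ContDiff

noncomputable section

namespace HeatProbe

/-- Physical space `ℝ³` with its Euclidean norm. -/
abbrev E : Type := EuclideanSpace ℝ (Fin 3)

/-- Real `3 × 3` matrices. -/
abbrev Mat : Type := Matrix (Fin 3) (Fin 3) ℝ

/-! ### Conductivities -/

/-- The vector `A ξ`. -/
def app (A : Mat) (ξ : E) : E := Matrix.toEuclideanLin A ξ

/-- `A` is symmetric and `γ⁻¹ |ξ|² ≤ A ξ · ξ ≤ γ |ξ|²` for all `ξ`. -/
def IsElliptic (γ : ℝ) (A : Mat) : Prop :=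
  A.IsSymm ∧ ∀ ξ : E, γ⁻¹ * ‖ξ‖ ^ 2 ≤ inner ℝ (app A ξ) ξ ∧ inner ℝ (app A ξ) ξ ≤ γ * ‖ξ‖ ^ 2

/-- `c I ≤ A` in the sense of quadratic forms. -/
def GeScalar (A : Mat) (c : ℝ) : Prop := ∀ ξ : E, c * ‖ξ‖ ^ 2 ≤ inner ℝ (app A ξ) ξ

/-- `A ≤ c I` in the sense of quadratic forms. -/
def LeScalar (A : Mat) (c : ℝ) : Prop := ∀ ξ : E, inner ℝ (app A ξ) ξ ≤ c * ‖ξ‖ ^ 2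

/-- Hypothesis (H0b): `b⁻¹ - a⁻¹ ≥ δ₁` and `b - a ≤ -δ₁` in `D`. -/
def H0b (δ₁ : ℝ) (D : Set (E × ℝ)) (a : E × ℝ → Mat) (b : E → Mat) : Prop :=
  ∀ p ∈ D, GeScalar ((b p.1)⁻¹ - (a p)⁻¹) δ₁ ∧ LeScalar (b p.1 - a p) (-δ₁)

open Classical in
/-- The extension of `b` from `Ω` to `ℝ³` by the identity matrix. -/
def extendId (Ω : Set E) (b : E → Mat) (x : E) : Mat := if x ∈ Ω then b x else 1

/-! ### Function spaces on space-time -/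

/-- The cylinder `Ω × (0, T)`. -/
def cyl (Ω : Set E) (T : ℝ) : Set (E × ℝ) := Ω ×ˢ Ioo 0 T

/-- `φ ∈ C_c^∞(Q)`. -/
def IsTest (Q : Set (E × ℝ)) (φ : E × ℝ → ℝ) : Prop :=
  ContDiff ℝ ∞ φ ∧ HasCompactSupport φ ∧ tsupport φ ⊆ Q

/-- Classical spatial gradient of a smooth function of `(x, t)`. -/
def gradx (φ : E × ℝ → ℝ) (p : E × ℝ) : E := gradient (fun x => φ (x, p.2)) p.1

/-- Classical time derivative of a smooth function of `(x, t)`. -/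
def dt (φ : E × ℝ → ℝ) (p : E × ℝ) : ℝ := deriv (fun t => φ (p.1, t)) p.2

/-- `u ∈ L²(Q)` has the weak spatial gradient `g ∈ L²(Q)`. -/
def IsWeakGrad (Q : Set (E × ℝ)) (u : E × ℝ → ℝ) (g : E × ℝ → E) : Prop :=
  MemLp u 2 (volume.restrict Q) ∧ MemLp g 2 (volume.restrict Q) ∧
    ∀ φ, IsTest Q φ → ∫ p in Q, u p • gradx φ p = -∫ p in Q, φ p • g p

/-- `u ∈ H^{1,0}(Q)`; for a cylinder `Q = Ω × (0, T)` this is `L²(0, T; H¹(Ω))`. -/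
def MemH (Q : Set (E × ℝ)) (u : E × ℝ → ℝ) : Prop := ∃ g, IsWeakGrad Q u g

open Classical in
/-- The weak spatial gradient `∇u` in `Q` of `u ∈ H^{1,0}(Q)` (unique up to null sets). -/
def wgrad (Q : Set (E × ℝ)) (u : E × ℝ → ℝ) : E × ℝ → E :=
  if h : MemH Q u then h.choose else 0

/-- `u ∈ L²(0, T; H¹(Ω)) ∩ C([0, T]; L²(Ω))`. -/
def MemEnergy (Ω : Set E) (T : ℝ) (u : E × ℝ → ℝ) : Prop :=
  MemH (cyl Ω T) u ∧
  (∀ t ∈ Icc 0 T, MemLp (fun x => u (x, t)) 2 (volume.restrict Ω)) ∧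
  ∀ t ∈ Icc 0 T,
    Tendsto (fun s => eLpNorm (fun x => u (x, s) - u (x, t)) 2 (volume.restrict Ω))
      (𝓝[Icc 0 T] t) (𝓝 0)

/-- `w ∈ L²(0, T; H¹₀(Ω))`, i.e. `w = 0` on the lateral boundary `∂Ω × (0, T)`:
`w` is a limit in `L²(0, T; H¹(Ω))` of functions in `C_c^∞(Ω × (0, T))`. -/
def VanishesLaterally (Ω : Set E) (T : ℝ) (w : E × ℝ → ℝ) : Prop :=
  MemH (cyl Ω T) w ∧ ∃ φ : ℕ → E × ℝ → ℝ, (∀ n, IsTest (cyl Ω T) (φ n)) ∧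
    Tendsto (fun n => eLpNorm (fun p => φ n p - w p) 2 (volume.restrict (cyl Ω T)))
      atTop (𝓝 0) ∧
    Tendsto (fun n => eLpNorm (fun p => gradx (φ n) p - wgrad (cyl Ω T) w p) 2
      (volume.restrict (cyl Ω T))) atTop (𝓝 0)

/-! ### The heat operator in weak form -/

/-- The distribution `L_A u = ∂ₜ u - div (A ∇u)` on `Q`, tested against `φ ∈ C_c^∞(Q)`. -/
def heatOp (Q : Set (E × ℝ)) (A : E × ℝ → Mat) (u φ : E × ℝ → ℝ) : ℝ :=
  ∫ p in Q, (-(u p * dt φ p) + inner ℝ (app (A p) (wgrad Q u p)) (gradx φ p))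

/-- The superposition `∫ G_y(x, t) f(y) dy` for `t > 0`, completed by `f` for `t ≤ 0`. -/
def superpose (G : E → E → ℝ → ℝ) (f : E → ℝ) (p : E × ℝ) : ℝ :=
  if 0 < p.2 then ∫ y, G y p.1 p.2 * f y else f p.1

/-- `G y x t = G_y(x, t)` is the fundamental solution of `L_b = ∂ₜ - div (b ∇ ·)` in `ℝ³ × ℝ`:
`G_y = 0` for `t < 0` and `L_b G_y = δ_(y, 0)`. The second condition is taken superposed in `y`:
for all `f ∈ L²(ℝ³)`, `∫ G_y f(y) dy` is the weak (finite energy) solution of the Cauchy problem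
`L_b U = 0` for `t > 0`, `U = f` at `t = 0`. This determines `G` up to null sets. -/
structure IsFundamentalSolution (b : E → Mat) (G : E → E → ℝ → ℝ) : Prop where
  measurable : Measurable fun q : E × E × ℝ => G q.1 q.2.1 q.2.2
  causal : ∀ y x t, t < 0 → G y x t = 0
  integrable : ∀ f : E → ℝ, MemLp f 2 → ∀ t > 0, ∀ᵐ x, Integrable fun y => G y x t * f y
  energy : ∀ f : E → ℝ, MemLp f 2 → ∀ S > 0, MemEnergy univ S (superpose G f)
  equation : ∀ f : E → ℝ, MemLp f 2 → ∀ S > 0, ∀ φ, IsTest (cyl univ S) φ →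
    heatOp (cyl univ S) (fun p => b p.1) (superpose G f) φ = 0

/-! ### The special functions attached to a curve -/

/-- The curve `y`, given on `[0, T]`, extended to `ℝ` by `y(0)` on the left and `y(T)` on the
right. -/
def extendCurve (T : ℝ) (y : ℝ → E) (t : ℝ) : E := y (max 0 (min t T))

/-- `M₀(r) = |1 - r| 1_{|r| ≤ 1}`. -/
def M₀ (r : ℝ) : ℝ := if |r| ≤ 1 then |1 - r| else 0

/-- `m_τ(x, t) = M₀(τ |x - y(t)|)`. -/
def mτ (T : ℝ) (y : ℝ → E) (τ : ℝ) (x : E) (t : ℝ) : ℝ := M₀ (τ * ‖x - extendCurve T y t‖)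

/-- The special solution `u_τ`. -/
def uτ (G : E → E → ℝ → ℝ) (T : ℝ) (y : ℝ → E) (θ μ τ : ℝ) (p : E × ℝ) : ℝ :=
  ∫ s : ℝ, ∫ z : E, Real.exp (τ ^ 2 * (s + T)) * Real.exp (-(τ * μ * |s - θ|)) *
    mτ T y τ z s * G z p.1 (p.2 - s)

/-- The special solution `u_τ^*` of the backward equation. -/
def uτs (G : E → E → ℝ → ℝ) (T : ℝ) (y : ℝ → E) (θ μ τ : ℝ) (p : E × ℝ) : ℝ :=
  ∫ s : ℝ, ∫ z : E, Real.exp (-(τ ^ 2 * (T + s))) * Real.exp (-(τ * μ * |s - θ|)) *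
    mτ T y τ z s * G z p.1 (s - p.2)

/-- `P_τ(x, t) = ∫₀^∞ ∫ e^{-τ² s} m_τ(z, t) G_z(x, s) dz ds`. -/
def Pτ (G : E → E → ℝ → ℝ) (T : ℝ) (y : ℝ → E) (τ : ℝ) (p : E × ℝ) : ℝ :=
  ∫ s in Ioi (0 : ℝ), ∫ z : E, Real.exp (-(τ ^ 2 * s)) * mτ T y τ z p.2 * G z p.1 s

/-- `q_τ = e^{-τ² (T + t)} u_τ - e^{-τ μ |t - θ|} P_τ`. -/
def qτ (G : E → E → ℝ → ℝ) (T : ℝ) (y : ℝ → E) (θ μ τ : ℝ) (p : E × ℝ) : ℝ :=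
  Real.exp (-(τ ^ 2 * (T + p.2))) * uτ G T y θ μ τ p
    - Real.exp (-(τ * μ * |p.2 - θ|)) * Pτ G T y τ p

/-- `q_τ^* = e^{τ² (T + t)} u_τ^* - e^{-τ μ |t - θ|} P_τ`. -/
def qτs (G : E → E → ℝ → ℝ) (T : ℝ) (y : ℝ → E) (θ μ τ : ℝ) (p : E × ℝ) : ℝ :=
  Real.exp (τ ^ 2 * (T + p.2)) * uτs G T y θ μ τ p
    - Real.exp (-(τ * μ * |p.2 - θ|)) * Pτ G T y τ p

/-! ### The perturbed solution and the indicator function -/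

/-- `v` is a (weak) solution of `L_a v = L_b u` in `Ω × (0, T)`, `v = u` on `∂Ω × (0, T)`,
`v = v₀` at `t = 0`. -/
structure IsPerturbedSolution (Ω : Set E) (T : ℝ) (a : E × ℝ → Mat) (b : E → Mat)
    (u : E × ℝ → ℝ) (v₀ : E → ℝ) (v : E × ℝ → ℝ) : Prop where
  energy : MemEnergy Ω T v
  equation : ∀ φ, IsTest (cyl Ω T) φ →
    heatOp (cyl Ω T) a v φ = heatOp (cyl Ω T) (fun p => b p.1) u φ
  lateral : VanishesLaterally Ω T (fun p => v p - u p)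
  initial : ∀ᵐ x ∂(volume.restrict Ω), v (x, 0) = v₀ x

/-- The indicator function
`I_∞ = ∫_{Ω × [0, T]} (a - b) ∇v · ∇u^* dx dt + ∫_Ω [(v - u) u^*]_0^T dx`. -/
def indicatorI (Ω : Set E) (T : ℝ) (a : E × ℝ → Mat) (b : E → Mat) (u us v : E × ℝ → ℝ) : ℝ :=
  (∫ p in cyl Ω T,
      inner ℝ (app (a p - b p.1) (wgrad (cyl Ω T) v p)) (wgrad (cyl Ω T) us p)) +
    ∫ x in Ω, ((v (x, T) - u (x, T)) * us (x, T) - (v (x, 0) - u (x, 0)) * us (x, 0))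

/-- `∫_D e^{-2 τ μ |t - θ|} |∇P_τ|² dx dt`. -/
def mainTerm (G : E → E → ℝ → ℝ) (Ω : Set E) (D : Set (E × ℝ)) (T : ℝ) (y : ℝ → E)
    (θ μ τ : ℝ) : ℝ :=
  ∫ p in D, Real.exp (-(2 * τ * μ * |p.2 - θ|)) * ‖wgrad (cyl Ω T) (Pτ G T y τ) p‖ ^ 2

/-- `∫_D (|∇q_τ|² + |∇q_τ^*|²) dx dt`. -/
def remainder (G : E → E → ℝ → ℝ) (Ω : Set E) (D : Set (E × ℝ)) (T : ℝ) (y : ℝ → E)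
    (θ μ τ : ℝ) : ℝ :=
  ∫ p in D, (‖wgrad (cyl Ω T) (qτ G T y θ μ τ) p‖ ^ 2
    + ‖wgrad (cyl Ω T) (qτs G T y θ μ τ) p‖ ^ 2)

/-- `10 (‖v₀‖²_{L²(Ω)} + d_Ω) e^{-τ μ min(T - θ, θ)}`, where `d_Ω` is the diameter of `Ω`. -/
def boundaryTerm (Ω : Set E) (T : ℝ) (v₀ : E → ℝ) (θ μ τ : ℝ) : ℝ :=
  10 * ((∫ x in Ω, v₀ x ^ 2) + Metric.diam Ω) * Real.exp (-(τ * μ * min (T - θ) θ))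

end HeatProbe

end

open HeatProbe

open MeasureTheory Set Filter Topology
open scoped ContDiff

noncomputable section

namespace HeatProbe

/-! ### Linear algebra of conductivities -/

/-! Put `ρ = e^{-τ²(T+t)}`, `g = ρ ∇u_τ`, `k = ρ ∇w_τ` and `e = ρ⁻¹ ∇u_τ^* - g`. The weights cancel
in the indicator function, whose volume density becomes `(a - b)(g + k)·(g + e)`. The unknown here
is `k`, and the energy inequality for `ρ w_τ` controls it. This function solves a divergence form
equation with the extra zero-order term `τ² ρ w_τ`, which has the good sign. Hence `X = a k·k + (a -
b) g·k` satisfies `∫ X ≤ ½ ‖ρ w_τ(0)‖² - ½ ‖ρ w_τ(T)‖²`.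

Subtracting `X` from the density for the upper bound, and adding it for the lower bound, leaves
quadratic expressions from which `k` is eliminated pointwise. In the upper bound `-a k·k` absorbs
the product of `k` and `e` (`density_upper`). In the lower bound, completing the square in `k`
leaves a nonnegative square, products with `e`, and `(b⁻¹ - a⁻¹) bg·bg`, which (H0b) bounds below by
a multiple of `|g|²` (`density_lower`). Off `D` one has `a = b`, the density vanishes and `X = a k·k
≥ 0`, so both estimates localise on `D`. Finally `g = e^{-τμ|t-θ|} ∇P_τ + ∇q_τ` and `e = ∇q_τ^* -
∇q_τ` produce the main term and the remainder.

At the two ends in time, Young's inequality creates `½ ‖ρ w_τ(T)‖²`, which the energy inequality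
cancels. What is left involves `ρ w_τ` at `0` and `ρ⁻¹ u_τ^*` at `0` and `T`. By `uτ_eq` and
`uτs_eq`, `ρ u_τ` and `ρ⁻¹ u_τ^*` are potentials `∫₀^∞ ∫ e^{-τ² r} β(z, t ∓ r) G_z(x, r) dz dr` of
one source carrying the factor `e^{-τμ|s-θ|}`. The semigroup of `G` contracts `L²` and `L^∞`, so
these potentials are exponentially small there (`endpointBound_le`).

Two analytic facts carry this. The first is `IsDivSolution.energy_le`, an energy inequality for weak
solutions that have no time derivative in `L²`: the equation is tested with forward Steklov averages
and convexity replaces the chain rule. It is used with `r²/2` and with a smooth truncation for the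
semigroup, and with `r²/2` again for `ρ w_τ`. The second is that potentials have a spatial gradient
in `L²`. The hypothesis on `G` concerns initial data only, and gives `∫ ‖∇ S_r f‖² dr ≤ γ ‖f‖²` for
the evolution `S_r f` of data `f`. A source varying with `r` is reduced to frozen ones by summation
by parts (`norm_integral_diag_le`), its Lipschitz dependence on time bounding the total variation;
duality (`memH_of_norm_integral_le`) then yields the gradient. -/

lemma app_add (A : Mat) (ξ η : E) : app A (ξ + η) = app A ξ + app A η := by simp [app]

lemma app_sub (A : Mat) (ξ η : E) : app A (ξ - η) = app A ξ - app A η := by simp [app]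

lemma app_smul (A : Mat) (c : ℝ) (ξ : E) : app A (c • ξ) = c • app A ξ := by simp [app]

lemma sub_app (A B : Mat) (ξ : E) : app (A - B) ξ = app A ξ - app B ξ := by simp [app]

lemma app_mul (A B : Mat) (ξ : E) : app (A * B) ξ = app A (app B ξ) := by
  simp [app, Matrix.toLpLin_apply, Matrix.mulVec_mulVec]

lemma app_one (ξ : E) : app 1 ξ = ξ := by
  simp [app]

lemma app_apply (A : Mat) (ξ : E) (i : Fin 3) : app A ξ i = ∑ j, A i j * ξ j := by
  simp [app, Matrix.toLpLin_apply, Matrix.mulVec, dotProduct]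

lemma inner_eq_sum (ξ η : E) : inner ℝ ξ η = ∑ i, ξ i * η i := by
  simp [PiLp.inner_apply, mul_comm]

lemma inner_app_comm {A : Mat} (hA : A.IsSymm) (ξ η : E) :
    inner ℝ (app A ξ) η = inner ℝ ξ (app A η) := by
  simp only [inner_eq_sum, app_apply, Finset.sum_mul, Finset.mul_sum]
  rw [Finset.sum_comm]
  refine Finset.sum_congr rfl fun i _ => Finset.sum_congr rfl fun j _ => ?_
  rw [hA.apply]
  ring

namespace IsElliptic

variable {γ : ℝ} {A : Mat}

lemma nonneg (hγ : 0 < γ) (hA : IsElliptic γ A) (ξ : E) : 0 ≤ inner ℝ (app A ξ) ξ :=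
  le_trans (by positivity) (hA.2 ξ).1

/-- Cauchy–Schwarz for the form of `A`: nonnegativity of the polynomial `s ↦ A(ξ - sη)·(ξ - sη)`
with `η = Aξ` forces its discriminant to be nonpositive, so `|η|⁴ ≤ (Aη·η)(Aξ·ξ)`. No
diagonalisation is needed. -/
lemma norm_app_le (hγ : 0 < γ) (hA : IsElliptic γ A) (ξ : E) : ‖app A ξ‖ ≤ γ * ‖ξ‖ := by
  set η := app A ξ with hη
  have key : ∀ s : ℝ, 0 ≤ (inner ℝ (app A η) η) * (s * s) + (-(2 * ‖η‖ ^ 2)) * s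
      + inner ℝ (app A ξ) ξ := by
    intro s
    have h := hA.nonneg hγ (ξ - s • η)
    have h1 : inner ℝ (app A η) ξ = ‖η‖ ^ 2 := by
      rw [inner_app_comm hA.1, ← hη, real_inner_self_eq_norm_sq]
    have h2 : inner ℝ (app A ξ) η = ‖η‖ ^ 2 := by rw [← hη, real_inner_self_eq_norm_sq]
    simp only [app_sub, app_smul, inner_sub_left, inner_sub_right, inner_smul_left,
      inner_smul_right, h1, h2] at h
    simp only [conj_trivial] at h
    nlinarith
  have hd := discrim_le_zero key
  rw [discrim] at hd
  have hb1 := (hA.2 η).2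
  have hb2 := (hA.2 ξ).2
  have hn1 := hA.nonneg hγ η
  have h4 : ‖η‖ ^ 2 * ‖η‖ ^ 2 ≤ (γ * ‖η‖ ^ 2) * (γ * ‖ξ‖ ^ 2) := by
    have := mul_le_mul hb1 hb2 (hA.nonneg hγ ξ) (by positivity)
    nlinarith
  by_cases h0 : ‖η‖ = 0
  · rw [h0]; positivity
  have hpos : 0 < ‖η‖ ^ 2 := by positivity
  have h5 : ‖η‖ ^ 2 ≤ (γ * ‖ξ‖) ^ 2 := by
    have : ‖η‖ ^ 2 * ‖η‖ ^ 2 ≤ ‖η‖ ^ 2 * (γ * ‖ξ‖) ^ 2 := by nlinarith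
    exact le_of_mul_le_mul_left this hpos
  exact le_of_sq_le_sq h5 (by positivity)

lemma norm_le_app (hA : IsElliptic γ A) (ξ : E) : γ⁻¹ * ‖ξ‖ ≤ ‖app A ξ‖ := by
  by_cases h0 : ‖ξ‖ = 0
  · rw [h0]; simp
  have hpos : 0 < ‖ξ‖ := lt_of_le_of_ne (norm_nonneg _) (Ne.symm h0)
  have h1 := (hA.2 ξ).1
  have h2 := real_inner_le_norm (app A ξ) ξ
  have : ‖ξ‖ * (γ⁻¹ * ‖ξ‖) ≤ ‖ξ‖ * ‖app A ξ‖ := by nlinarith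
  exact le_of_mul_le_mul_left this hpos

lemma isUnit_det (hγ : 0 < γ) (hA : IsElliptic γ A) : IsUnit A.det := by
  rw [isUnit_iff_ne_zero]
  intro h
  obtain ⟨v, hv, hv0⟩ := Matrix.exists_mulVec_eq_zero_iff.2 h
  have h1 := hA.norm_le_app (WithLp.toLp 2 v)
  have h2 : app A (WithLp.toLp 2 v) = 0 := by
    simp [app, Matrix.toLpLin_apply, hv0]
  rw [h2, norm_zero] at h1
  have h3 : ‖WithLp.toLp 2 v‖ ≤ 0 := by
    have := inv_pos.2 hγ
    by_contra hc
    push Not at hc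
    nlinarith [mul_pos this hc]
  apply hv
  have h4 := norm_le_zero_iff.1 h3
  simpa using h4

lemma app_app_inv (hγ : 0 < γ) (hA : IsElliptic γ A) (ξ : E) : app A (app A⁻¹ ξ) = ξ := by
  rw [← app_mul, Matrix.mul_nonsing_inv _ (hA.isUnit_det hγ), app_one]

lemma app_inv_app (hγ : 0 < γ) (hA : IsElliptic γ A) (ξ : E) : app A⁻¹ (app A ξ) = ξ := by
  rw [← app_mul, Matrix.nonsing_inv_mul _ (hA.isUnit_det hγ), app_one]

lemma mono {γ' : ℝ} (hγ : 0 < γ) (hγ' : γ ≤ γ') (hA : IsElliptic γ A) : IsElliptic γ' A := by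
  refine ⟨hA.1, fun ξ => ⟨le_trans ?_ (hA.2 ξ).1, (hA.2 ξ).2.trans ?_⟩⟩ <;> gcongr

end IsElliptic

lemma isElliptic_one {γ : ℝ} (hγ : 1 ≤ γ) : IsElliptic γ 1 := by
  refine ⟨Matrix.isSymm_one, fun ξ => ?_⟩
  rw [app_one, real_inner_self_eq_norm_sq]
  exact ⟨mul_le_of_le_one_left (by positivity) (inv_le_one_of_one_le₀ hγ),
    le_mul_of_one_le_left (by positivity) hγ⟩

/-! ### Pointwise estimates for the density of the indicator function -/

lemma abs_inner_sub_app_le {γ : ℝ} {A B : Mat} (hγ : 0 < γ) (hA : IsElliptic γ A)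
    (hB : IsElliptic γ B) (ξ η : E) : |inner ℝ (app (A - B) ξ) η| ≤ 2 * γ * (‖ξ‖ * ‖η‖) := by
  refine (abs_real_inner_le_norm _ _).trans ?_
  rw [sub_app]
  have h := (norm_sub_le (app A ξ) (app B ξ)).trans
    (add_le_add (hA.norm_app_le hγ ξ) (hB.norm_app_le hγ ξ))
  nlinarith [mul_le_mul_of_nonneg_right h (norm_nonneg η)]

/-- Pointwise upper bound for the density of the indicator function. -/
lemma density_upper {γ : ℝ} (hγ : 0 < γ) : ∃ C, 0 ≤ C ∧ ∀ A B : Mat, IsElliptic γ A →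
    IsElliptic γ B → ∀ g k e : E,
      inner ℝ (app (A - B) (g + k)) (g + e) - inner ℝ (app A k) k - inner ℝ (app (A - B) g) k
        ≤ C * (‖g‖ ^ 2 + ‖e‖ ^ 2) := by
  refine ⟨3 * γ + γ ^ 3, by positivity, fun A B hA hB g k e => ?_⟩
  have hsymm : (A - B).IsSymm := hA.1.sub hB.1
  have e1 : inner ℝ (app (A - B) (g + k)) (g + e) - inner ℝ (app A k) k
      - inner ℝ (app (A - B) g) k = inner ℝ (app (A - B) g) g + inner ℝ (app (A - B) g) e
        + inner ℝ (app (A - B) k) e - inner ℝ (app A k) k := by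
    have : inner ℝ (app (A - B) k) g = inner ℝ (app (A - B) g) k := by
      rw [inner_app_comm hsymm, real_inner_comm]
    rw [app_add, inner_add_left, inner_add_right, inner_add_right, this]
    ring
  rw [e1]
  have h1 := (abs_le.1 (abs_inner_sub_app_le hγ hA hB g g)).2
  have h2 := (abs_le.1 (abs_inner_sub_app_le hγ hA hB g e)).2
  have h3 := (abs_le.1 (abs_inner_sub_app_le hγ hA hB k e)).2
  have h4 := (hA.2 k).1
  -- The weight in Young's inequality is chosen so that its `k` part is exactly the coercive lower
  -- bound of `A k · k`, which then cancels it.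
  have h5 : 2 * γ * (‖k‖ * ‖e‖) ≤ γ⁻¹ * ‖k‖ ^ 2 + γ ^ 3 * ‖e‖ ^ 2 := by
    have : γ⁻¹ * ‖k‖ ^ 2 + γ ^ 3 * ‖e‖ ^ 2 - 2 * γ * (‖k‖ * ‖e‖)
        = γ⁻¹ * (‖k‖ - γ ^ 2 * ‖e‖) ^ 2 := by field_simp; ring
    have : 0 ≤ γ⁻¹ * (‖k‖ - γ ^ 2 * ‖e‖) ^ 2 := by positivity
    linarith
  have h6 : 2 * γ * (‖g‖ * ‖e‖) ≤ γ * ‖g‖ ^ 2 + γ * ‖e‖ ^ 2 := by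
    nlinarith [mul_nonneg hγ.le (sq_nonneg (‖g‖ - ‖e‖))]
  have h7 : 0 ≤ γ ^ 3 * ‖g‖ ^ 2 := by positivity
  have h8 : 0 ≤ γ * ‖e‖ ^ 2 := by positivity
  nlinarith

/-- Pointwise lower bound for the density of the indicator function. -/
lemma density_lower {γ δ : ℝ} (hγ : 0 < γ) (hδ : 0 < δ) : ∃ c C, 0 < c ∧ 0 ≤ C ∧ ∀ A B : Mat,
    IsElliptic γ A → IsElliptic γ B → GeScalar (B⁻¹ - A⁻¹) δ → ∀ g k e : E,
      c * ‖g‖ ^ 2 - C * ‖e‖ ^ 2 ≤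
        inner ℝ (app (A - B) (g + k)) (g + e) + inner ℝ (app A k) k
          + inner ℝ (app (A - B) g) k := by
  set c₀ := δ * (γ⁻¹) ^ 2 with hc₀
  have hc₀pos : 0 < c₀ := by positivity
  refine ⟨c₀ / 2, 2 * γ ^ 6 / c₀ + γ ^ 3, by positivity, by positivity,
    fun A B hA hB hAB g k e => ?_⟩
  have hsymm : (A - B).IsSymm := hA.1.sub hB.1
  -- As a quadratic in `g + k`, the part free of `e` is minimised at `s₀ = A⁻¹ B g`. Its minimum is
  -- the form of `B⁻¹ - A⁻¹` at `B g`, and the excess is `A d · d`.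
  obtain ⟨s₀, hs₀⟩ : ∃ s₀, s₀ = app A⁻¹ (app B g) := ⟨_, rfl⟩
  obtain ⟨d, hd⟩ : ∃ d, d = g + k - s₀ := ⟨_, rfl⟩
  have hAs₀ : app A s₀ = app B g := by rw [hs₀, hA.app_app_inv hγ]
  have hgk : g + k = s₀ + d := by rw [hd]; abel
  have hk : k = s₀ + d - g := by rw [← hgk]; abel
  have hs₀n : ‖s₀‖ ≤ γ ^ 2 * ‖g‖ := by
    have h1 := hA.norm_le_app s₀
    rw [hAs₀] at h1
    have h2 := hB.norm_app_le hγ g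
    have h3 : γ⁻¹ * ‖s₀‖ ≤ γ * ‖g‖ := h1.trans h2
    calc ‖s₀‖ = γ * (γ⁻¹ * ‖s₀‖) := by field_simp
      _ ≤ γ * (γ * ‖g‖) := by gcongr
      _ = γ ^ 2 * ‖g‖ := by ring
  have hmain : inner ℝ (app (A - B) (g + k)) (g + e) + inner ℝ (app A k) k
      + inner ℝ (app (A - B) g) k
      = inner ℝ (app (B⁻¹ - A⁻¹) (app B g)) (app B g) + inner ℝ (app A d) d
        + inner ℝ (app (A - B) s₀) e + inner ℝ (app (A - B) d) e := by
    have i1 : inner ℝ (app A d) s₀ = inner ℝ (app B g) d := by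
      rw [inner_app_comm hA.1, hAs₀, real_inner_comm]
    have i2 : inner ℝ (app A g) s₀ = inner ℝ (app B g) g := by
      rw [inner_app_comm hA.1, hAs₀, real_inner_comm]
    have i3 : inner ℝ (app A d) g = inner ℝ (app A g) d := by
      rw [inner_app_comm hA.1, real_inner_comm]
    have i4 : inner ℝ (app B d) g = inner ℝ (app B g) d := by
      rw [inner_app_comm hB.1, real_inner_comm]
    have i5 : inner ℝ (app B s₀) g = inner ℝ (app B g) s₀ := by
      rw [inner_app_comm hB.1, real_inner_comm]
    have i6 : inner ℝ s₀ (app B g) = inner ℝ (app B g) s₀ := real_inner_comm _ _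
    have i7 : inner ℝ g (app B g) = inner ℝ (app B g) g := real_inner_comm _ _
    rw [sub_app (B⁻¹), hB.app_inv_app hγ, ← hs₀, hgk, hk]
    simp only [sub_app, app_add, app_sub, inner_add_left, inner_add_right, inner_sub_left,
      inner_sub_right, hAs₀, i1, i2, i3, i4, i5, i6, i7]
    ring
  rw [hmain]
  have h1 := hAB (app B g)
  have h2 : c₀ * ‖g‖ ^ 2 ≤ δ * ‖app B g‖ ^ 2 := by
    have := hB.norm_le_app g
    have h' : (γ⁻¹ * ‖g‖) ^ 2 ≤ ‖app B g‖ ^ 2 := by gcongr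
    calc c₀ * ‖g‖ ^ 2 = δ * (γ⁻¹ * ‖g‖) ^ 2 := by rw [hc₀]; ring
      _ ≤ _ := by gcongr
  have h3 := (hA.2 d).1
  have h4 := (abs_le.1 (abs_inner_sub_app_le hγ hA hB s₀ e)).1
  have h5 := (abs_le.1 (abs_inner_sub_app_le hγ hA hB d e)).1
  have h6 : 2 * γ * (‖d‖ * ‖e‖) ≤ γ⁻¹ * ‖d‖ ^ 2 + γ ^ 3 * ‖e‖ ^ 2 := by
    have : γ⁻¹ * ‖d‖ ^ 2 + γ ^ 3 * ‖e‖ ^ 2 - 2 * γ * (‖d‖ * ‖e‖)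
        = γ⁻¹ * (‖d‖ - γ ^ 2 * ‖e‖) ^ 2 := by field_simp; ring
    have : 0 ≤ γ⁻¹ * (‖d‖ - γ ^ 2 * ‖e‖) ^ 2 := by positivity
    linarith
  -- Half of `c₀ ‖g‖²` absorbs the product of `s₀` with `e`; the other half is the constant `c` of
  -- the conclusion.
  have h7 : 2 * γ * (‖s₀‖ * ‖e‖) ≤ c₀ / 2 * ‖g‖ ^ 2 + 2 * γ ^ 6 / c₀ * ‖e‖ ^ 2 := by
    have hle : 2 * γ * (‖s₀‖ * ‖e‖) ≤ 2 * γ * ((γ ^ 2 * ‖g‖) * ‖e‖) := by gcongr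
    have : c₀ / 2 * ‖g‖ ^ 2 + 2 * γ ^ 6 / c₀ * ‖e‖ ^ 2 - 2 * γ * ((γ ^ 2 * ‖g‖) * ‖e‖)
        = (2 * c₀)⁻¹ * (c₀ * ‖g‖ - 2 * γ ^ 3 * ‖e‖) ^ 2 := by field_simp; ring
    have : 0 ≤ (2 * c₀)⁻¹ * (c₀ * ‖g‖ - 2 * γ ^ 3 * ‖e‖) ^ 2 := by positivity
    linarith
  linarith

/-! ### Square-integrable functions -/

section L2

variable {α β : Type*} [MeasurableSpace α] [MeasurableSpace β] {μ : Measure α} {ν : Measure β}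

lemma eLpNorm_two_sq {F : Type*} [NormedAddCommGroup F] (f : α → F) :
    eLpNorm f 2 μ ^ 2 = ∫⁻ x, ‖f x‖ₑ ^ 2 ∂μ := by
  have := eLpNorm_nnreal_pow_eq_lintegral (μ := μ) (f := f) (p := 2) (by norm_num)
  simpa using this

lemma integral_norm_sq {F : Type*} [NormedAddCommGroup F] {f : α → F} (hf : MemLp f 2 μ) :
    ∫ x, ‖f x‖ ^ 2 ∂μ = (eLpNorm f 2 μ).toReal ^ 2 := by
  rw [← ENNReal.toReal_pow, eLpNorm_two_sq, integral_eq_lintegral_of_nonneg_ae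
    (f := fun x => ‖f x‖ ^ 2) (ae_of_all _ fun x => by positivity) (hf.1.norm.pow 2)]
  congr 1
  refine lintegral_congr fun x => ?_
  rw [ENNReal.ofReal_pow (norm_nonneg _), ofReal_norm]

variable {F : Type*} [NormedAddCommGroup F] [InnerProductSpace ℝ F]

lemma integrable_inner_of_memLp {f g : α → F} (hf : MemLp f 2 μ) (hg : MemLp g 2 μ) :
    Integrable (fun x => inner ℝ (f x) (g x)) μ := by
  refine (L2.integrable_inner (𝕜 := ℝ) (hf.toLp f) (hg.toLp g)).congr ?_
  filter_upwards [hf.coeFn_toLp, hg.coeFn_toLp] with x h1 h2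
  rw [h1, h2]

lemma inner_toLp {f g : α → F} (hf : MemLp f 2 μ) (hg : MemLp g 2 μ) :
    inner ℝ (hf.toLp f) (hg.toLp g) = ∫ x, inner ℝ (f x) (g x) ∂μ := by
  rw [L2.inner_def]
  refine integral_congr_ae ?_
  filter_upwards [hf.coeFn_toLp, hg.coeFn_toLp] with x h1 h2
  rw [h1, h2]

lemma abs_integral_inner_le {f g : α → F} (hf : MemLp f 2 μ) (hg : MemLp g 2 μ) :
    |∫ x, inner ℝ (f x) (g x) ∂μ| ≤ (eLpNorm f 2 μ).toReal * (eLpNorm g 2 μ).toReal := by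
  rw [← inner_toLp hf hg, ← Lp.norm_toLp f hf, ← Lp.norm_toLp g hg]
  exact abs_real_inner_le_norm _ _

lemma abs_integral_mul_le {f g : α → ℝ} (hf : MemLp f 2 μ) (hg : MemLp g 2 μ) :
    |∫ x, f x * g x ∂μ| ≤ (eLpNorm f 2 μ).toReal * (eLpNorm g 2 μ).toReal := by
  have := abs_integral_inner_le hf hg
  simpa [mul_comm] using this

lemma integrable_smul_of_memLp {f : α → ℝ} {g : α → F} (hf : MemLp f 2 μ) (hg : MemLp g 2 μ) :
    Integrable (fun x => f x • g x) μ := by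
  rw [← memLp_one_iff_integrable]
  exact hg.smul hf

/-- Cauchy–Schwarz for `f = w^{1/2} · f w^{-1/2}`. In Minkowski's inequality `w` majorises the `L²`
norms of the slices; a majorant that is nowhere `0` or `∞` avoids dividing by the norms themselves.
-/
lemma lintegral_sq_le {f w : β → ENNReal} (hf : AEMeasurable f ν) (hw : Measurable w)
    (h0 : ∀ y, w y ≠ 0) (htop : ∀ y, w y ≠ ⊤) :
    (∫⁻ y, f y ∂ν) ^ 2 ≤ (∫⁻ y, w y ∂ν) * ∫⁻ y, f y ^ 2 * (w y)⁻¹ ∂ν := by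
  have h := ENNReal.lintegral_mul_le_Lp_mul_Lq ν (p := 2) (q := 2)
    (Real.HolderConjugate.two_two) (f := fun y => w y ^ (1 / 2 : ℝ))
    (g := fun y => f y * (w y)⁻¹ ^ (1 / 2 : ℝ)) (by fun_prop) (by fun_prop)
  have e1 : ∀ y, ((fun y => w y ^ (1 / 2 : ℝ)) * fun y => f y * (w y)⁻¹ ^ (1 / 2 : ℝ)) y = f y := by
    intro y
    simp only [Pi.mul_apply]
    rw [mul_left_comm, ← ENNReal.mul_rpow_of_nonneg _ _ (by norm_num),
      ENNReal.mul_inv_cancel (h0 y) (htop y), ENNReal.one_rpow, mul_one]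
  have e2 : ∀ y, (w y ^ (1 / 2 : ℝ)) ^ (2 : ℝ) = w y := fun y => by
    rw [← ENNReal.rpow_mul]; norm_num
  have e3 : ∀ y, (f y * (w y)⁻¹ ^ (1 / 2 : ℝ)) ^ (2 : ℝ) = f y ^ 2 * (w y)⁻¹ := fun y => by
    rw [ENNReal.mul_rpow_of_nonneg _ _ (by norm_num), ← ENNReal.rpow_mul]; norm_num
  simp_rw [e1, e2, e3] at h
  calc (∫⁻ y, f y ∂ν) ^ 2 ≤ ((∫⁻ y, w y ∂ν) ^ (1 / 2 : ℝ)
        * (∫⁻ y, f y ^ 2 * (w y)⁻¹ ∂ν) ^ (1 / 2 : ℝ)) ^ 2 := by gcongr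
    _ = _ := by
      rw [mul_pow, ← ENNReal.rpow_natCast, ← ENNReal.rpow_natCast, ← ENNReal.rpow_mul,
        ← ENNReal.rpow_mul]
      norm_num

omit [InnerProductSpace ℝ F] in
-- After the weighted Cauchy–Schwarz inequality the integrals are exchanged, and the inner one is at
-- most `w² w⁻¹ = w`. With the norm inside, the estimate gives both Minkowski's inequality and
-- integrability in `y` for almost every `x`.
lemma lintegral_lintegral_sq_le [SFinite μ] [SFinite ν] {h : α × β → F}
    (hh : AEStronglyMeasurable h (μ.prod ν)) {w : β → ENNReal} (hw : Measurable w)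
    (h0 : ∀ y, w y ≠ 0) (htop : ∀ y, w y ≠ ⊤)
    (hM : ∀ᵐ y ∂ν, eLpNorm (fun x => h (x, y)) 2 μ ≤ w y) :
    ∫⁻ x, (∫⁻ y, ‖h (x, y)‖ₑ ∂ν) ^ 2 ∂μ ≤ (∫⁻ y, w y ∂ν) ^ 2 := by
  have hm : AEMeasurable (fun p : α × β => ‖h p‖ₑ ^ 2 * (w p.2)⁻¹) (μ.prod ν) := by
    have := hh.enorm
    fun_prop
  calc ∫⁻ x, (∫⁻ y, ‖h (x, y)‖ₑ ∂ν) ^ 2 ∂μ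
      ≤ ∫⁻ x, (∫⁻ y, w y ∂ν) * ∫⁻ y, ‖h (x, y)‖ₑ ^ 2 * (w y)⁻¹ ∂ν ∂μ := by
        refine lintegral_mono_ae ?_
        filter_upwards [hh.prodMk_left] with x hx
        exact lintegral_sq_le hx.enorm hw h0 htop
    _ = (∫⁻ y, w y ∂ν) * ∫⁻ y, ∫⁻ x, ‖h (x, y)‖ₑ ^ 2 * (w y)⁻¹ ∂μ ∂ν := by
        rw [lintegral_const_mul'' _ hm.lintegral_prod_right', lintegral_lintegral_swap hm]
    _ ≤ (∫⁻ y, w y ∂ν) * ∫⁻ y, w y ∂ν := by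
        gcongr 1
        refine lintegral_mono_ae ?_
        filter_upwards [hM] with y hy
        rw [lintegral_mul_const' _ _ (ENNReal.inv_ne_top.2 (h0 y)), ← eLpNorm_two_sq]
        calc eLpNorm (fun x => h (x, y)) 2 μ ^ 2 * (w y)⁻¹ ≤ w y ^ 2 * (w y)⁻¹ := by gcongr
          _ = w y := by rw [sq, mul_assoc, ENNReal.mul_inv_cancel (h0 y) (htop y), mul_one]
    _ = _ := by rw [sq]

/-- Minkowski's integral inequality in `L²`. -/
lemma eLpNorm_integral_le [SFinite μ] [SFinite ν] {h : α × β → F}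
    (hh : AEStronglyMeasurable h (μ.prod ν)) {w : β → ENNReal} (hw : Measurable w)
    (h0 : ∀ y, w y ≠ 0) (htop : ∀ y, w y ≠ ⊤)
    (hM : ∀ᵐ y ∂ν, eLpNorm (fun x => h (x, y)) 2 μ ≤ w y) :
    eLpNorm (fun x => ∫ y, h (x, y) ∂ν) 2 μ ≤ ∫⁻ y, w y ∂ν := by
  refine (ENNReal.pow_right_strictMono two_ne_zero).le_iff_le.1
    (le_trans ?_ (lintegral_lintegral_sq_le hh hw h0 htop hM))
  rw [eLpNorm_two_sq]
  exact lintegral_mono fun x => by gcongr; exact enorm_integral_le_lintegral_enorm _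

lemma ae_integrable_of_eLpNorm_le [SFinite μ] [SFinite ν] {h : α × β → F}
    (hh : AEStronglyMeasurable h (μ.prod ν)) {w : β → ENNReal} (hw : Measurable w)
    (h0 : ∀ y, w y ≠ 0) (htop : ∀ y, w y ≠ ⊤) (hfin : ∫⁻ y, w y ∂ν ≠ ⊤)
    (hM : ∀ᵐ y ∂ν, eLpNorm (fun x => h (x, y)) 2 μ ≤ w y) :
    ∀ᵐ x ∂μ, Integrable (fun y => h (x, y)) ν := by
  have h1 := lintegral_lintegral_sq_le hh hw h0 htop hM
  have h2 : ∫⁻ x, (∫⁻ y, ‖h (x, y)‖ₑ ∂ν) ^ 2 ∂μ ≠ ⊤ :=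
    ne_top_of_le_ne_top (ENNReal.pow_ne_top hfin) h1
  have h3 : AEMeasurable (fun x => (∫⁻ y, ‖h (x, y)‖ₑ ∂ν) ^ 2) μ :=
    (hh.enorm.lintegral_prod_right').pow_const 2
  filter_upwards [ae_lt_top' h3 h2, hh.prodMk_left] with x hx hx'
  refine ⟨hx', ?_⟩
  rw [hasFiniteIntegral_iff_enorm]
  by_contra hc
  simp [not_lt_top_iff.1 hc] at hx

end L2

/-! ### Derivatives of test functions -/

lemma gradx_eq {φ : E × ℝ → ℝ} (hφ : ContDiff ℝ ∞ φ) (p : E × ℝ) :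
    gradx φ p = (InnerProductSpace.toDual ℝ E).symm
      ((fderiv ℝ φ p).comp (ContinuousLinearMap.inl ℝ E ℝ)) := by
  have h : HasFDerivAt (fun x : E => φ (x, p.2))
      ((fderiv ℝ φ p).comp (ContinuousLinearMap.inl ℝ E ℝ)) p.1 := by
    have h1 : HasFDerivAt φ (fderiv ℝ φ p) (p.1, p.2) :=
      ((hφ.differentiable (by simp)) p).hasFDerivAt
    exact h1.comp p.1 (hasFDerivAt_prodMk_left p.1 p.2)
  rw [gradx, gradient, h.fderiv]

lemma inner_gradx {φ : E × ℝ → ℝ} (hφ : ContDiff ℝ ∞ φ) (p : E × ℝ) (v : E) :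
    inner ℝ (gradx φ p) v = fderiv ℝ φ p (v, 0) := by
  rw [gradx_eq hφ, InnerProductSpace.toDual_symm_apply]
  simp

lemma dt_eq {φ : E × ℝ → ℝ} (hφ : ContDiff ℝ ∞ φ) (p : E × ℝ) : dt φ p = fderiv ℝ φ p (0, 1) := by
  have h1 : HasFDerivAt φ (fderiv ℝ φ p) (p.1, p.2) :=
    ((hφ.differentiable (by simp)) p).hasFDerivAt
  have h : HasDerivAt (fun t : ℝ => φ (p.1, t)) (fderiv ℝ φ p (0, 1)) p.2 := by
    have := h1.comp p.2 (hasFDerivAt_prodMk_right p.1 p.2)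
    simpa [Function.comp_def] using this.hasDerivAt
  exact h.deriv

lemma contDiff_gradx {φ : E × ℝ → ℝ} (hφ : ContDiff ℝ ∞ φ) : ContDiff ℝ ∞ (gradx φ) := by
  have h : gradx φ = fun p => (InnerProductSpace.toDual ℝ E).symm
      ((fderiv ℝ φ p).comp (ContinuousLinearMap.inl ℝ E ℝ)) := funext (gradx_eq hφ)
  rw [h]
  refine (InnerProductSpace.toDual ℝ E).symm.contDiff.comp ?_
  exact ((hφ.fderiv_right (m := ∞) (by simp)).clm_comp contDiff_const)

lemma contDiff_dt {φ : E × ℝ → ℝ} (hφ : ContDiff ℝ ∞ φ) : ContDiff ℝ ∞ (dt φ) := by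
  have h : dt φ = fun p => fderiv ℝ φ p (0, 1) := funext (dt_eq hφ)
  rw [h]
  exact (hφ.fderiv_right (m := ∞) (by simp)).clm_apply contDiff_const

lemma tsupport_gradx_subset {φ : E × ℝ → ℝ} (hφ : ContDiff ℝ ∞ φ) :
    tsupport (gradx φ) ⊆ tsupport φ := by
  refine closure_minimal (fun p hp => ?_) (isClosed_tsupport φ)
  refine support_fderiv_subset ℝ fun h => hp ?_
  rw [gradx_eq hφ, h]; simp

lemma tsupport_dt_subset {φ : E × ℝ → ℝ} (hφ : ContDiff ℝ ∞ φ) :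
    tsupport (dt φ) ⊆ tsupport φ := by
  refine closure_minimal (fun p hp => ?_) (isClosed_tsupport φ)
  refine support_fderiv_subset ℝ fun h => hp ?_
  rw [dt_eq hφ, h]; simp

lemma gradx_add {φ ψ : E × ℝ → ℝ} (hφ : ContDiff ℝ ∞ φ) (hψ : ContDiff ℝ ∞ ψ) (p : E × ℝ) :
    gradx (fun p => φ p + ψ p) p = gradx φ p + gradx ψ p := by
  refine ext_inner_right ℝ fun v => ?_
  rw [inner_gradx (hφ.add hψ), inner_add_left, inner_gradx hφ, inner_gradx hψ,
    fderiv_fun_add (hφ.differentiable (by simp) p) (hψ.differentiable (by simp) p)]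
  rfl

lemma gradx_mul {φ ψ : E × ℝ → ℝ} (hφ : ContDiff ℝ ∞ φ) (hψ : ContDiff ℝ ∞ ψ) (p : E × ℝ) :
    gradx (fun p => φ p * ψ p) p = φ p • gradx ψ p + ψ p • gradx φ p := by
  refine ext_inner_right ℝ fun v => ?_
  rw [inner_gradx (hφ.mul hψ), inner_add_left, inner_smul_left, inner_smul_left,
    inner_gradx hφ, inner_gradx hψ,
    fderiv_fun_mul (hφ.differentiable (by simp) p) (hψ.differentiable (by simp) p)]
  simp

lemma dt_mul {φ ψ : E × ℝ → ℝ} (hφ : ContDiff ℝ ∞ φ) (hψ : ContDiff ℝ ∞ ψ) (p : E × ℝ) :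
    dt (fun p => φ p * ψ p) p = φ p * dt ψ p + ψ p * dt φ p := by
  rw [dt_eq (hφ.mul hψ), dt_eq hφ, dt_eq hψ,
    fderiv_fun_mul (hφ.differentiable (by simp) p) (hψ.differentiable (by simp) p)]
  simp

lemma contDiff_comp_snd {κ : ℝ → ℝ} (hκ : ContDiff ℝ ∞ κ) :
    ContDiff ℝ ∞ fun p : E × ℝ => κ p.2 := hκ.comp contDiff_snd

lemma gradx_comp_snd (κ : ℝ → ℝ) (p : E × ℝ) : gradx (fun p => κ p.2) p = 0 := by
  simp [gradx, gradient]

lemma gradx_timeMul {κ : ℝ → ℝ} {φ : E × ℝ → ℝ} (hκ : ContDiff ℝ ∞ κ) (hφ : ContDiff ℝ ∞ φ)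
    (p : E × ℝ) : gradx (fun p => κ p.2 * φ p) p = κ p.2 • gradx φ p := by
  rw [gradx_mul (contDiff_comp_snd hκ) hφ, gradx_comp_snd]; simp

lemma dt_timeMul {κ : ℝ → ℝ} {φ : E × ℝ → ℝ} (hκ : ContDiff ℝ ∞ κ) (hφ : ContDiff ℝ ∞ φ)
    (p : E × ℝ) : dt (fun p => κ p.2 * φ p) p = κ p.2 * dt φ p + deriv κ p.2 * φ p := by
  rw [dt_mul (contDiff_comp_snd hκ) hφ]
  have : dt (fun p : E × ℝ => κ p.2) p = deriv κ p.2 := rfl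
  rw [this]; ring

lemma gradx_comp {φ : E × ℝ → ℝ} {ψ : ℝ → ℝ} (hφ : ContDiff ℝ ∞ φ) (hψ : ContDiff ℝ ∞ ψ)
    (p : E × ℝ) : gradx (fun p => ψ (φ p)) p = deriv ψ (φ p) • gradx φ p := by
  refine ext_inner_right ℝ fun v => ?_
  rw [inner_gradx (φ := fun p => ψ (φ p)) (hψ.comp hφ), inner_smul_left, inner_gradx hφ]
  have h := ((hψ.differentiable (by simp) (φ p)).hasDerivAt.comp_hasFDerivAt p
    (hφ.differentiable (by simp) p).hasFDerivAt)
  have h' : fderiv ℝ (fun p => ψ (φ p)) p = deriv ψ (φ p) • fderiv ℝ φ p := h.fderiv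
  rw [h']; simp

namespace IsTest

variable {Q : Set (E × ℝ)} {φ ψ : E × ℝ → ℝ}

lemma contDiff (h : IsTest Q φ) : ContDiff ℝ ∞ φ := h.1

lemma mono {Q' : Set (E × ℝ)} (h : IsTest Q φ) (hQ : Q ⊆ Q') : IsTest Q' φ :=
  ⟨h.1, h.2.1, h.2.2.trans hQ⟩

lemma mul_left (hψ : IsTest Q ψ) (hφ : ContDiff ℝ ∞ φ) : IsTest Q fun p => φ p * ψ p :=
  ⟨hφ.mul hψ.1, hψ.2.1.mul_left, (tsupport_mul_subset_right).trans hψ.2.2⟩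

lemma add (hφ : IsTest Q φ) (hψ : IsTest Q ψ) : IsTest Q fun p => φ p + ψ p :=
  ⟨hφ.1.add hψ.1, hφ.2.1.add hψ.2.1,
    (tsupport_add φ ψ).trans (union_subset hφ.2.2 hψ.2.2)⟩

lemma const_mul (hφ : IsTest Q φ) (c : ℝ) : IsTest Q fun p => c * φ p :=
  hφ.mul_left contDiff_const

lemma comp_left {κ : ℝ → ℝ} (hφ : IsTest Q φ) (hκ : ContDiff ℝ ∞ κ) (h0 : κ 0 = 0) :
    IsTest Q fun p => κ (φ p) := by
  have hs : Function.support (fun p => κ (φ p)) ⊆ Function.support φ := by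
    intro p hp h
    simp only [Function.mem_support, ne_eq] at hp
    exact hp (by rw [h, h0])
  exact ⟨hκ.comp hφ.1, hφ.2.1.comp_left h0, (closure_mono hs).trans hφ.2.2⟩

lemma hasCompactSupport_gradx (hφ : IsTest Q φ) : HasCompactSupport (gradx φ) :=
  hφ.2.1.of_isClosed_subset (isClosed_tsupport _) (tsupport_gradx_subset hφ.1)

lemma hasCompactSupport_dt (hφ : IsTest Q φ) : HasCompactSupport (dt φ) :=
  hφ.2.1.of_isClosed_subset (isClosed_tsupport _) (tsupport_dt_subset hφ.1)

lemma memLp (hφ : IsTest Q φ) (s : Set (E × ℝ)) : MemLp φ 2 (volume.restrict s) :=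
  (hφ.1.continuous.memLp_of_hasCompactSupport hφ.2.1).restrict s

lemma memLp_gradx (hφ : IsTest Q φ) (s : Set (E × ℝ)) : MemLp (gradx φ) 2 (volume.restrict s) :=
  ((contDiff_gradx hφ.1).continuous.memLp_of_hasCompactSupport
    hφ.hasCompactSupport_gradx).restrict s

lemma memLp_dt (hφ : IsTest Q φ) (s : Set (E × ℝ)) : MemLp (dt φ) 2 (volume.restrict s) :=
  ((contDiff_dt hφ.1).continuous.memLp_of_hasCompactSupport
    hφ.hasCompactSupport_dt).restrict s

end IsTest

/-! ### Weak gradients -/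

lemma isOpen_cyl {Ω : Set E} (hΩ : IsOpen Ω) (T : ℝ) : IsOpen (cyl Ω T) := hΩ.prod isOpen_Ioo

lemma MemH.isWeakGrad {Q : Set (E × ℝ)} {u : E × ℝ → ℝ} (h : MemH Q u) :
    IsWeakGrad Q u (wgrad Q u) := by
  rw [wgrad, dif_pos h]
  exact h.choose_spec

namespace IsWeakGrad

variable {Q : Set (E × ℝ)} {u v : E × ℝ → ℝ} {g g' : E × ℝ → E}

lemma ae_eq (hQ : IsOpen Q) (h : IsWeakGrad Q u g) (h' : IsWeakGrad Q u g') :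
    g =ᵐ[volume.restrict Q] g' := by
  have hL : LocallyIntegrableOn (fun p => g p - g' p) Q := by
    have h1 : MemLp (fun p => g p - g' p) 2 (volume.restrict Q) := h.2.1.sub h'.2.1
    exact locallyIntegrableOn_of_locallyIntegrable_restrict (h1.locallyIntegrable (by norm_num))
  have key := hQ.ae_eq_zero_of_integral_contDiff_smul_eq_zero hL ?_
  · rw [Filter.EventuallyEq, ae_restrict_iff' hQ.measurableSet]
    filter_upwards [key] with p hp hpQ
    exact sub_eq_zero.1 (hp hpQ)
  · intro φ hφ hc hs
    have hT : IsTest Q φ := ⟨hφ, hc, hs⟩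
    have hzero : ∀ p, p ∉ Q → φ p • (g p - g' p) = 0 := by
      intro p hp
      have : φ p = 0 := by
        by_contra h0
        exact hp (hs (subset_tsupport φ h0))
      rw [this, zero_smul]
    rw [← setIntegral_eq_integral_of_forall_compl_eq_zero hzero]
    simp_rw [smul_sub]
    rw [integral_sub (integrable_smul_of_memLp (hT.memLp Q) h.2.1)
      (integrable_smul_of_memLp (hT.memLp Q) h'.2.1), sub_eq_zero]
    have e1 := h.2.2 φ hT
    have e2 := h'.2.2 φ hT
    exact neg_injective (e1.symm.trans e2)

lemma wgrad_ae_eq (hQ : IsOpen Q) (h : IsWeakGrad Q u g) :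
    wgrad Q u =ᵐ[volume.restrict Q] g :=
  (MemH.isWeakGrad ⟨g, h⟩).ae_eq hQ h

lemma sub (h : IsWeakGrad Q u g) (h' : IsWeakGrad Q v g') :
    IsWeakGrad Q (fun p => u p - v p) (fun p => g p - g' p) := by
  refine ⟨h.1.sub h'.1, h.2.1.sub h'.2.1, fun φ hφ => ?_⟩
  simp_rw [sub_smul, smul_sub]
  rw [integral_sub (integrable_smul_of_memLp h.1 (hφ.memLp_gradx Q))
      (integrable_smul_of_memLp h'.1 (hφ.memLp_gradx Q)),
    integral_sub (integrable_smul_of_memLp (hφ.memLp Q) h.2.1)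
      (integrable_smul_of_memLp (hφ.memLp Q) h'.2.1), h.2.2 φ hφ, h'.2.2 φ hφ]
  abel

end IsWeakGrad

lemma memLp_timeMul {F : Type*} [NormedAddCommGroup F] [NormedSpace ℝ F] {Ω : Set E} {T : ℝ}
    (hΩ : IsOpen Ω) {κ : ℝ → ℝ} (hκ : Continuous κ) {f : E × ℝ → F}
    (hf : MemLp f 2 (volume.restrict (cyl Ω T))) :
    MemLp (fun p => κ p.2 • f p) 2 (volume.restrict (cyl Ω T)) := by
  obtain ⟨M, hM⟩ := (isCompact_Icc (a := (0 : ℝ)) (b := T)).exists_bound_of_continuousOn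
    hκ.continuousOn
  refine MemLp.of_le_mul (c := M) hf ?_ ?_
  · exact ((hκ.comp continuous_snd).aestronglyMeasurable).smul hf.1
  · rw [ae_restrict_iff' (isOpen_cyl hΩ T).measurableSet]
    refine ae_of_all _ fun p hp => ?_
    rw [norm_smul]
    have := hM p.2 (Ioo_subset_Icc_self hp.2)
    gcongr

/-- The factor is only continuous because `e^{-τμ|t-θ|}` has a corner, so it cannot be moved onto a
test function. Polynomial factors can, and since no time derivative occurs, Weierstrass
approximation on `[0, T]` passes from polynomials to `κ`. -/
lemma IsWeakGrad.timeMul {Ω : Set E} {T : ℝ} (hΩ : IsOpen Ω) {κ : ℝ → ℝ} (hκ : Continuous κ)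
    {u : E × ℝ → ℝ} {g : E × ℝ → E} (h : IsWeakGrad (cyl Ω T) u g) :
    IsWeakGrad (cyl Ω T) (fun p => κ p.2 * u p) (fun p => κ p.2 • g p) := by
  have hQm := (isOpen_cyl hΩ T).measurableSet
  have hu := memLp_timeMul hΩ hκ h.1
  have hg := memLp_timeMul hΩ hκ h.2.1
  refine ⟨hu, hg, fun φ hφ => ?_⟩
  set X : E × ℝ → E := fun p => u p • gradx φ p + φ p • g p with hX
  have hXi : Integrable X (volume.restrict (cyl Ω T)) :=
    (integrable_smul_of_memLp h.1 (hφ.memLp_gradx _)).add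
      (integrable_smul_of_memLp (hφ.memLp _) h.2.1)
  have hbd : ∀ κ' : ℝ → ℝ, Continuous κ' →
      Integrable (fun p => κ' p.2 • X p) (volume.restrict (cyl Ω T)) := by
    intro κ' hκ'
    have i1 := integrable_smul_of_memLp (memLp_timeMul hΩ hκ' h.1) (hφ.memLp_gradx (cyl Ω T))
    have i2 := integrable_smul_of_memLp (hφ.memLp (cyl Ω T)) (memLp_timeMul hΩ hκ' h.2.1)
    refine (i1.add i2).congr (ae_of_all _ fun p => ?_)
    simp only [hX, Pi.add_apply, smul_add, smul_smul, smul_eq_mul, mul_comm (φ p)]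
  have hpoly : ∀ q : Polynomial ℝ, ∫ p in cyl Ω T, q.eval p.2 • X p = 0 := by
    intro q
    have hq : ContDiff ℝ ∞ fun t : ℝ => q.eval t := by
      simpa using (Polynomial.contDiff_aeval (R := ℝ) (𝕜 := ℝ) q ∞)
    have e := h.2.2 _ (hφ.mul_left (contDiff_comp_snd hq))
    simp_rw [gradx_timeMul hq hφ.1] at e
    have i1 := integrable_smul_of_memLp h.1 (memLp_timeMul hΩ hq.continuous
      (hφ.memLp_gradx (cyl Ω T)))
    have i2 := integrable_smul_of_memLp
      ((hφ.mul_left (contDiff_comp_snd hq)).memLp (cyl Ω T)) h.2.1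
    rw [← add_eq_zero_iff_eq_neg, ← integral_add i1 i2] at e
    rw [← e]
    refine integral_congr_ae (ae_of_all _ fun p => ?_)
    simp only [hX, smul_add, smul_smul, mul_comm (u p)]
  have hzero : ∫ p in cyl Ω T, κ p.2 • X p = 0 := by
    rw [← norm_le_zero_iff]
    refine le_of_forall_pos_le_add fun ε hε => ?_
    set M := ∫ p in cyl Ω T, ‖X p‖ with hM
    have hM0 : 0 ≤ M := integral_nonneg fun _ => norm_nonneg _
    obtain ⟨q, hq⟩ := exists_polynomial_near_of_continuousOn 0 T κ hκ.continuousOn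
      (ε / (M + 1)) (by positivity)
    have hqc : Continuous fun t : ℝ => q.eval t := q.continuous
    have e : ∫ p in cyl Ω T, κ p.2 • X p = ∫ p in cyl Ω T, (κ p.2 - q.eval p.2) • X p := by
      simp_rw [sub_smul]
      rw [integral_sub (hbd κ hκ) (hbd _ hqc), hpoly q, sub_zero]
    rw [e, zero_add]
    calc ‖∫ p in cyl Ω T, (κ p.2 - q.eval p.2) • X p‖
        ≤ ∫ p in cyl Ω T, ε / (M + 1) * ‖X p‖ := by
          refine norm_integral_le_of_norm_le (hXi.norm.const_mul _) ?_
          rw [ae_restrict_iff' hQm]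
          refine ae_of_all _ fun p hp => ?_
          rw [norm_smul, Real.norm_eq_abs, abs_sub_comm]
          have := (hq p.2 (Ioo_subset_Icc_self hp.2)).le
          gcongr
      _ = ε / (M + 1) * M := by rw [integral_const_mul]
      _ ≤ ε := by
          rw [div_mul_eq_mul_div, div_le_iff₀ (by positivity)]
          nlinarith
  have i1 := integrable_smul_of_memLp hu (hφ.memLp_gradx (cyl Ω T))
  have i2 := integrable_smul_of_memLp (hφ.memLp (cyl Ω T)) hg
  rw [← add_eq_zero_iff_eq_neg]
  refine Eq.trans ?_ hzero
  refine (integral_add i1 i2).symm.trans ?_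
  refine integral_congr_ae (ae_of_all _ fun p => ?_)
  simp only [hX, smul_add, smul_smul, smul_eq_mul, mul_comm (φ p)]

/-! ### Bounded coefficients -/

lemma aestronglyMeasurable_app {μ : Measure (E × ℝ)} {A : E × ℝ → Mat} {f : E × ℝ → E}
    (hA : ∀ i j, AEStronglyMeasurable (fun p => A p i j) μ) (hf : AEStronglyMeasurable f μ) :
    AEStronglyMeasurable (fun p => app (A p) (f p)) μ := by
  have e : (fun p => app (A p) (f p)) = fun p =>
      ∑ i, (∑ j, A p i j * f p j) • (EuclideanSpace.single i (1 : ℝ) : E) := by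
    funext p
    ext i
    rw [app_apply]
    simp [Finset.sum_apply, Pi.single_apply]
  rw [e]
  have hfj : ∀ j, AEStronglyMeasurable (fun p => f p j) μ := fun j =>
    (EuclideanSpace.proj (𝕜 := ℝ) j).continuous.comp_aestronglyMeasurable hf
  refine Finset.aestronglyMeasurable_fun_sum _ fun i _ => AEStronglyMeasurable.smul_const ?_ _
  exact Finset.aestronglyMeasurable_fun_sum _ fun j _ => (hA i j).mul (hfj j)

lemma memLp_app {μ : Measure (E × ℝ)} {A : E × ℝ → Mat} {f : E × ℝ → E} {γ : ℝ} (hγ : 0 < γ)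
    (hA : ∀ i j, AEStronglyMeasurable (fun p => A p i j) μ) (hell : ∀ᵐ p ∂μ, IsElliptic γ (A p))
    (hf : MemLp f 2 μ) : MemLp (fun p => app (A p) (f p)) 2 μ := by
  refine MemLp.of_le_mul (c := γ) hf (aestronglyMeasurable_app hA hf.1) ?_
  filter_upwards [hell] with p hp
  exact hp.norm_app_le hγ _

/-! ### Averages of translates -/

open scoped Pointwise

/-- The average `∫ X(p - q) dν(q)` of the translates of `X`. -/
def avg {F : Type*} [NormedAddCommGroup F] [NormedSpace ℝ F] (ν : Measure (E × ℝ))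
    (X : E × ℝ → F) (p : E × ℝ) : F := ∫ q, X (p - q) ∂ν

instance : (volume : Measure (E × ℝ)).IsAddHaarMeasure :=
  Measure.prod.instIsAddHaarMeasure volume volume

section Average

variable {F : Type*} [NormedAddCommGroup F] [InnerProductSpace ℝ F] [CompleteSpace F]
  {ν : Measure (E × ℝ)} [IsProbabilityMeasure ν] {X : E × ℝ → F}

omit [InnerProductSpace ℝ F] [CompleteSpace F] in
lemma eLpNorm_translate (hX : StronglyMeasurable X) (q : E × ℝ) :
    eLpNorm (fun p => X (p - q)) 2 volume = eLpNorm X 2 volume :=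
  eLpNorm_comp_measurePreserving hX.aestronglyMeasurable (measurePreserving_sub_right volume q)

omit [CompleteSpace F] in
-- Averaging against a probability measure covers mollification and Steklov averaging at once. Both
-- contract `L²` by Minkowski's inequality, and both are close to the identity when the measure
-- concentrates near the origin.
lemma eLpNorm_avg_le (hX : StronglyMeasurable X) :
    eLpNorm (avg ν X) 2 volume ≤ eLpNorm X 2 volume := by
  refine ENNReal.le_of_forall_pos_le_add fun ε hε hfin => ?_
  have h := eLpNorm_integral_le (μ := (volume : Measure (E × ℝ))) (ν := ν)
    (h := fun z : (E × ℝ) × (E × ℝ) => X (z.1 - z.2))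
    (hX.comp_measurable (measurable_fst.sub measurable_snd)).aestronglyMeasurable
    (w := fun _ => eLpNorm X 2 volume + ε) measurable_const
    (fun _ => by simp [hε.ne']) (fun _ => by simp [hfin.ne])
    (ae_of_all _ fun q => by rw [eLpNorm_translate hX]; exact le_self_add)
  refine le_trans (le_of_eq rfl) (h.trans (by simp))

lemma eLpNorm_avg_sub_le (hX : StronglyMeasurable X) (hX2 : MemLp X 2 volume) {M : ENNReal}
    (hM : ∀ᵐ q ∂ν, eLpNorm (fun p => X (p - q) - X p) 2 volume ≤ M) :
    eLpNorm (fun p => avg ν X p - X p) 2 volume ≤ M := by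
  refine ENNReal.le_of_forall_pos_le_add fun ε hε hfin => ?_
  have hmeas : StronglyMeasurable fun z : (E × ℝ) × (E × ℝ) => X (z.1 - z.2) :=
    hX.comp_measurable (measurable_fst.sub measurable_snd)
  have h := eLpNorm_integral_le (μ := (volume : Measure (E × ℝ))) (ν := ν)
    (h := fun z : (E × ℝ) × (E × ℝ) => X (z.1 - z.2) - X z.1)
    (hmeas.sub (hX.comp_measurable measurable_fst)).aestronglyMeasurable
    (w := fun _ => M + ε) measurable_const
    (fun _ => by simp [hε.ne']) (fun _ => by simp [hfin.ne])
    (by filter_upwards [hM] with q hq; exact hq.trans le_self_add)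
  have hint := ae_integrable_of_eLpNorm_le (μ := (volume : Measure (E × ℝ))) (ν := ν)
    (h := fun z : (E × ℝ) × (E × ℝ) => X (z.1 - z.2)) hmeas.aestronglyMeasurable
    (w := fun _ => eLpNorm X 2 volume + 1) measurable_const
    (fun _ => by simp) (fun _ => by simp [hX2.2.ne]) (by simp [hX2.2.ne])
    (ae_of_all _ fun q => by rw [eLpNorm_translate hX]; exact le_self_add)
  refine (le_of_eq (eLpNorm_congr_ae ?_)).trans (h.trans (by simp))
  filter_upwards [hint] with p hp
  rw [integral_sub hp (integrable_const _)]
  rw [integral_const, probReal_univ, one_smul]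
  rfl

omit [InnerProductSpace ℝ F] [CompleteSpace F] in
-- Translations act continuously on `L²`, as compositions with a continuous family of measure
-- preserving maps.
lemma exists_translate_le (hX : MemLp X 2 (volume : Measure (E × ℝ))) {ε : ENNReal}
    (hε : ε ≠ 0) :
    ∃ δ > 0, ∀ q : E × ℝ, ‖q‖ < δ → eLpNorm (fun p => X (p - q) - X p) 2 volume ≤ ε := by
  have hmp : ∀ q : E × ℝ, MeasurePreserving (fun p : E × ℝ => p - q) volume volume :=
    fun q => measurePreserving_sub_right volume q
  let g : E × ℝ → C(E × ℝ, E × ℝ) := fun q => ⟨fun p => p - q, by fun_prop⟩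
  have hg : Continuous g := ContinuousMap.continuous_of_continuous_uncurry _ (by
    change Continuous fun z : (E × ℝ) × (E × ℝ) => z.2 - z.1
    fun_prop)
  have hc : Continuous fun q => Lp.compMeasurePreserving (g q) (hmp q) (hX.toLp X) :=
    Continuous.compMeasurePreservingLp (f := fun _ : E × ℝ => hX.toLp X) continuous_const hg hmp
      (by simp)
  have h0 := hc.tendsto 0
  rw [EMetric.tendsto_nhds] at h0
  obtain ⟨δ, hδ, hball⟩ := Metric.eventually_nhds_iff.1 (h0 ε (pos_iff_ne_zero.2 hε))
  refine ⟨δ, hδ, fun q hq => ?_⟩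
  have := (hball (y := q) (by simpa using hq)).le
  refine le_trans (le_of_eq ?_) this
  rw [Lp.edist_def]
  refine eLpNorm_congr_ae ?_
  have e1 : ∀ q : E × ℝ, (Lp.compMeasurePreserving (g q) (hmp q) (hX.toLp X) : E × ℝ → F)
      =ᵐ[volume] fun p => X (p - q) := by
    intro q
    refine (Lp.coeFn_compMeasurePreserving _ (hmp q)).trans ?_
    exact (hmp q).quasiMeasurePreserving.ae_eq_comp hX.coeFn_toLp
  filter_upwards [e1 q, e1 0] with p h1 h2
  simp only [Pi.sub_apply, h1, h2, sub_zero]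

end Average

/-! ### Averages of smooth functions -/

section AverageSmooth

variable {ν : Measure (E × ℝ)} [IsProbabilityMeasure ν] {Ψ : E × ℝ → ℝ}

lemma avg_eq_convolution (ν : Measure (E × ℝ)) (Ψ : E × ℝ → ℝ) :
    avg ν Ψ = convolution (fun _ => (1 : ℝ)) Ψ (ContinuousLinearMap.mul ℝ ℝ) ν := by
  funext p
  simp [avg, convolution_def]

lemma contDiff_avg (hΨ : ContDiff ℝ ∞ Ψ) (hc : HasCompactSupport Ψ) : ContDiff ℝ ∞ (avg ν Ψ) := by
  rw [avg_eq_convolution]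
  exact hc.contDiff_convolution_right _ (locallyIntegrable_const _) hΨ

lemma integrable_translate {F : Type*} [NormedAddCommGroup F] {X : E × ℝ → F}
    (hX : Continuous X) (hc : HasCompactSupport X) (p : E × ℝ) :
    Integrable (fun q => X (p - q)) ν := by
  obtain ⟨C, hC⟩ := hX.bounded_above_of_compact_support hc
  exact Integrable.of_bound (by fun_prop : Continuous fun q => X (p - q)).aestronglyMeasurable C
    (ae_of_all _ fun q => hC _)

lemma fderiv_avg (hΨ : ContDiff ℝ ∞ Ψ) (hc : HasCompactSupport Ψ) (p v : E × ℝ) :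
    fderiv ℝ (avg ν Ψ) p v = ∫ q, fderiv ℝ Ψ (p - q) v ∂ν := by
  have h1 : ContDiff ℝ 1 Ψ := hΨ.of_le (by simp)
  obtain ⟨C, hC⟩ := (h1.continuous_fderiv (by simp)).bounded_above_of_compact_support (hc.fderiv ℝ)
  have hi := integrable_translate (ν := ν) (h1.continuous_fderiv (by simp)) (hc.fderiv ℝ) p
  have h : HasFDerivAt (avg ν Ψ) (∫ q, fderiv ℝ Ψ (p - q) ∂ν) p := by
    refine hasFDerivAt_integral_of_dominated_of_fderiv_le (bound := fun _ => C)
      (F' := fun p q => fderiv ℝ Ψ (p - q)) univ_mem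
      (Eventually.of_forall fun p => (integrable_translate hΨ.continuous hc p).1)
      (integrable_translate hΨ.continuous hc p) hi.1 (ae_of_all _ fun q x _ => hC _)
      (integrable_const _) (ae_of_all _ fun q x _ => ?_)
    have := ((hΨ.differentiable (by simp)) (x - q)).hasFDerivAt.comp x
      ((hasFDerivAt_id x).sub_const q)
    simpa [Function.comp_def] using this
  rw [h.fderiv, ContinuousLinearMap.integral_apply hi]

lemma gradx_avg (hΨ : ContDiff ℝ ∞ Ψ) (hc : HasCompactSupport Ψ) (p : E × ℝ) :
    gradx (avg ν Ψ) p = avg ν (gradx Ψ) p := by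
  have hgc : HasCompactSupport (gradx Ψ) :=
    hc.of_isClosed_subset (isClosed_tsupport _) (tsupport_gradx_subset hΨ)
  refine ext_inner_left ℝ fun v => ?_
  rw [real_inner_comm, inner_gradx (contDiff_avg hΨ hc), fderiv_avg hΨ hc, avg,
    ← integral_inner (integrable_translate (contDiff_gradx hΨ).continuous hgc p)]
  refine integral_congr_ae (ae_of_all _ fun q => ?_)
  simp only []
  rw [real_inner_comm, inner_gradx hΨ]

lemma dt_avg (hΨ : ContDiff ℝ ∞ Ψ) (hc : HasCompactSupport Ψ) (p : E × ℝ) :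
    dt (avg ν Ψ) p = avg ν (dt Ψ) p := by
  rw [dt_eq (contDiff_avg hΨ hc), fderiv_avg hΨ hc, avg]
  simp_rw [dt_eq hΨ]

omit [IsProbabilityMeasure ν] in
lemma tsupport_avg_subset {F : Type*} [NormedAddCommGroup F] [NormedSpace ℝ F] {X : E × ℝ → F}
    (hc : HasCompactSupport X) {K : Set (E × ℝ)} (hK : IsCompact K) (hν : ∀ᵐ q ∂ν, q ∈ K) :
    tsupport (avg ν X) ⊆ tsupport X + K := by
  refine closure_minimal (fun p hp => ?_) (hc.isCompact.add hK).isClosed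
  by_contra hn
  refine hp (integral_eq_zero_of_ae ?_)
  filter_upwards [hν] with q hq
  by_contra hne
  exact hn ⟨p - q, subset_tsupport _ hne, q, hq, by simp⟩

end AverageSmooth

/-! ### Cutoffs in time -/

section Cutoff

lemma intervalIntegral_normed_eq_zero {c : ℝ} (f : ContDiffBump c) {t : ℝ} (h0 : f.rOut ≤ c)
    (ht : t ≤ c - f.rOut) : ∫ s in (0 : ℝ)..t, f.normed volume s = 0 := by
  rw [intervalIntegral.integral_congr (g := fun _ => 0), intervalIntegral.integral_zero]
  intro s hs
  by_contra hne
  have : s ∈ Function.support (f.normed volume) := hne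
  rw [f.support_normed_eq, Real.ball_eq_Ioo] at this
  rcases le_total 0 t with h | h
  · rw [uIcc_of_le h] at hs; linarith [hs.2, this.1]
  · rw [uIcc_of_ge h] at hs; linarith [hs.2, this.1]

lemma intervalIntegral_normed_eq_one {c : ℝ} (f : ContDiffBump c) {t : ℝ} (h0 : f.rOut ≤ c)
    (ht : c + f.rOut ≤ t) : ∫ s in (0 : ℝ)..t, f.normed volume s = 1 := by
  have hpos := f.rOut_pos
  rw [intervalIntegral.integral_of_le (by linarith), ← f.integral_normed (μ := volume)]
  refine setIntegral_eq_integral_of_forall_compl_eq_zero fun s hs => ?_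
  by_contra hne
  have : s ∈ Function.support (f.normed volume) := hne
  rw [f.support_normed_eq, Real.ball_eq_Ioo] at this
  exact hs ⟨by linarith [this.1], by linarith [this.2]⟩

lemma abs_intervalIntegral_normed_le {c : ℝ} (f : ContDiffBump c) (t : ℝ) :
    |∫ s in (0 : ℝ)..t, f.normed volume s| ≤ 1 := by
  have hm : ∀ S : Set ℝ, ∫ s in S, f.normed volume s ≤ 1 := fun S => by
    rw [← f.integral_normed (μ := volume)]
    exact setIntegral_le_integral f.integrable_normed (ae_of_all _ fun s => f.nonneg_normed s)
  rcases le_total 0 t with h | h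
  · rw [intervalIntegral.integral_of_le h, abs_of_nonneg
      (integral_nonneg fun s => f.nonneg_normed s)]
    exact hm _
  · rw [intervalIntegral.integral_of_ge h, abs_neg, abs_of_nonneg
      (integral_nonneg fun s => f.nonneg_normed s)]
    exact hm _

/-- A bump at `2δ` of radius `δ`. -/
def timeBump (δ : ℝ) (hδ : 0 < δ) (c : ℝ) : ContDiffBump c := ⟨δ / 2, δ, by positivity, by linarith⟩

/-- A smooth cutoff in time, with the two bumps which make up its derivative. -/
def timeCutoff (T δ : ℝ) (hδ : 0 < δ) (t : ℝ) : ℝ :=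
  ∫ s in (0 : ℝ)..t, ((timeBump δ hδ (2 * δ)).normed volume s
    - (timeBump δ hδ (T - 2 * δ)).normed volume s)

variable {T δ : ℝ} (hδ : 0 < δ)

lemma timeCutoff_eq (t : ℝ) : timeCutoff T δ hδ t =
    (∫ s in (0 : ℝ)..t, (timeBump δ hδ (2 * δ)).normed volume s)
    - ∫ s in (0 : ℝ)..t, (timeBump δ hδ (T - 2 * δ)).normed volume s :=
  intervalIntegral.integral_sub ((ContDiffBump.continuous_normed _).intervalIntegrable _ _)
    ((ContDiffBump.continuous_normed _).intervalIntegrable _ _)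

lemma hasDerivAt_timeCutoff (t : ℝ) : HasDerivAt (timeCutoff T δ hδ)
    ((timeBump δ hδ (2 * δ)).normed volume t - (timeBump δ hδ (T - 2 * δ)).normed volume t) t :=
  ((ContDiffBump.continuous_normed _).sub (ContDiffBump.continuous_normed _)).integral_hasStrictDerivAt
    0 t |>.hasDerivAt

lemma contDiff_timeCutoff : ContDiff ℝ ∞ (timeCutoff T δ hδ) := by
  rw [contDiff_infty_iff_deriv]
  refine ⟨fun t => (hasDerivAt_timeCutoff hδ t).differentiableAt, ?_⟩
  rw [funext fun t => (hasDerivAt_timeCutoff (T := T) hδ t).deriv]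
  exact (ContDiffBump.contDiff_normed _).sub (ContDiffBump.contDiff_normed _)

lemma abs_timeCutoff_le (t : ℝ) : |timeCutoff T δ hδ t| ≤ 2 := by
  rw [timeCutoff_eq]
  refine (abs_sub _ _).trans ?_
  linarith [abs_intervalIntegral_normed_le (timeBump δ hδ (2 * δ)) t,
    abs_intervalIntegral_normed_le (timeBump δ hδ (T - 2 * δ)) t]

variable (hT : 6 * δ ≤ T)
include hT

lemma timeCutoff_eq_one {t : ℝ} (h1 : 3 * δ ≤ t) (h2 : t ≤ T - 3 * δ) :
    timeCutoff T δ hδ t = 1 := by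
  rw [timeCutoff_eq, intervalIntegral_normed_eq_one _ _ _, intervalIntegral_normed_eq_zero,
    sub_zero]
  all_goals simp only [timeBump]; linarith

lemma timeCutoff_eq_zero {t : ℝ} (h : t ∉ Icc δ (T - δ)) : timeCutoff T δ hδ t = 0 := by
  rw [timeCutoff_eq]
  rcases lt_or_ge t δ with h1 | h1
  · rw [intervalIntegral_normed_eq_zero, intervalIntegral_normed_eq_zero, sub_zero]
    all_goals simp only [timeBump]; linarith
  · have h2 : T - δ < t := by
      by_contra hc
      exact h ⟨h1, not_lt.1 hc⟩
    rw [intervalIntegral_normed_eq_one, intervalIntegral_normed_eq_one, sub_self]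
    all_goals simp only [timeBump]; linarith

lemma tsupport_timeCutoff_subset : tsupport (timeCutoff T δ hδ) ⊆ Icc δ (T - δ) :=
  closure_minimal (fun t ht => by
    by_contra hc
    exact ht (timeCutoff_eq_zero hδ hT hc)) isClosed_Icc

lemma hasCompactSupport_timeCutoff : HasCompactSupport (timeCutoff T δ hδ) :=
  isCompact_Icc.of_isClosed_subset (isClosed_tsupport _) (tsupport_timeCutoff_subset hδ hT)

end Cutoff

/-- The scale of the `n`-th time cutoff on `(0, T)`. -/
def cutScale (T : ℝ) (n : ℕ) : ℝ := T / (6 * (n + 1))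

lemma cutScale_pos {T : ℝ} (hT : 0 < T) (n : ℕ) : 0 < cutScale T n := by
  rw [cutScale]; positivity

lemma six_mul_cutScale_le {T : ℝ} (hT : 0 < T) (n : ℕ) : 6 * cutScale T n ≤ T := by
  rw [cutScale, ← mul_div_assoc, mul_div_mul_left _ _ (by norm_num)]
  exact div_le_self hT.le (by linarith [(Nat.cast_nonneg n : (0 : ℝ) ≤ n)])

lemma tendsto_cutScale (T : ℝ) : Tendsto (cutScale T) atTop (𝓝 0) := by
  have h := (tendsto_one_div_add_atTop_nhds_zero_nat (𝕜 := ℝ)).const_mul (T / 6)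
  rw [mul_zero] at h
  refine h.congr fun n => ?_
  rw [cutScale]; field_simp

lemma tendsto_timeCutoff {T : ℝ} (hT : 0 < T) {t : ℝ} (ht : t ∈ Ioo 0 T) :
    Tendsto (fun n => timeCutoff T (cutScale T n) (cutScale_pos hT n) t) atTop (𝓝 1) := by
  refine tendsto_const_nhds.congr' ?_
  have h := ((tendsto_cutScale T).const_mul 3)
  rw [mul_zero] at h
  filter_upwards [h.eventually (gt_mem_nhds ht.1),
    h.eventually (gt_mem_nhds (sub_pos.2 ht.2))] with n h1 h2
  exact (timeCutoff_eq_one _ (six_mul_cutScale_le hT n) h1.le (by linarith)).symm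

/-- The bumps have mass one, live inside `(0, T)` and concentrate at `c₀`. Since `j` is continuous
on the closed interval, `c₀` may be an endpoint, which is the case of interest. -/
lemma tendsto_integral_timeBump {T : ℝ} (hT : 0 < T) {j : ℝ → ℝ} (hj : ContinuousOn j (Icc 0 T))
    {c : ℕ → ℝ} {c₀ : ℝ} (hc₀ : c₀ ∈ Icc 0 T) (hc : Tendsto c atTop (𝓝 c₀))
    (hc1 : ∀ n, cutScale T n ≤ c n) (hc2 : ∀ n, c n ≤ T - cutScale T n) :
    Tendsto (fun n => ∫ t in Ioo 0 T,
      (timeBump (cutScale T n) (cutScale_pos hT n) (c n)).normed volume t * j t)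
      atTop (𝓝 (j c₀)) := by
  have hsub : ∀ n, Function.support
      ((timeBump (cutScale T n) (cutScale_pos hT n) (c n)).normed volume) ⊆ Ioo 0 T := by
    intro n
    rw [ContDiffBump.support_normed_eq, Real.ball_eq_Ioo]
    exact Ioo_subset_Ioo (by simp only [timeBump]; linarith [hc1 n])
      (by simp only [timeBump]; linarith [hc2 n])
  have hint : ∀ n, ∫ t in Ioo 0 T,
      (timeBump (cutScale T n) (cutScale_pos hT n) (c n)).normed volume t = 1 := by
    intro n
    rw [← ContDiffBump.integral_normed (timeBump (cutScale T n) (cutScale_pos hT n) (c n))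
      (μ := volume)]
    exact setIntegral_eq_integral_of_forall_compl_eq_zero fun t ht => by
      by_contra hne
      exact ht (hsub n hne)
  rw [Metric.tendsto_atTop]
  intro ε hε
  obtain ⟨η, hη, hηj⟩ := Metric.continuousOn_iff.1 hj c₀ hc₀ (ε / 2) (by positivity)
  obtain ⟨N1, hN1⟩ := Metric.tendsto_atTop.1 hc (η / 2) (by positivity)
  obtain ⟨N2, hN2⟩ := Metric.tendsto_atTop.1 (tendsto_cutScale T) (η / 2) (by positivity)
  refine ⟨max N1 N2, fun n hn => ?_⟩
  set f := timeBump (cutScale T n) (cutScale_pos hT n) (c n) with hf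
  have hfi : IntegrableOn (f.normed volume) (Ioo 0 T) := f.integrable_normed.integrableOn
  have hfj : IntegrableOn (fun t => f.normed volume t * j t) (Ioo 0 T) :=
    ((f.continuous_normed.continuousOn.mul hj).integrableOn_Icc).mono_set Ioo_subset_Icc_self
  have e : (∫ t in Ioo 0 T, f.normed volume t * j t) - j c₀
      = ∫ t in Ioo 0 T, f.normed volume t * (j t - j c₀) := by
    simp_rw [mul_sub]
    rw [integral_sub hfj (hfi.mul_const _), integral_mul_const, hint n, one_mul]
  rw [Real.dist_eq, e, ← Real.norm_eq_abs]
  refine lt_of_le_of_lt (norm_integral_le_of_norm_le (g := fun t => f.normed volume t * (ε / 2))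
    (hfi.mul_const _) ?_) (by rw [integral_mul_const, hint n]; linarith)
  rw [ae_restrict_iff' measurableSet_Ioo]
  refine ae_of_all _ fun t ht => ?_
  rw [norm_mul, Real.norm_of_nonneg (f.nonneg_normed t)]
  by_cases h0 : f.normed volume t = 0
  · rw [h0]; simp
  · have hts : t ∈ Function.support (f.normed volume) := h0
    rw [f.support_normed_eq, Metric.mem_ball] at hts
    have h1 := hN1 n (le_of_max_le_left hn)
    have h2 := hN2 n (le_of_max_le_right hn)
    rw [Real.dist_eq, sub_zero, abs_of_pos (cutScale_pos hT n)] at h2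
    have h3 : dist t c₀ < η := by
      calc dist t c₀ ≤ dist t (c n) + dist (c n) c₀ := dist_triangle _ _ _
        _ < η / 2 + η / 2 := add_lt_add (hts.trans h2) h1
        _ = η := by ring
    have := (hηj t (Ioo_subset_Icc_self ht) h3).le
    rw [Real.dist_eq] at this
    exact mul_le_mul_of_nonneg_left this (f.nonneg_normed t)

/-- A continuous function with integrable weak derivative `k` is a primitive of `k`. -/
lemma sub_eq_integral_of_weak_deriv {T : ℝ} (hT : 0 < T) {j k : ℝ → ℝ}
    (hj : ContinuousOn j (Icc 0 T)) (hk : IntegrableOn k (Ioo 0 T))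
    (h : ∀ ζ : ℝ → ℝ, ContDiff ℝ ∞ ζ → HasCompactSupport ζ → tsupport ζ ⊆ Ioo 0 T →
      ∫ t in Ioo 0 T, (deriv ζ t * j t + ζ t * k t) = 0) :
    j T - j 0 = ∫ t in Ioo 0 T, k t := by
  -- The derivative of the cutoff is a bump near `0` minus a bump near `T`. Testing with it
  -- therefore evaluates `j` at both ends in the limit, while the cutoff itself tends to `1`.
  set ζ : ℕ → ℝ → ℝ := fun n => timeCutoff T (cutScale T n) (cutScale_pos hT n) with hζ
  have hs := six_mul_cutScale_le hT
  have hp := cutScale_pos hT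
  have hlim := tendsto_cutScale T
  have l1 := tendsto_integral_timeBump hT hj (c := fun n => 2 * cutScale T n) (c₀ := 0)
    ⟨le_rfl, hT.le⟩ (by simpa using hlim.const_mul 2) (fun n => by linarith [hp n])
    (fun n => by linarith [hp n, hs n])
  have l2 := tendsto_integral_timeBump hT hj (c := fun n => T - 2 * cutScale T n) (c₀ := T)
    ⟨hT.le, le_rfl⟩ (by simpa using (hlim.const_mul 2).const_sub T)
    (fun n => by linarith [hp n, hs n]) (fun n => by linarith [hp n])
  have l3 : Tendsto (fun n => ∫ t in Ioo 0 T, ζ n t * k t) atTop (𝓝 (∫ t in Ioo 0 T, k t)) := by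
    refine tendsto_integral_of_dominated_convergence (fun t => 2 * ‖k t‖)
      (fun n => (contDiff_timeCutoff (T := T) (hp n)).continuous.aestronglyMeasurable.mul hk.1)
      (hk.norm.const_mul 2) (fun n => ae_of_all _ fun t => ?_) ?_
    · rw [norm_mul]
      have := abs_timeCutoff_le (T := T) (hp n) t
      exact mul_le_mul_of_nonneg_right this (norm_nonneg _)
    · rw [ae_restrict_iff' measurableSet_Ioo]
      refine ae_of_all _ fun t ht => ?_
      simpa using (tendsto_timeCutoff hT ht).mul_const (k t)
  have hzero : ∀ n, (∫ t in Ioo 0 T, (timeBump (cutScale T n) (hp n)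
        (2 * cutScale T n)).normed volume t * j t)
      - (∫ t in Ioo 0 T, (timeBump (cutScale T n) (hp n)
        (T - 2 * cutScale T n)).normed volume t * j t)
      + ∫ t in Ioo 0 T, ζ n t * k t = 0 := by
    intro n
    have hb : ∀ c, IntegrableOn (fun t => (timeBump (cutScale T n) (hp n) c).normed volume t * j t)
        (Ioo 0 T) := fun c =>
      (((ContDiffBump.continuous_normed _).continuousOn.mul hj).integrableOn_Icc).mono_set
        Ioo_subset_Icc_self
    have hζk : IntegrableOn (fun t => ζ n t * k t) (Ioo 0 T) :=
      hk.bdd_mul (c := 2) (contDiff_timeCutoff _).continuous.aestronglyMeasurable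
        (ae_of_all _ fun t => abs_timeCutoff_le (T := T) (hp n) t)
    rw [← integral_sub (hb _) (hb _)]
    refine (integral_add ((hb _).sub (hb _)) hζk).symm.trans (Eq.trans ?_
      (h (ζ n) (contDiff_timeCutoff _) (hasCompactSupport_timeCutoff _ (hs n))
        ((tsupport_timeCutoff_subset _ (hs n)).trans fun t ht =>
          ⟨(hp n).trans_le ht.1, ht.2.trans_lt (by linarith [hp n])⟩)))
    refine integral_congr_ae (ae_of_all _ fun t => ?_)
    simp only [Pi.sub_apply, (hasDerivAt_timeCutoff (T := T) (hp n) t).deriv, hζ]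
    ring
  have hl := (l1.sub l2).add l3
  simp_rw [hzero] at hl
  have := tendsto_nhds_unique hl tendsto_const_nhds
  linarith

/-! ### Time slices -/

lemma eLpNorm_le_of_support {α : Type*} [MeasurableSpace α] {μ : Measure α} {F : Type*}
    [NormedAddCommGroup F] {h : α → F} {c : ℝ} (hc : 0 ≤ c) {B : Set α} (hB : MeasurableSet B)
    (hle : ∀ x, ‖h x‖ ≤ c) (h0 : ∀ x, x ∉ B → h x = 0) :
    eLpNorm h 2 μ ≤ ENNReal.ofReal c * μ B ^ (1 / 2 : ℝ) := by
  have h1 : eLpNorm h 2 μ ≤ eLpNorm (B.indicator fun _ => c) 2 μ := by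
    refine eLpNorm_mono fun x => ?_
    by_cases hx : x ∈ B
    · rw [indicator_of_mem hx, Real.norm_of_nonneg hc]; exact hle x
    · rw [h0 x hx]; simp
  refine h1.trans (le_of_eq ?_)
  rw [eLpNorm_indicator_const hB (by simp) (by simp), Real.enorm_of_nonneg hc]
  norm_num

open Classical in
/-- The slice `φ(·, t)` as an element of `L²(Ω)`. -/
def slc (Ω : Set E) (φ : E × ℝ → ℝ) (t : ℝ) : Lp ℝ 2 (volume.restrict Ω) :=
  if h : MemLp (fun x => φ (x, t)) 2 (volume.restrict Ω) then h.toLp _ else 0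

section Slices

variable {Ω : Set E} {φ ψ : E × ℝ → ℝ} {t s : ℝ}

lemma slc_coe (h : MemLp (fun x => φ (x, t)) 2 (volume.restrict Ω)) :
    slc Ω φ t =ᵐ[volume.restrict Ω] fun x => φ (x, t) := by
  rw [slc, dif_pos h]
  exact h.coeFn_toLp

lemma inner_eq_integral_mul {μ : Measure E} (f g : Lp ℝ 2 μ) {f' g' : E → ℝ} (hf : f =ᵐ[μ] f')
    (hg : g =ᵐ[μ] g') : inner ℝ f g = ∫ x, f' x * g' x ∂μ := by
  rw [L2.inner_def]
  refine integral_congr_ae ?_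
  filter_upwards [hf, hg] with x h1 h2
  rw [h1, h2]
  simp [mul_comm]

lemma memLp_slice (hφ : Continuous φ) (hc : HasCompactSupport φ) (Ω : Set E) (t : ℝ) :
    MemLp (fun x => φ (x, t)) 2 (volume.restrict Ω) := by
  refine MemLp.restrict Ω (Continuous.memLp_of_hasCompactSupport (by fun_prop) ?_)
  refine HasCompactSupport.intro (hc.isCompact.image continuous_fst) fun x hx => ?_
  by_contra hne
  exact hx ⟨(x, t), subset_tsupport φ hne, rfl⟩

lemma dist_slc_le (hφ : MemLp (fun x => φ (x, t)) 2 (volume.restrict Ω))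
    (hψ : MemLp (fun x => ψ (x, s)) 2 (volume.restrict Ω)) :
    dist (slc Ω φ t) (slc Ω ψ s)
      = (eLpNorm (fun x => φ (x, t) - ψ (x, s)) 2 (volume.restrict Ω)).toReal := by
  rw [Lp.dist_def]
  congr 1
  refine eLpNorm_congr_ae ?_
  filter_upwards [slc_coe hφ, slc_coe hψ] with x h1 h2
  simp [h1, h2]

lemma continuous_slc (hφ : Continuous φ) (hc : HasCompactSupport φ) : Continuous (slc Ω φ) := by
  set K : Set E := Prod.fst '' tsupport φ with hK
  have hKc : IsCompact K := hc.isCompact.image continuous_fst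
  have hKfin : volume.restrict Ω K ≠ ⊤ :=
    ((Measure.restrict_apply_le Ω K).trans_lt hKc.measure_lt_top).ne
  set V : ℝ := ((volume.restrict Ω K) ^ (1 / 2 : ℝ)).toReal with hV
  have hV0 : 0 ≤ V := ENNReal.toReal_nonneg
  rw [Metric.continuous_iff]
  intro t ε hε
  obtain ⟨δ, hδ, hu⟩ := Metric.uniformContinuous_iff.1
    (hc.uniformContinuous_of_continuous hφ) (ε / (V + 1)) (by positivity)
  refine ⟨δ, hδ, fun s hs => ?_⟩
  rw [dist_slc_le (memLp_slice hφ hc Ω s) (memLp_slice hφ hc Ω t)]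
  have hle := eLpNorm_le_of_support (μ := volume.restrict Ω) (h := fun x => φ (x, s) - φ (x, t))
    (c := ε / (V + 1)) (by positivity) hKc.measurableSet (fun x => by
      have : dist (x, s) (x, t) < δ := by simpa [Prod.dist_eq, hδ] using hs
      simpa [dist_eq_norm] using (hu this).le) (fun x hx => by
      have : ∀ r, φ (x, r) = 0 := fun r => by
        by_contra hne
        exact hx ⟨(x, r), subset_tsupport φ hne, rfl⟩
      simp [this])
  have := ENNReal.toReal_mono (ENNReal.mul_ne_top ENNReal.ofReal_ne_top
    (ENNReal.rpow_ne_top_of_nonneg (by norm_num) hKfin)) hle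
  rw [ENNReal.toReal_mul, ENNReal.toReal_ofReal (by positivity), ← hV] at this
  refine this.trans_lt ?_
  rw [div_mul_eq_mul_div, div_lt_iff₀ (by positivity)]
  nlinarith

lemma slc_eq_zero (h : ∀ x, φ (x, t) = 0) : slc Ω φ t = 0 := by
  have hm : MemLp (fun x => φ (x, t)) 2 (volume.restrict Ω) := by simp only [h, MemLp.zero']
  refine Lp.ext ?_
  filter_upwards [slc_coe hm, Lp.coeFn_zero ℝ 2 (volume.restrict Ω)] with x h1 h2
  rw [h1, h2, h x]
  rfl

end Slices

lemma volume_restrict_cyl (Ω : Set E) (T : ℝ) : (volume : Measure (E × ℝ)).restrict (cyl Ω T)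
    = (volume.restrict Ω).prod (volume.restrict (Ioo 0 T)) :=
  (Measure.prod_restrict Ω (Ioo 0 T)).symm

lemma integral_cyl {F : Type*} [NormedAddCommGroup F] [NormedSpace ℝ F] {Ω : Set E} {T : ℝ}
    {f : E × ℝ → F} (hf : Integrable f (volume.restrict (cyl Ω T))) :
    ∫ p in cyl Ω T, f p = ∫ t in Ioo 0 T, ∫ x in Ω, f (x, t) := by
  rw [volume_restrict_cyl] at hf ⊢
  exact integral_prod_symm f hf

lemma integrableOn_integral_slice {F : Type*} [NormedAddCommGroup F] [NormedSpace ℝ F] {Ω : Set E}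
    {T : ℝ} {f : E × ℝ → F} (hf : Integrable f (volume.restrict (cyl Ω T))) :
    IntegrableOn (fun t => ∫ x in Ω, f (x, t)) (Ioo 0 T) := by
  rw [volume_restrict_cyl] at hf
  exact hf.integral_prod_right

lemma ae_integrable_slice {F : Type*} [NormedAddCommGroup F] {Ω : Set E}
    {T : ℝ} {f : E × ℝ → F} (hf : Integrable f (volume.restrict (cyl Ω T))) :
    ∀ᵐ t ∂(volume.restrict (Ioo 0 T)), Integrable (fun x => f (x, t)) (volume.restrict Ω) := by
  rw [volume_restrict_cyl] at hf
  exact hf.prod_left_ae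

/-! ### The energy inequality -/

section Energy

variable {Ω : Set E} {T : ℝ} {w f₀ : E × ℝ → ℝ} {F : E × ℝ → E}

/-- `∂ₜ w - div F + f₀ = 0` in `Ω × (0, T)`, for `w ∈ C([0, T]; L²(Ω))` represented by the
curve `W`. -/
structure IsDivSolution (Ω : Set E) (T : ℝ) (w : E × ℝ → ℝ) (F : E × ℝ → E) (f₀ : E × ℝ → ℝ)
    (W : ℝ → Lp ℝ 2 (volume.restrict Ω)) : Prop where
  cont : Continuous W
  clamp : ∀ t, W t = W (max 0 (min t T))
  coe : ∀ t ∈ Icc 0 T, W t =ᵐ[volume.restrict Ω] fun x => w (x, t)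
  memLp : MemLp w 2 (volume.restrict (cyl Ω T))
  flux : MemLp F 2 (volume.restrict (cyl Ω T))
  source : MemLp f₀ 2 (volume.restrict (cyl Ω T))
  equation : ∀ φ, IsTest (cyl Ω T) φ →
    ∫ p in cyl Ω T, (-(w p * dt φ p) + inner ℝ (F p) (gradx φ p) + f₀ p * φ p) = 0

/-- Clamping time to `[0, T]` extends the curve continuously to `ℝ` by its end values. The constant
continuation to negative times is what makes the Steklov shifts below meaningful. -/
lemma MemEnergy.exists_curve (hT : 0 ≤ T) (h : MemEnergy Ω T w) :
    ∃ W : ℝ → Lp ℝ 2 (volume.restrict Ω), Continuous W ∧ (∀ t, W t = W (max 0 (min t T))) ∧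
      ∀ t ∈ Icc 0 T, W t =ᵐ[volume.restrict Ω] fun x => w (x, t) := by
  have hcl : ∀ t : ℝ, max 0 (min t T) ∈ Icc 0 T := fun t =>
    ⟨le_max_left _ _, max_le hT (min_le_right _ _)⟩
  have hfix : ∀ t ∈ Icc 0 T, max 0 (min t T) = t := fun t ht => by
    rw [min_eq_left ht.2, max_eq_right ht.1]
  have hW : ContinuousOn (slc Ω w) (Icc 0 T) := by
    intro t ht
    rw [ContinuousWithinAt, tendsto_iff_dist_tendsto_zero]
    have h1 := (ENNReal.tendsto_toReal (by simp)).comp (h.2.2 t ht)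
    refine Tendsto.congr' ?_ h1
    filter_upwards [self_mem_nhdsWithin] with s hs
    exact (dist_slc_le (h.2.1 s hs) (h.2.1 t ht)).symm
  refine ⟨fun t => slc Ω w (max 0 (min t T)), ?_, fun t => ?_, fun t ht => ?_⟩
  · exact hW.comp_continuous (by fun_prop) hcl
  · simp only [hfix _ (hcl t)]
  · simp only [hfix t ht]
    exact slc_coe (h.2.1 t ht)

variable {W : ℝ → Lp ℝ 2 (volume.restrict Ω)}

/-- The weak form, with boundary terms in time. -/
lemma IsDivSolution.endpoints (hT : 0 < T) (h : IsDivSolution Ω T w F f₀ W)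
    {φ : E × ℝ → ℝ} (hφ : IsTest (Ω ×ˢ univ) φ) :
    inner ℝ (W T) (slc Ω φ T) - inner ℝ (W 0) (slc Ω φ 0)
      = (∫ t in Ioo 0 T, inner ℝ (W t) (slc Ω (dt φ) t))
        - ∫ p in cyl Ω T, (inner ℝ (F p) (gradx φ p) + f₀ p * φ p) := by
  have hc1 : Continuous (slc Ω φ) := continuous_slc hφ.1.continuous hφ.2.1
  have hc2 : Continuous (slc Ω (dt φ)) :=
    continuous_slc (contDiff_dt hφ.1).continuous hφ.hasCompactSupport_dt
  have iw : ∀ ψ : E × ℝ → ℝ, MemLp ψ 2 (volume.restrict (cyl Ω T)) →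
      Integrable (fun p => w p * ψ p) (volume.restrict (cyl Ω T)) := fun ψ hψ =>
    h.memLp.integrable_mul hψ
  have iF := integrable_inner_of_memLp h.flux (hφ.memLp_gradx (cyl Ω T))
  have i0 : Integrable (fun p => f₀ p * φ p) (volume.restrict (cyl Ω T)) :=
    h.source.integrable_mul (hφ.memLp _)
  have iR : Integrable (fun p => inner ℝ (F p) (gradx φ p) + f₀ p * φ p)
      (volume.restrict (cyl Ω T)) := iF.add i0
  have iD := iw _ (hφ.memLp_dt (cyl Ω T))
  have hinner : ∀ t ∈ Ioo 0 T, ∀ ψ : E × ℝ → ℝ, Continuous ψ → HasCompactSupport ψ →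
      inner ℝ (W t) (slc Ω ψ t) = ∫ x in Ω, w (x, t) * ψ (x, t) := fun t ht ψ h1 h2 =>
    inner_eq_integral_mul _ _ (h.coe t (Ioo_subset_Icc_self ht)) (slc_coe (memLp_slice h1 h2 Ω t))
  have e1 : ∫ t in Ioo 0 T, inner ℝ (W t) (slc Ω (dt φ) t) = ∫ p in cyl Ω T, w p * dt φ p := by
    rw [integral_cyl iD]
    refine setIntegral_congr_fun measurableSet_Ioo fun t ht => ?_
    exact hinner t ht _ (contDiff_dt hφ.1).continuous hφ.hasCompactSupport_dt
  rw [e1]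
  have e2 : (∫ p in cyl Ω T, w p * dt φ p)
      - (∫ p in cyl Ω T, (inner ℝ (F p) (gradx φ p) + f₀ p * φ p))
      = ∫ p in cyl Ω T, (w p * dt φ p - (inner ℝ (F p) (gradx φ p) + f₀ p * φ p)) :=
    (integral_sub iD iR).symm
  rw [e2]
  have iK : Integrable (fun p => w p * dt φ p - (inner ℝ (F p) (gradx φ p) + f₀ p * φ p))
      (volume.restrict (cyl Ω T)) := iD.sub iR
  refine (sub_eq_integral_of_weak_deriv hT (j := fun t => inner ℝ (W t) (slc Ω φ t))
    (k := fun t => ∫ x in Ω, (w (x, t) * dt φ (x, t)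
      - (inner ℝ (F (x, t)) (gradx φ (x, t)) + f₀ (x, t) * φ (x, t))))
    (h.cont.inner hc1).continuousOn (integrableOn_integral_slice iK) ?_).trans
    (integral_cyl iK).symm
  -- The weak derivative of `t ↦ ⟨W(t), φ(t)⟩` is read off from the equation tested with `ζ(t) φ(x,
  -- t)`, which vanishes near both ends in time.
  intro ζ hζ hζc hζs
  have hT' : IsTest (cyl Ω T) fun p => ζ p.2 * φ p := by
    refine ⟨(contDiff_comp_snd hζ).mul hφ.1, hφ.2.1.mul_left, fun p hp => ⟨?_, ?_⟩⟩
    · exact (hφ.2.2 (tsupport_mul_subset_right hp)).1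
    · have h1 : p ∈ tsupport fun p : E × ℝ => ζ p.2 := tsupport_mul_subset_left hp
      exact hζs (tsupport_comp_subset_preimage ζ continuous_snd h1)
  have heq := h.equation _ hT'
  have iζ : ∀ ψ : E × ℝ → ℝ, Integrable ψ (volume.restrict (cyl Ω T)) → ∀ η : ℝ → ℝ,
      Continuous η → HasCompactSupport η →
      Integrable (fun p => η p.2 * ψ p) (volume.restrict (cyl Ω T)) := by
    intro ψ hψ η hη hηc
    obtain ⟨C, hC⟩ := hη.bounded_above_of_compact_support hηc
    exact hψ.bdd_mul (by fun_prop : Continuous fun p : E × ℝ => η p.2).aestronglyMeasurable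
      (ae_of_all _ fun p => hC _)
  have hζ' : Continuous (deriv ζ) := hζ.continuous_deriv (by simp)
  have iA := iζ _ (iw _ (hφ.memLp (cyl Ω T))) _ hζ' hζc.deriv
  have iB := iζ _ iK ζ hζ.continuous hζc
  rw [← neg_eq_zero]
  refine Eq.trans ?_ heq
  have e3 : ∫ t in Ioo 0 T, (deriv ζ t * inner ℝ (W t) (slc Ω φ t) + ζ t * ∫ x in Ω,
      (w (x, t) * dt φ (x, t) - (inner ℝ (F (x, t)) (gradx φ (x, t)) + f₀ (x, t) * φ (x, t))))
      = ∫ p in cyl Ω T, (deriv ζ p.2 * (w p * φ p) + ζ p.2 * (w p * dt φ p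
          - (inner ℝ (F p) (gradx φ p) + f₀ p * φ p))) := by
    refine Eq.trans ?_ (integral_cyl (iA.add iB)).symm
    refine integral_congr_ae ?_
    filter_upwards [ae_integrable_slice iA, ae_integrable_slice iB,
      ae_restrict_mem measurableSet_Ioo] with t h1 h2 ht
    rw [hinner t ht φ hφ.1.continuous hφ.2.1, ← integral_const_mul, ← integral_const_mul]
    exact (integral_add h1 h2).symm
  rw [e3, ← integral_neg]
  refine integral_congr_ae (ae_of_all _ fun p => ?_)
  simp only [dt_timeMul hζ hφ.1, gradx_timeMul hζ hφ.1, inner_smul_right]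
  ring

end Energy

/-! ### Steklov averages -/

section Steklov

/-- The uniform distribution on `{0} × [-h, 0]`; averaging against it gives the forward Steklov
average in time. -/
def steklovMeasure (h : ℝ) : Measure (E × ℝ) :=
  (volume.restrict (Ioc (0 : ℝ) 1)).map fun σ => ((0 : E), -(h * σ))

lemma measurable_steklov (h : ℝ) : Measurable fun σ : ℝ => ((0 : E), -(h * σ)) := by fun_prop

instance (h : ℝ) : IsProbabilityMeasure (steklovMeasure h) := by
  have : IsProbabilityMeasure (volume.restrict (Ioc (0 : ℝ) 1)) := ⟨by simp⟩
  exact Measure.isProbabilityMeasure_map (measurable_steklov h).aemeasurable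

lemma avg_steklov {F : Type*} [NormedAddCommGroup F] [NormedSpace ℝ F] {X : E × ℝ → F}
    (hX : Continuous X) (h : ℝ) (x : E) (t : ℝ) :
    avg (steklovMeasure h) X (x, t) = ∫ σ in (0 : ℝ)..1, X (x, t + h * σ) := by
  rw [avg, steklovMeasure, integral_map (measurable_steklov h).aemeasurable
    (by fun_prop : Continuous fun q => X ((x, t) - q)).aestronglyMeasurable,
    intervalIntegral.integral_of_le zero_le_one]
  simp

lemma ae_steklov_mem {h : ℝ} (hh : 0 ≤ h) :
    ∀ᵐ q ∂steklovMeasure h, q ∈ ({0} : Set E) ×ˢ Icc (-h) 0 := by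
  refine (ae_map_iff (p := fun q => q ∈ ({0} : Set E) ×ˢ Icc (-h) 0)
    (measurable_steklov h).aemeasurable
    ((isClosed_singleton.prod isClosed_Icc).measurableSet)).2 ?_
  rw [ae_restrict_iff' measurableSet_Ioc]
  refine ae_of_all _ fun σ hσ => ⟨rfl, ?_, ?_⟩
  · simpa using mul_le_of_le_one_right hh hσ.2
  · simpa using mul_nonneg hh hσ.1.le

variable {Ω : Set E} {T : ℝ} {w f₀ : E × ℝ → ℝ} {F : E × ℝ → E}
  {W : ℝ → Lp ℝ 2 (volume.restrict Ω)}

lemma IsTest.eq_zero_of_notMem {Q : Set (E × ℝ)} {φ : E × ℝ → ℝ} (hφ : IsTest Q φ) {p : E × ℝ}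
    (hp : p ∉ Q) : φ p = 0 := by
  by_contra hne
  exact hp (hφ.2.2 (subset_tsupport φ hne))

lemma IsTest.gradx_eq_zero_of_notMem {Q : Set (E × ℝ)} {φ : E × ℝ → ℝ} (hφ : IsTest Q φ)
    {p : E × ℝ} (hp : p ∉ Q) : gradx φ p = 0 := by
  by_contra hne
  exact hp (hφ.2.2 (tsupport_gradx_subset hφ.1 (subset_tsupport _ hne)))

lemma IsTest.avg_steklov {Ψ : E × ℝ → ℝ} (hΨ : IsTest (cyl Ω T) Ψ) {h : ℝ} (hh : 0 ≤ h) :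
    IsTest (Ω ×ˢ univ) (avg (steklovMeasure h) Ψ) := by
  have hK : IsCompact (({0} : Set E) ×ˢ Icc (-h) 0) := isCompact_singleton.prod isCompact_Icc
  have hs := tsupport_avg_subset hΨ.2.1 hK (ae_steklov_mem hh)
  refine ⟨contDiff_avg hΨ.1 hΨ.2.1,
    (hΨ.2.1.isCompact.add hK).of_isClosed_subset (isClosed_tsupport _) hs, fun p hp => ?_⟩
  obtain ⟨a, ha, c, hc, rfl⟩ := hs hp
  have h1 : c.1 = 0 := hc.1
  exact ⟨by simpa [h1] using (hΨ.2.2 ha).1, mem_univ _⟩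

/-- By the fundamental theorem of calculus the time derivative of the average is a difference
quotient. This frees the energy argument from any time derivative of the solution. -/
lemma dt_avg_steklov {Ψ : E × ℝ → ℝ} (hΨ : IsTest (cyl Ω T) Ψ) {h : ℝ} (hh : 0 < h) (x : E)
    (t : ℝ) : dt (avg (steklovMeasure h) Ψ) (x, t) = h⁻¹ * (Ψ (x, t + h) - Ψ (x, t)) := by
  have hd := contDiff_dt hΨ.1
  rw [dt_avg hΨ.1 hΨ.2.1, HeatProbe.avg_steklov hd.continuous]
  have hder : ∀ σ : ℝ, HasDerivAt (fun σ => h⁻¹ * Ψ (x, t + h * σ)) (dt Ψ (x, t + h * σ)) σ := by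
    intro σ
    have h1 : HasDerivAt (fun s => Ψ (x, s)) (dt Ψ (x, t + h * σ)) (t + h * σ) := by
      have : DifferentiableAt ℝ (fun s => Ψ (x, s)) (t + h * σ) :=
        ((hΨ.1.comp (contDiff_prodMk_right x)).differentiable (by simp)) _
      exact this.hasDerivAt
    have h2 : HasDerivAt (fun σ : ℝ => t + h * σ) h σ := by
      simpa using ((hasDerivAt_id σ).const_mul h).const_add t
    have h3 := (h1.comp σ h2).const_mul h⁻¹
    refine h3.congr_deriv ?_
    field_simp
  rw [intervalIntegral.integral_eq_sub_of_hasDerivAt (fun σ _ => hder σ)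
    ((by fun_prop : Continuous fun σ : ℝ => (x, t + h * σ)) |> hd.continuous.comp
      |>.intervalIntegrable 0 1)]
  simp [mul_sub]

/-- A forward average need not vanish at `t = 0` although `Ψ` does. The boundary term so created is
the one cancelled when time is shifted by `h` in the tested equation. -/
lemma inner_slc_avg_zero {Ψ : E × ℝ → ℝ} (hΨ : IsTest (cyl Ω T) Ψ) {h : ℝ} (hh : 0 < h)
    (f : Lp ℝ 2 (volume.restrict Ω)) :
    inner ℝ f (slc Ω (avg (steklovMeasure h) Ψ) 0)
      = h⁻¹ * ∫ s in (0 : ℝ)..h, inner ℝ f (slc Ω Ψ s) := by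
  have hφ := hΨ.avg_steklov hh.le
  have hsl := fun t => memLp_slice hΨ.1.continuous hΨ.2.1 Ω t
  rw [inner_eq_integral_mul f _ (ae_eq_refl f)
    (slc_coe (memLp_slice hφ.1.continuous hφ.2.1 Ω 0))]
  have e1 : h⁻¹ * ∫ s in (0 : ℝ)..h, inner ℝ f (slc Ω Ψ s)
      = ∫ σ in (0 : ℝ)..1, inner ℝ f (slc Ω Ψ (h * σ)) := by
    rw [intervalIntegral.integral_comp_mul_left (fun s => inner ℝ f (slc Ω Ψ s)) hh.ne']
    simp
  rw [e1]
  have e2 : ∀ σ : ℝ, inner ℝ f (slc Ω Ψ (h * σ)) = ∫ x in Ω, f x * Ψ (x, h * σ) := fun σ =>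
    inner_eq_integral_mul f _ (ae_eq_refl f) (slc_coe (hsl _))
  simp_rw [e2, HeatProbe.avg_steklov hΨ.1.continuous, zero_add,
    intervalIntegral.integral_of_le zero_le_one, ← integral_const_mul]
  refine integral_integral_swap ?_
  have hm : MemLp (fun z : E × ℝ => Ψ (z.1, h * z.2)) 2
      ((volume.restrict Ω).prod (volume.restrict (Ioc 0 1))) := by
    rw [Measure.prod_restrict]
    refine MemLp.restrict _ (Continuous.memLp_of_hasCompactSupport (μ := volume)
      (hΨ.1.continuous.comp (by fun_prop)) ?_)
    refine hΨ.2.1.comp_homeomorph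
      ((Homeomorph.refl E).prodCongr (Homeomorph.mulLeft₀ h hh.ne'))
  exact ((Lp.memLp f).comp_fst _).integrable_mul hm

/-- The equation tested with a Steklov average. -/
lemma IsDivSolution.steklov (hT : 0 < T) (hw : IsDivSolution Ω T w F f₀ W) {Ψ : E × ℝ → ℝ}
    (hΨ : IsTest (cyl Ω T) Ψ) {h : ℝ} (hh : 0 < h) :
    ∫ p in cyl Ω T, (inner ℝ (F p) (avg (steklovMeasure h) (gradx Ψ) p)
        + f₀ p * avg (steklovMeasure h) Ψ p)
      = h⁻¹ * ∫ s in (0 : ℝ)..T, inner ℝ (W (s - h) - W s) (slc Ω Ψ s) := by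
  have hφ := hΨ.avg_steklov hh.le
  have e := hw.endpoints hT hφ
  have hsl := fun t => memLp_slice hΨ.1.continuous hΨ.2.1 Ω t
  have hΨc : Continuous (slc Ω Ψ) := continuous_slc hΨ.1.continuous hΨ.2.1
  have hz : ∀ s, T ≤ s → slc Ω Ψ s = 0 := fun s hs =>
    slc_eq_zero fun x => hΨ.eq_zero_of_notMem fun hp => absurd hp.2.2 (not_lt.2 hs)
  have hT0 : slc Ω (avg (steklovMeasure h) Ψ) T = 0 := by
    refine slc_eq_zero fun x => ?_
    rw [HeatProbe.avg_steklov hΨ.1.continuous, intervalIntegral.integral_congr (g := fun _ => 0),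
      intervalIntegral.integral_zero]
    intro σ hσ
    rw [uIcc_of_le zero_le_one] at hσ
    refine hΨ.eq_zero_of_notMem fun hp => absurd hp.2.2 (not_lt.2 ?_)
    have := mul_nonneg hh.le hσ.1
    linarith
  have hdt : ∀ t, slc Ω (dt (avg (steklovMeasure h) Ψ)) t
      = h⁻¹ • (slc Ω Ψ (t + h) - slc Ω Ψ t) := by
    intro t
    refine Lp.ext ?_
    filter_upwards [slc_coe (memLp_slice (contDiff_dt hφ.1).continuous hφ.hasCompactSupport_dt Ω t),
      slc_coe (hsl (t + h)), slc_coe (hsl t), Lp.coeFn_smul h⁻¹ (slc Ω Ψ (t + h) - slc Ω Ψ t),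
      Lp.coeFn_sub (slc Ω Ψ (t + h)) (slc Ω Ψ t)] with x h1 h2 h3 h4 h5
    rw [h1, h4, Pi.smul_apply, h5, Pi.sub_apply, h2, h3, dt_avg_steklov hΨ hh, smul_eq_mul]
  simp_rw [hT0, hdt, gradx_avg hΨ.1 hΨ.2.1] at e
  rw [inner_zero_right, zero_sub, inner_slc_avg_zero hΨ hh (W 0),
    ← integral_Ioc_eq_integral_Ioo, ← intervalIntegral.integral_of_le hT.le] at e
  have hWh : Continuous fun s => W (s - h) := hw.cont.comp (by fun_prop)
  have c1 : Continuous fun t => (inner ℝ (W t) (slc Ω Ψ (t + h)) : ℝ) :=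
    hw.cont.inner (hΨc.comp (by fun_prop))
  have c2 : Continuous fun t => (inner ℝ (W t) (slc Ω Ψ t) : ℝ) := hw.cont.inner hΨc
  have c3 : Continuous fun t => (inner ℝ (W (t - h)) (slc Ω Ψ t) : ℝ) := hWh.inner hΨc
  have e1 : ∫ t in (0 : ℝ)..T, inner ℝ (W t) (h⁻¹ • (slc Ω Ψ (t + h) - slc Ω Ψ t))
      = h⁻¹ * ((∫ t in (0 : ℝ)..T, inner ℝ (W t) (slc Ω Ψ (t + h)))
        - ∫ t in (0 : ℝ)..T, inner ℝ (W t) (slc Ω Ψ t)) := by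
    simp_rw [inner_smul_right, inner_sub_right]
    rw [intervalIntegral.integral_const_mul, intervalIntegral.integral_sub
      (c1.intervalIntegrable _ _) (c2.intervalIntegrable _ _)]
  -- Integration by parts for differences: after the shift by `h`, the part beyond `T` vanishes with
  -- `Ψ`, and on `[0, h]` the clamped curve `W(s - h)` stays at `W(0)`.
  have e2 : ∫ t in (0 : ℝ)..T, inner ℝ (W t) (slc Ω Ψ (t + h))
      = (∫ s in (0 : ℝ)..T, inner ℝ (W (s - h)) (slc Ω Ψ s))
        - ∫ s in (0 : ℝ)..h, inner ℝ (W 0) (slc Ω Ψ s) := by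
    have s1 : ∫ t in (0 : ℝ)..T, inner ℝ (W t) (slc Ω Ψ (t + h))
        = ∫ s in h..(T + h), inner ℝ (W (s - h)) (slc Ω Ψ s) := by
      have := intervalIntegral.integral_comp_add_right (a := 0) (b := T)
        (fun s => (inner ℝ (W (s - h)) (slc Ω Ψ s) : ℝ)) h
      simpa using this
    have s2 : ∫ s in T..(T + h), inner ℝ (W (s - h)) (slc Ω Ψ s) = (0 : ℝ) := by
      rw [intervalIntegral.integral_congr (g := fun _ => 0), intervalIntegral.integral_zero]
      intro s hs
      rw [uIcc_of_le (by linarith)] at hs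
      simp [hz s hs.1]
    have s3 : ∫ s in (0 : ℝ)..h, inner ℝ (W 0) (slc Ω Ψ s)
        = ∫ s in (0 : ℝ)..h, inner ℝ (W (s - h)) (slc Ω Ψ s) := by
      refine intervalIntegral.integral_congr fun s hs => ?_
      rw [uIcc_of_le hh.le] at hs
      rw [hw.clamp (s - h), max_eq_left ((min_le_left _ _).trans (by linarith [hs.2]))]
    rw [s1, s3]
    have a1 := intervalIntegral.integral_add_adjacent_intervals (c3.intervalIntegrable (μ := volume) 0 h)
      (c3.intervalIntegrable h (T + h))
    have a2 := intervalIntegral.integral_add_adjacent_intervals (c3.intervalIntegrable (μ := volume) 0 T)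
      (c3.intervalIntegrable T (T + h))
    linarith
  have e3 : ∫ s in (0 : ℝ)..T, inner ℝ (W (s - h) - W s) (slc Ω Ψ s)
      = (∫ s in (0 : ℝ)..T, inner ℝ (W (s - h)) (slc Ω Ψ s))
        - ∫ t in (0 : ℝ)..T, inner ℝ (W t) (slc Ω Ψ t) := by
    simp_rw [inner_sub_left]
    rw [intervalIntegral.integral_sub (c3.intervalIntegrable _ _) (c2.intervalIntegrable _ _)]
  rw [e1, e2] at e
  rw [e3]
  linarith

/-- Steklov averages of test functions which converge in `L²`. -/
lemma eventually_steklov_le {H : Type*} [NormedAddCommGroup H] [InnerProductSpace ℝ H]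
    [CompleteSpace H] {Q : Set (E × ℝ)} (hQ : MeasurableSet Q) {X : ℕ → E × ℝ → H} {Y Z : E × ℝ → H}
    (hX : ∀ n, Continuous (X n)) (hXc : ∀ n, HasCompactSupport (X n))
    (hX0 : ∀ n p, p ∉ Q → X n p = 0) (hY : MemLp Y 2 (volume.restrict Q))
    (hZ : MemLp Z 2 (volume.restrict Q))
    (hlim : Tendsto (fun n => eLpNorm (fun p => X n p - Y p) 2 (volume.restrict Q)) atTop (𝓝 0))
    {ε : ℝ} (hε : 0 < ε) :
    ∃ h₀ > 0, ∀ h, 0 < h → h < h₀ → ∀ᶠ n in atTop,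
      |(∫ p in Q, inner ℝ (Z p) (avg (steklovMeasure h) (X n) p))
        - ∫ p in Q, inner ℝ (Z p) (Y p)| ≤ ε := by
  set N := (eLpNorm Z 2 (volume.restrict Q)).toReal with hN
  have hN0 : 0 ≤ N := ENNReal.toReal_nonneg
  -- Translates see values outside `Q`, so `Y` is extended by zero, consistently with the vanishing
  -- of `X n` there, and replaced by a strongly measurable representative.
  obtain ⟨Y', hY'm, hYY'⟩ : ∃ Y' : E × ℝ → H, StronglyMeasurable Y' ∧ Q.indicator Y =ᵐ[volume] Y' := by
    have := (memLp_indicator_iff_restrict hQ).2 hY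
    exact this.1
  have hY'2 : MemLp Y' 2 volume :=
    ((memLp_indicator_iff_restrict hQ).2 hY).ae_eq hYY'
  -- There are two errors of size `η`: averaging contracts `X n - Y'`, and it moves `Y'` only
  -- slightly. The threshold for `h` depends on `Y'` alone, so it is fixed before `n`.
  set η : ℝ := ε / (2 * (N + 1)) with hη
  have hηpos : 0 < η := by positivity
  obtain ⟨δ, hδ, htr⟩ := exists_translate_le hY'2 (ε := ENNReal.ofReal η) (by simpa using hηpos)
  refine ⟨δ, hδ, fun h hh hhδ => ?_⟩
  have hmem : ∀ n, MemLp (X n) 2 volume := fun n => (hX n).memLp_of_hasCompactSupport (hXc n)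
  filter_upwards [(tendsto_order.1 hlim).2 (ENNReal.ofReal η) (by simpa using hηpos)] with n hn
  have hXm : StronglyMeasurable (X n) := (hX n).stronglyMeasurable
  have b1 : eLpNorm (fun p => X n p - Y' p) 2 volume ≤ ENNReal.ofReal η := by
    refine le_trans (le_of_eq ?_) hn.le
    rw [← eLpNorm_indicator_eq_eLpNorm_restrict hQ]
    refine eLpNorm_congr_ae ?_
    filter_upwards [hYY'] with p hp
    rw [← hp]
    by_cases hpQ : p ∈ Q
    · simp [hpQ]
    · simp [hpQ, hX0 n p hpQ]
  have b2 : eLpNorm (avg (steklovMeasure h) fun p => X n p - Y' p) 2 volume ≤ ENNReal.ofReal η :=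
    (eLpNorm_avg_le (hXm.sub hY'm)).trans b1
  have b3 : eLpNorm (fun p => avg (steklovMeasure h) Y' p - Y' p) 2 volume ≤ ENNReal.ofReal η := by
    refine eLpNorm_avg_sub_le hY'm hY'2 ?_
    filter_upwards [ae_steklov_mem hh.le] with q hq
    refine htr q ?_
    rw [Prod.norm_def, max_lt_iff]
    have h1 : q.1 = 0 := hq.1
    refine ⟨by simpa [h1] using hδ, ?_⟩
    rw [Real.norm_eq_abs, abs_lt]
    constructor <;> linarith [hq.2.1, hq.2.2]
  have m1 : AEStronglyMeasurable (avg (steklovMeasure h) (X n)) volume := by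
    have : StronglyMeasurable fun z : (E × ℝ) × (E × ℝ) => X n (z.1 - z.2) :=
      hXm.comp_measurable (measurable_fst.sub measurable_snd)
    exact this.integral_prod_right.aestronglyMeasurable
  have m2 : AEStronglyMeasurable (avg (steklovMeasure h) Y') volume := by
    have : StronglyMeasurable fun z : (E × ℝ) × (E × ℝ) => Y' (z.1 - z.2) :=
      hY'm.comp_measurable (measurable_fst.sub measurable_snd)
    exact this.integral_prod_right.aestronglyMeasurable
  have hdecomp : (avg (steklovMeasure h) fun p => X n p - Y' p)
      =ᵐ[volume] fun p => avg (steklovMeasure h) (X n) p - avg (steklovMeasure h) Y' p := by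
    have hint := ae_integrable_of_eLpNorm_le (μ := (volume : Measure (E × ℝ)))
      (ν := steklovMeasure h) (h := fun z : (E × ℝ) × (E × ℝ) => Y' (z.1 - z.2))
      (hY'm.comp_measurable (measurable_fst.sub measurable_snd)).aestronglyMeasurable
      (w := fun _ => eLpNorm Y' 2 volume + 1) measurable_const
      (fun _ => by simp) (fun _ => by simp [hY'2.2.ne]) (by simp [hY'2.2.ne])
      (ae_of_all _ fun q => by rw [eLpNorm_translate hY'm]; exact le_self_add)
    filter_upwards [hint] with p hp
    exact integral_sub (integrable_translate (hX n) (hXc n) p) hp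
  have b4 : eLpNorm (fun p => avg (steklovMeasure h) (X n) p - Y' p) 2 volume
      ≤ ENNReal.ofReal (2 * η) := by
    rw [eLpNorm_congr_ae hdecomp] at b2
    have hadd := eLpNorm_add_le (m1.sub m2) (m2.sub hY'm.aestronglyMeasurable) (p := 2)
      (by norm_num)
    refine le_trans (le_of_eq ?_) (hadd.trans ((add_le_add b2 b3).trans (le_of_eq ?_)))
    · congr 1; funext p; simp
    · rw [← ENNReal.ofReal_add hηpos.le hηpos.le]; congr 1; ring
  have hd2 : MemLp (fun p => avg (steklovMeasure h) (X n) p - Y' p) 2 volume :=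
    ⟨m1.sub hY'm.aestronglyMeasurable, b4.trans_lt ENNReal.ofReal_lt_top⟩
  have hav : MemLp (avg (steklovMeasure h) (X n)) 2 volume := by
    have := hd2.add hY'2
    refine this.congr_norm m1 (ae_of_all _ fun p => by simp)
  have eY : ∫ p in Q, inner ℝ (Z p) (Y p) = ∫ p in Q, inner ℝ (Z p) (Y' p) := by
    refine integral_congr_ae ?_
    have := ae_restrict_of_ae (s := Q) hYY'
    filter_upwards [this, ae_restrict_mem hQ] with p hp hpQ
    rw [← hp, indicator_of_mem hpQ]
  rw [eY, ← integral_sub (integrable_inner_of_memLp hZ (hav.restrict Q))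
    (integrable_inner_of_memLp hZ (hY'2.restrict Q))]
  simp_rw [← inner_sub_right]
  refine (abs_integral_inner_le hZ (hd2.restrict Q)).trans ?_
  have b5 : (eLpNorm (fun p => avg (steklovMeasure h) (X n) p - Y' p) 2
      (volume.restrict Q)).toReal ≤ 2 * η := by
    refine ENNReal.toReal_le_of_le_ofReal (by positivity) (le_trans ?_ b4)
    exact eLpNorm_mono_measure _ Measure.restrict_le_self
  calc N * _ ≤ N * (2 * η) := by gcongr
    _ ≤ ε := by
      rw [hη]
      have : N * (2 * (ε / (2 * (N + 1)))) = ε * (N / (N + 1)) := by field_simp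
      rw [this]
      exact mul_le_of_le_one_right hε.le (by rw [div_le_one (by positivity)]; linarith)

end Steklov

/-! ### The energy inequality for convex functions of a weak solution -/

section EnergyInequality

/-- A function `Φ` which is convex with derivative `ψ`, where `ψ` is Lipschitz. -/
structure IsConvexPair (L : NNReal) (Φ ψ : ℝ → ℝ) : Prop where
  lipschitz : LipschitzWith L ψ
  zero : Φ 0 = 0
  deriv_zero : ψ 0 = 0
  convex : ∀ r s, Φ r - Φ s ≤ ψ r * (r - s)

namespace IsConvexPair

variable {L : NNReal} {Φ ψ : ℝ → ℝ} (h : IsConvexPair L Φ ψ)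
include h

lemma abs_deriv_le (r : ℝ) : |ψ r| ≤ L * |r| := by
  have := h.lipschitz.dist_le_mul r 0
  simpa [Real.dist_eq, h.deriv_zero] using this

/-- The subgradient inequality, used in both orders, bounds the increment from above and from below.
Differentiability of `Φ` is never needed. -/
lemma abs_sub_le (r s : ℝ) : |Φ r - Φ s| ≤ (|ψ r| + |ψ s|) * |r - s| := by
  have h1 := h.convex r s
  have h2 := h.convex s r
  have a1 := (le_abs_self (ψ r * (r - s))).trans_eq (abs_mul _ _)
  have a2 := (le_abs_self (ψ s * (s - r))).trans_eq (abs_mul _ _)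
  rw [abs_sub_comm s r] at a2
  have p1 := mul_nonneg (abs_nonneg (ψ r)) (abs_nonneg (r - s))
  have p2 := mul_nonneg (abs_nonneg (ψ s)) (abs_nonneg (r - s))
  rw [abs_le]
  constructor <;> nlinarith

lemma abs_le (r : ℝ) : |Φ r| ≤ L * r ^ 2 := by
  have := h.abs_sub_le r 0
  rw [h.zero, h.deriv_zero, abs_zero, add_zero, sub_zero, sub_zero] at this
  refine this.trans ?_
  rw [← sq_abs r]
  nlinarith [h.abs_deriv_le r, abs_nonneg r]

lemma continuous : Continuous Φ := by
  rw [continuous_iff_continuousAt]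
  intro s
  rw [ContinuousAt, tendsto_iff_norm_sub_tendsto_zero]
  have hc : Tendsto (fun r => (|ψ r| + |ψ s|) * |r - s|) (𝓝 s) (𝓝 0) := by
    have : Continuous fun r => (|ψ r| + |ψ s|) * |r - s| := by
      have := h.lipschitz.continuous
      fun_prop
    simpa using this.tendsto s
  exact squeeze_zero (fun _ => norm_nonneg _) (fun r => h.abs_sub_le r s) hc

variable {α : Type*} [MeasurableSpace α] {μ : Measure α}

lemma integrable {f : α → ℝ} (hf : MemLp f 2 μ) : Integrable (fun x => Φ (f x)) μ := by
  refine (hf.integrable_sq.const_mul (L : ℝ)).mono'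
    (h.continuous.comp_aestronglyMeasurable hf.1) (ae_of_all _ fun x => ?_)
  exact h.abs_le (f x)

lemma integral_sub_le (f g : Lp ℝ 2 μ) :
    (∫ x, Φ (f x) ∂μ) - ∫ x, Φ (g x) ∂μ
      ≤ inner ℝ (f - g) (h.lipschitz.compLp h.deriv_zero f) := by
  rw [L2.inner_def, ← integral_sub (h.integrable (Lp.memLp f)) (h.integrable (Lp.memLp g))]
  refine integral_mono_ae ((h.integrable (Lp.memLp f)).sub (h.integrable (Lp.memLp g)))
    (L2.integrable_inner _ _) ?_
  filter_upwards [Lp.coeFn_sub f g, h.lipschitz.coeFn_compLp h.deriv_zero f] with x h1 h2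
  rw [h1, h2]
  simpa using h.convex (f x) (g x)

/-- The functional is squeezed between its subgradient inequalities at `f` and at `g`, whose linear
terms tend to zero in `L²`. -/
lemma continuous_integral : Continuous fun f : Lp ℝ 2 μ => ∫ x, Φ (f x) ∂μ := by
  rw [continuous_iff_continuousAt]
  intro g
  have hcomp := h.lipschitz.continuous_compLp (μ := μ) (p := 2) h.deriv_zero
  have l1 : Tendsto (fun f : Lp ℝ 2 μ => (∫ x, Φ (g x) ∂μ)
      + inner ℝ (f - g) (h.lipschitz.compLp h.deriv_zero f)) (𝓝 g) (𝓝 (∫ x, Φ (g x) ∂μ)) := by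
    have : Continuous fun f : Lp ℝ 2 μ => (∫ x, Φ (g x) ∂μ)
      + inner ℝ (f - g) (h.lipschitz.compLp h.deriv_zero f) := by fun_prop
    simpa using this.tendsto g
  have l2 : Tendsto (fun f : Lp ℝ 2 μ => (∫ x, Φ (g x) ∂μ)
      - inner ℝ (g - f) (h.lipschitz.compLp h.deriv_zero g)) (𝓝 g) (𝓝 (∫ x, Φ (g x) ∂μ)) := by
    have : Continuous fun f : Lp ℝ 2 μ => (∫ x, Φ (g x) ∂μ)
      - inner ℝ (g - f) (h.lipschitz.compLp h.deriv_zero g) := by fun_prop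
    simpa using this.tendsto g
  refine tendsto_of_tendsto_of_tendsto_of_le_of_le l2 l1 (fun f => ?_) (fun f => ?_)
  · have := h.integral_sub_le g f
    simp only []
    linarith
  · have := h.integral_sub_le f g
    simp only []
    linarith

end IsConvexPair

variable {Ω : Set E} {T : ℝ} {w f₀ : E × ℝ → ℝ} {F : E × ℝ → E}
  {W : ℝ → Lp ℝ 2 (volume.restrict Ω)}

/-- Convergence is assumed in `L²` of space-time and not on each slice. That suffices: `D` is
bounded on `[0, T]`, and the squared distances of the slices integrate to the squared space-time
distance. -/
lemma tendsto_integral_inner_slc {Z : ℝ → Lp ℝ 2 (volume.restrict Ω)}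
    (hT : 0 < T) {D : ℝ → Lp ℝ 2 (volume.restrict Ω)} (hD : Continuous D) (hZ : Continuous Z)
    {v : E × ℝ → ℝ} (hω : MemLp v 2 (volume.restrict (cyl Ω T)))
    (hZω : ∀ t ∈ Ioo 0 T, Z t =ᵐ[volume.restrict Ω] fun x => v (x, t))
    {Ψ : ℕ → E × ℝ → ℝ} (hΨ : ∀ n, IsTest (cyl Ω T) (Ψ n))
    (hlim : Tendsto (fun n => eLpNorm (fun p => Ψ n p - v p) 2 (volume.restrict (cyl Ω T)))
      atTop (𝓝 0)) :
    Tendsto (fun n => ∫ s in (0 : ℝ)..T, inner ℝ (D s) (slc Ω (Ψ n) s)) atTop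
      (𝓝 (∫ s in (0 : ℝ)..T, inner ℝ (D s) (Z s))) := by
  obtain ⟨M, hM⟩ := (isCompact_Icc (a := (0 : ℝ)) (b := T)).exists_bound_of_continuousOn
    hD.continuousOn
  have hM0 : 0 ≤ M := (norm_nonneg _).trans (hM 0 ⟨le_rfl, hT.le⟩)
  have hsc : ∀ n, Continuous (slc Ω (Ψ n)) := fun n =>
    continuous_slc (hΨ n).1.continuous (hΨ n).2.1
  set e : ℕ → ℝ := fun n => (eLpNorm (fun p => Ψ n p - v p) 2 (volume.restrict (cyl Ω T))).toReal
    with he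
  have he0 : Tendsto e atTop (𝓝 0) := by
    simpa [Function.comp_def] using (ENNReal.tendsto_toReal (by simp)).comp hlim
  have hsq : ∀ n, ∫ s in Ioo 0 T, ‖slc Ω (Ψ n) s - Z s‖ ^ 2 = e n ^ 2 := by
    intro n
    have hm : MemLp (fun p => Ψ n p - v p) 2 (volume.restrict (cyl Ω T)) :=
      ((hΨ n).memLp _).sub hω
    rw [he, ← integral_norm_sq hm, integral_cyl hm.norm.integrable_sq]
    refine setIntegral_congr_fun measurableSet_Ioo fun s hs => ?_
    rw [← real_inner_self_eq_norm_sq, L2.inner_def]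
    refine integral_congr_ae ?_
    filter_upwards [Lp.coeFn_sub (slc Ω (Ψ n) s) (Z s), hZω s hs,
      slc_coe (memLp_slice (hΨ n).1.continuous (hΨ n).2.1 Ω s)] with x h1 h2 h3
    rw [h1, Pi.sub_apply, h2, h3, real_inner_self_eq_norm_sq]
  rw [tendsto_iff_norm_sub_tendsto_zero]
  have hb : Tendsto (fun n => M * (Real.sqrt T * e n)) atTop (𝓝 0) := by
    simpa using (he0.const_mul (Real.sqrt T)).const_mul M
  refine squeeze_zero (fun _ => norm_nonneg _) (fun n => ?_) hb
  have hc : Continuous fun s => ‖slc Ω (Ψ n) s - Z s‖ := ((hsc n).sub hZ).norm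
  rw [← intervalIntegral.integral_sub ((hD.inner (hsc n)).intervalIntegrable _ _)
    ((hD.inner hZ).intervalIntegrable _ _), intervalIntegral.integral_of_le hT.le,
    integral_Ioc_eq_integral_Ioo]
  simp_rw [← inner_sub_right]
  have i1 : IntegrableOn (fun s => ‖slc Ω (Ψ n) s - Z s‖) (Ioo 0 T) :=
    hc.integrableOn_Icc.mono_set Ioo_subset_Icc_self
  have hcs : ∫ s in Ioo 0 T, ‖slc Ω (Ψ n) s - Z s‖ ≤ Real.sqrt T * e n := by
    have hm1 : MemLp (fun _ : ℝ => (1 : ℝ)) 2 (volume.restrict (Ioo 0 T)) := memLp_const _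
    have hm2 : MemLp (fun s => ‖slc Ω (Ψ n) s - Z s‖) 2 (volume.restrict (Ioo 0 T)) := by
      refine (memLp_two_iff_integrable_sq hc.aestronglyMeasurable).2 ?_
      exact (hc.pow 2).integrableOn_Icc.mono_set Ioo_subset_Icc_self
    have := (le_abs_self _).trans (abs_integral_mul_le hm1 hm2)
    simp only [one_mul] at this
    refine this.trans (le_of_eq ?_)
    congr 1
    · have := integral_norm_sq hm1
      rw [← Real.sqrt_sq ENNReal.toReal_nonneg, ← this]
      simp [hT.le]
    · have h2 := integral_norm_sq hm2
      simp only [norm_norm] at h2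
      rw [hsq n] at h2
      exact ((sq_eq_sq₀ ENNReal.toReal_nonneg ENNReal.toReal_nonneg).1 h2).symm
  refine (norm_integral_le_of_norm_le (i1.const_mul M) ?_).trans ?_
  · rw [ae_restrict_iff' measurableSet_Ioo]
    refine ae_of_all _ fun s hs => ?_
    exact (norm_inner_le_norm _ _).trans
      (mul_le_mul_of_nonneg_right (hM s (Ioo_subset_Icc_self hs)) (norm_nonneg _))
  · rw [integral_const_mul]
    gcongr

/-- The energy inequality: if `∂ₜ w = div F - f₀` and `Φ` is convex with derivative `ψ`, where
`ψ(w)` is a limit of test functions with spatial gradients converging to `G`, then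
`[∫ Φ(w)]_0^T ≤ - ∫ (F · G + f₀ ψ(w))`. -/
theorem IsDivSolution.energy_le (hΩ : IsOpen Ω) (hT : 0 < T) (hw : IsDivSolution Ω T w F f₀ W)
    {L : NNReal} {Φ ψ : ℝ → ℝ} (h : IsConvexPair L Φ ψ) {G : E × ℝ → E}
    (hG : MemLp G 2 (volume.restrict (cyl Ω T)))
    {Ψ : ℕ → E × ℝ → ℝ} (hΨ : ∀ n, IsTest (cyl Ω T) (Ψ n))
    (hlim : Tendsto (fun n => eLpNorm (fun p => Ψ n p - ψ (w p)) 2 (volume.restrict (cyl Ω T)))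
      atTop (𝓝 0))
    (hlimG : Tendsto (fun n => eLpNorm (fun p => gradx (Ψ n) p - G p) 2
      (volume.restrict (cyl Ω T))) atTop (𝓝 0)) :
    (∫ x in Ω, Φ (w (x, T))) - ∫ x in Ω, Φ (w (x, 0))
      ≤ -∫ p in cyl Ω T, (inner ℝ (F p) (G p) + f₀ p * ψ (w p)) := by
  have hQ := (isOpen_cyl hΩ T).measurableSet
  set Z : ℝ → Lp ℝ 2 (volume.restrict Ω) := fun t => h.lipschitz.compLp h.deriv_zero (W t) with hZd
  have hZ : Continuous Z := (h.lipschitz.continuous_compLp h.deriv_zero).comp hw.cont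
  have hω : MemLp (fun p => ψ (w p)) 2 (volume.restrict (cyl Ω T)) :=
    h.lipschitz.comp_memLp h.deriv_zero hw.memLp
  have hZω : ∀ t ∈ Ioo 0 T, Z t =ᵐ[volume.restrict Ω] fun x => ψ (w (x, t)) := by
    intro t ht
    filter_upwards [h.lipschitz.coeFn_compLp h.deriv_zero (W t),
      hw.coe t (Ioo_subset_Icc_self ht)] with x h1 h2
    rw [h1, Function.comp_apply, h2]
  set J : ℝ → ℝ := fun t => ∫ x in Ω, Φ (W t x) with hJ
  have hJc : Continuous J := h.continuous_integral.comp hw.cont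
  have hJe : ∀ t ∈ Icc 0 T, J t = ∫ x in Ω, Φ (w (x, t)) := by
    intro t ht
    refine integral_congr_ae ?_
    filter_upwards [hw.coe t ht] with x hx
    rw [hx]
  rw [← hJe T ⟨hT.le, le_rfl⟩, ← hJe 0 ⟨le_rfl, hT.le⟩]
  have i1 := integrable_inner_of_memLp hw.flux hG
  have i2 : Integrable (fun p => f₀ p * ψ (w p)) (volume.restrict (cyl Ω T)) :=
    hw.source.integrable_mul hω
  have hR : ∫ p in cyl Ω T, (inner ℝ (F p) (G p) + f₀ p * ψ (w p))
      = (∫ p in cyl Ω T, inner ℝ (F p) (G p)) + ∫ p in cyl Ω T, f₀ p * ψ (w p) :=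
    integral_add i1 i2
  rw [hR]
  refine le_of_forall_pos_le_add fun ε hε => ?_
  obtain ⟨h1, h1pos, H1⟩ := eventually_steklov_le hQ (fun n => (contDiff_gradx (hΨ n).1).continuous)
    (fun n => (hΨ n).hasCompactSupport_gradx) (fun n p => (hΨ n).gradx_eq_zero_of_notMem) hG
    hw.flux hlimG (ε := ε / 3) (by positivity)
  obtain ⟨h2, h2pos, H2⟩ := eventually_steklov_le hQ (fun n => (hΨ n).1.continuous)
    (fun n => (hΨ n).2.1) (fun n p => (hΨ n).eq_zero_of_notMem) hω
    hw.source hlim (ε := ε / 3) (by positivity)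
  obtain ⟨h3, h3pos, H3⟩ := Metric.continuous_iff.1 hJc T (ε / 3) (by positivity)
  obtain ⟨k, hk0, hk1, hk2, hk3, hkT⟩ : ∃ k, 0 < k ∧ k < h1 ∧ k < h2 ∧ k < h3 ∧ k ≤ T := by
    refine ⟨min (min (h1 / 2) (h2 / 2)) (min (h3 / 2) T), by positivity, ?_, ?_, ?_, ?_⟩
    · exact ((min_le_left _ _).trans (min_le_left _ _)).trans_lt (by linarith)
    · exact ((min_le_left _ _).trans (min_le_right _ _)).trans_lt (by linarith)
    · exact ((min_le_right _ _).trans (min_le_left _ _)).trans_lt (by linarith)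
    · exact (min_le_right _ _).trans (min_le_right _ _)
  have hWk : Continuous fun s => W (s - k) := hw.cont.comp (by fun_prop)
  have hlim1 := tendsto_integral_inner_slc hT (D := fun s => W (s - k) - W s)
    (hWk.sub hw.cont) hZ hω hZω hΨ hlim
  -- The averaging length `k` is kept fixed while `n → ∞`, so the difference quotient converges
  -- without any uniformity in `k`.
  have hle : -((∫ p in cyl Ω T, inner ℝ (F p) (G p)) + ∫ p in cyl Ω T, f₀ p * ψ (w p))
      + 2 * (ε / 3) ≥ -(k⁻¹ * ∫ s in (0 : ℝ)..T, inner ℝ (W (s - k) - W s) (Z s)) := by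
    refine le_of_tendsto (hlim1.const_mul k⁻¹).neg ?_
    filter_upwards [H1 k hk0 hk1, H2 k hk0 hk2] with n e1 e2
    rw [← hw.steklov hT (hΨ n) hk0]
    have hmA : ∀ {H : Type} [NormedAddCommGroup H] [InnerProductSpace ℝ H] [CompleteSpace H]
        {X : E × ℝ → H}, Continuous X → HasCompactSupport X →
        MemLp (avg (steklovMeasure k) X) 2 (volume.restrict (cyl Ω T)) := by
      intro H _ _ _ X hX hc
      refine MemLp.restrict _ ⟨?_, ?_⟩
      · have : StronglyMeasurable fun z : (E × ℝ) × (E × ℝ) => X (z.1 - z.2) :=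
          (by fun_prop : Continuous fun z : (E × ℝ) × (E × ℝ) => X (z.1 - z.2)).stronglyMeasurable
        exact this.integral_prod_right.aestronglyMeasurable
      · exact (eLpNorm_avg_le hX.stronglyMeasurable).trans_lt
          (hX.memLp_of_hasCompactSupport hc).2
    have j1 := integrable_inner_of_memLp hw.flux
      (hmA (contDiff_gradx (hΨ n).1).continuous (hΨ n).hasCompactSupport_gradx)
    have j2 : Integrable (fun p => f₀ p * avg (steklovMeasure k) (Ψ n) p)
        (volume.restrict (cyl Ω T)) :=
      hw.source.integrable_mul (hmA (hΨ n).1.continuous (hΨ n).2.1)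
    have j3 := integral_add j1 j2
    have e2' : |(∫ p in cyl Ω T, f₀ p * avg (steklovMeasure k) (Ψ n) p)
        - ∫ p in cyl Ω T, f₀ p * ψ (w p)| ≤ ε / 3 := by simpa [mul_comm] using e2
    have a1 := (abs_le.1 e1).1
    have a2 := (abs_le.1 e2').1
    rw [j3]
    linarith
  have hJk : Continuous fun s => J (s - k) := hJc.comp (by fun_prop)
  -- Convexity replaces the chain rule: pairing the backward difference `W(s - k) - W(s)` with
  -- `ψ(W(s))` is at most `J(s - k) - J(s)`. Forward averages of the test functions were chosen to
  -- obtain this difference.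
  have hlow : ∫ s in (0 : ℝ)..T, inner ℝ (W (s - k) - W s) (Z s)
      ≤ (∫ s in (0 : ℝ)..T, J (s - k)) - ∫ s in (0 : ℝ)..T, J s := by
    rw [← intervalIntegral.integral_sub (hJk.intervalIntegrable _ _) (hJc.intervalIntegrable _ _)]
    refine intervalIntegral.integral_mono_on hT.le
      (((hWk.sub hw.cont).inner hZ).intervalIntegrable _ _)
      ((hJk.sub hJc).intervalIntegrable _ _) fun s _ => ?_
    have := h.integral_sub_le (W s) (W (s - k))
    rw [← neg_sub (W s), inner_neg_left]
    simp only [hJ, hZd]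
    linarith
  -- The shifted integrals overlap except at the two ends, and on `[-k, 0]` the clamped curve makes
  -- `J` equal to `J 0`.
  have hshift : (∫ s in (0 : ℝ)..T, J (s - k)) - ∫ s in (0 : ℝ)..T, J s
      = k * J 0 - ∫ s in (T - k)..T, J s := by
    have s1 : ∫ s in (0 : ℝ)..T, J (s - k) = ∫ s in (-k)..(T - k), J s := by
      simp
    have s2 : ∫ s in (-k)..0, J s = k * J 0 := by
      rw [intervalIntegral.integral_congr (g := fun _ => J 0)]
      · simp
      · intro s hs
        rw [uIcc_of_le (by linarith)] at hs
        simp only [hJ]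
        rw [hw.clamp s, max_eq_left ((min_le_left _ _).trans hs.2)]
    have a1 := intervalIntegral.integral_add_adjacent_intervals
      (hJc.intervalIntegrable (μ := volume) (-k) 0) (hJc.intervalIntegrable 0 (T - k))
    have a2 := intervalIntegral.integral_add_adjacent_intervals
      (hJc.intervalIntegrable (μ := volume) 0 (T - k)) (hJc.intervalIntegrable (T - k) T)
    linarith
  have hJT : k * (J T - ε / 3) ≤ ∫ s in (T - k)..T, J s := by
    have : ∫ s in (T - k)..T, (J T - ε / 3) ≤ ∫ s in (T - k)..T, J s := by
      refine intervalIntegral.integral_mono_on (by linarith) (by simp)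
        (hJc.intervalIntegrable _ _) fun s hs => ?_
      have hd : dist s T < h3 := by
        rw [Real.dist_eq, abs_lt]
        constructor <;> linarith [hs.1, hs.2]
      have := (abs_lt.1 (H3 s hd)).1
      linarith
    rwa [intervalIntegral.integral_const, sub_sub_cancel, smul_eq_mul] at this
  have hfin : k⁻¹ * ∫ s in (0 : ℝ)..T, inner ℝ (W (s - k) - W s) (Z s)
      ≤ J 0 - (J T - ε / 3) := by
    rw [inv_mul_le_iff₀ hk0]
    linarith
  linarith

end EnergyInequality

open scoped Pointwise

/-! ### Density of test functions on the whole space -/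

section Density

lemma tendsto_eLpNorm_smul_zero {α : Type*} [MeasurableSpace α] {μ : Measure α} {F : Type*}
    [NormedAddCommGroup F] [NormedSpace ℝ F] {f : α → F} (hf : MemLp f 2 μ) {d : ℕ → α → ℝ} {K : ℝ}
    (hm : ∀ n, AEStronglyMeasurable (d n) μ) (hK : ∀ n x, |d n x| ≤ K)
    (hd : ∀ᵐ x ∂μ, Tendsto (fun n => d n x) atTop (𝓝 0)) :
    Tendsto (fun n => eLpNorm (fun x => d n x • f x) 2 μ) atTop (𝓝 0) := by
  have h : Tendsto (fun n => ∫⁻ x, ‖d n x • f x‖ₑ ^ 2 ∂μ) atTop (𝓝 (∫⁻ _, 0 ∂μ)) := by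
    refine tendsto_lintegral_of_dominated_convergence' (fun x => (ENNReal.ofReal K * ‖f x‖ₑ) ^ 2)
      (fun n => ((hm n).smul hf.1).enorm.pow_const 2) (fun n => ae_of_all _ fun x => ?_) ?_ ?_
    · have h1 : ‖d n x • f x‖ₑ ≤ ENNReal.ofReal K * ‖f x‖ₑ := by
        rw [enorm_smul, Real.enorm_eq_ofReal_abs]
        exact mul_le_mul_left (ENNReal.ofReal_le_ofReal (hK n x)) _
      exact pow_le_pow_left' h1 2
    · simp_rw [mul_pow]
      rw [lintegral_const_mul' _ _ (by finiteness), ← eLpNorm_two_sq]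
      have := hf.2.ne
      finiteness
    · filter_upwards [hd] with x hx
      have h1 : Tendsto (fun n => ‖d n x • f x‖ₑ) atTop (𝓝 0) := by
        have := (hx.smul_const (f x)).enorm
        simpa using this
      simpa using ENNReal.Tendsto.pow (n := 2) h1
  simp only [lintegral_zero] at h
  have h2 := (ENNReal.continuous_rpow_const (y := (1 / 2 : ℝ))).tendsto 0 |>.comp h
  rw [ENNReal.zero_rpow_of_pos (by norm_num)] at h2
  refine h2.congr fun n => ?_
  rw [Function.comp_apply, ← eLpNorm_two_sq, ← ENNReal.rpow_natCast, ← ENNReal.rpow_mul]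
  norm_num

lemma IsWeakGrad.congr {Q : Set (E × ℝ)} {u u' : E × ℝ → ℝ} {g g' : E × ℝ → E}
    (h : IsWeakGrad Q u g) (hu : u =ᵐ[volume.restrict Q] u') (hg : g =ᵐ[volume.restrict Q] g') :
    IsWeakGrad Q u' g' := by
  refine ⟨h.1.ae_eq hu, h.2.1.ae_eq hg, fun φ hφ => ?_⟩
  have e1 : ∫ p in Q, u p • gradx φ p = ∫ p in Q, u' p • gradx φ p :=
    integral_congr_ae (by filter_upwards [hu] with p hp; rw [hp])
  have e2 : ∫ p in Q, φ p • g p = ∫ p in Q, φ p • g' p :=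
    integral_congr_ae (by filter_upwards [hg] with p hp; rw [hp])
  rw [← e1, ← e2, h.2.2 φ hφ]

/-- A mollifier of radius `δ`. -/
def mollifier (δ : ℝ) (hδ : 0 < δ) : ContDiffBump (0 : E × ℝ) :=
  ⟨δ / 2, δ, by positivity, by linarith⟩

/-- The probability measure whose density is the mollifier. -/
def mollMeasure (δ : ℝ) (hδ : 0 < δ) : Measure (E × ℝ) :=
  volume.withDensity fun q => ENNReal.ofReal ((mollifier δ hδ).normed volume q)

variable {δ : ℝ} (hδ : 0 < δ)

lemma measurable_mollifier :
    Measurable fun q => ENNReal.ofReal ((mollifier δ hδ).normed volume q) :=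
  (mollifier δ hδ).continuous_normed.measurable.ennreal_ofReal

instance : IsProbabilityMeasure (mollMeasure δ hδ) := by
  refine ⟨?_⟩
  rw [mollMeasure, withDensity_apply _ MeasurableSet.univ, Measure.restrict_univ,
    ← ofReal_integral_eq_lintegral_ofReal (mollifier δ hδ).integrable_normed
      (ae_of_all _ fun q => (mollifier δ hδ).nonneg_normed q), (mollifier δ hδ).integral_normed]
  simp

lemma ae_mollMeasure_mem : ∀ᵐ q ∂mollMeasure δ hδ, q ∈ Metric.closedBall (0 : E × ℝ) δ := by
  rw [mollMeasure, ae_withDensity_iff (measurable_mollifier hδ)]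
  refine ae_of_all _ fun q hq => ?_
  have : q ∈ Function.support ((mollifier δ hδ).normed volume) := by
    intro h0
    simp [h0] at hq
  rw [ContDiffBump.support_normed_eq] at this
  exact Metric.ball_subset_closedBall this

lemma avg_mollMeasure {F : Type*} [NormedAddCommGroup F] [NormedSpace ℝ F] (X : E × ℝ → F)
    (p : E × ℝ) : avg (mollMeasure δ hδ) X p
      = ∫ q, (mollifier δ hδ).normed volume (p - q) • X q := by
  have h : avg (mollMeasure δ hδ) X p
      = ∫ q, (mollifier δ hδ).normed volume q • X (p - q) := by
    rw [avg, mollMeasure, integral_withDensity_eq_integral_toReal_smul (measurable_mollifier hδ)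
      (ae_of_all _ fun q => ENNReal.ofReal_lt_top)]
    refine integral_congr_ae (ae_of_all _ fun q => ?_)
    simp only [ENNReal.toReal_ofReal ((mollifier δ hδ).nonneg_normed q)]
  rw [h, ← integral_sub_left_eq_self _ volume p]
  simp

lemma contDiff_avg_mollMeasure {X : E × ℝ → ℝ} (hX : LocallyIntegrable X) :
    ContDiff ℝ ∞ (avg (mollMeasure δ hδ) X) := by
  have h : avg (mollMeasure δ hδ) X = convolution ((mollifier δ hδ).normed volume) X
      (ContinuousLinearMap.lsmul ℝ ℝ) volume := by
    funext p
    rw [avg, mollMeasure, integral_withDensity_eq_integral_toReal_smul (measurable_mollifier hδ)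
      (ae_of_all _ fun q => ENNReal.ofReal_lt_top), convolution_def]
    refine integral_congr_ae (ae_of_all _ fun q => ?_)
    simp only [ENNReal.toReal_ofReal ((mollifier δ hδ).nonneg_normed q)]
    rfl
  rw [h]
  exact (mollifier δ hδ).hasCompactSupport_normed.contDiff_convolution_left _
    (mollifier δ hδ).contDiff_normed hX

/-- The derivative falls on the kernel, and `q ↦ η(p - q)` is itself an admissible test function.
Its gradient in `q` is minus that of `η`, which compensates the sign in the weak definition. -/
lemma gradx_avg_mollMeasure {X : E × ℝ → ℝ} {Y : E × ℝ → E} (hX : MemLp X 2 volume)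
    (hXY : ∀ φ : E × ℝ → ℝ, ContDiff ℝ ∞ φ → HasCompactSupport φ →
      ∫ p, X p • gradx φ p = -∫ p, φ p • Y p) (p : E × ℝ) :
    gradx (avg (mollMeasure δ hδ) X) p = avg (mollMeasure δ hδ) Y p := by
  set η := (mollifier δ hδ).normed volume with hη
  have hηs : ContDiff ℝ ∞ η := (mollifier δ hδ).contDiff_normed
  have hηc : HasCompactSupport η := (mollifier δ hδ).hasCompactSupport_normed
  have hXl : LocallyIntegrable X := hX.locallyIntegrable (by norm_num)
  set φ : E × ℝ → ℝ := fun q => η (p - q) with hφ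
  have hφs : ContDiff ℝ ∞ φ := hηs.comp (contDiff_const.sub contDiff_id)
  have hφc : HasCompactSupport φ := hηc.comp_homeomorph (Homeomorph.subLeft p)
  have hgφ : ∀ q, gradx φ q = -gradx η (p - q) := by
    intro q
    refine ext_inner_right ℝ fun v => ?_
    rw [inner_gradx hφs, inner_neg_left, inner_gradx hηs]
    have h1 := ((hηs.differentiable (by simp)) (p - q)).hasFDerivAt.comp q
      ((hasFDerivAt_id q).const_sub p)
    have h2 : fderiv ℝ φ q = _ := h1.fderiv
    rw [h2]
    simp
  have hfd : ∀ v : E × ℝ, fderiv ℝ (avg (mollMeasure δ hδ) X) p v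
      = ∫ q, X q * fderiv ℝ η (p - q) v := by
    intro v
    have h : avg (mollMeasure δ hδ) X = convolution η X (ContinuousLinearMap.lsmul ℝ ℝ) volume := by
      funext p
      rw [avg_mollMeasure, convolution_eq_swap]
      rfl
    have h1 : ContDiff ℝ 1 η := hηs.of_le (by simp)
    have hint : ConvolutionExistsAt (fderiv ℝ η) X p
        ((ContinuousLinearMap.lsmul ℝ ℝ).precompL (E × ℝ)) volume :=
      (hηc.fderiv ℝ).convolutionExists_left _ (h1.continuous_fderiv (by simp)) hXl p
    rw [h, (hηc.hasFDerivAt_convolution_left (ContinuousLinearMap.lsmul ℝ ℝ) h1 hXl p).fderiv,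
      convolution_def, ContinuousLinearMap.integral_apply hint,
      ← integral_sub_left_eq_self _ volume p]
    refine integral_congr_ae (ae_of_all _ fun q => ?_)
    simp [mul_comm, ContinuousLinearMap.precompL_apply]
  have key := hXY φ hφs hφc
  have hgc : HasCompactSupport (gradx φ) :=
    hφc.of_isClosed_subset (isClosed_tsupport _) (tsupport_gradx_subset hφs)
  have hi : Integrable fun q => X q • gradx φ q := integrable_smul_of_memLp hX
    ((contDiff_gradx hφs).continuous.memLp_of_hasCompactSupport hgc)
  rw [avg_mollMeasure]
  refine ext_inner_left ℝ fun v => ?_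
  rw [real_inner_comm, inner_gradx (contDiff_avg_mollMeasure hδ hXl), hfd]
  have e : ∫ q, φ q • Y q = -∫ q, X q • gradx φ q := by rw [key, neg_neg]
  change _ = inner ℝ v (∫ q, φ q • Y q)
  rw [e, inner_neg_right, ← integral_inner hi, ← integral_neg]
  refine integral_congr_ae (ae_of_all _ fun q => ?_)
  simp only [inner_smul_right, hgφ, inner_neg_right]
  rw [real_inner_comm, inner_gradx hηs]
  ring

/-- The extension of `χ u` by zero is mollified. Since `χ` has compact support in `Q`, the
distributional gradient of this extension is `χ g + u ∇χ` extended by zero, with no boundary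
contribution; a small enough radius keeps the mollification supported in `Q`. -/
lemma exists_test_near {Q : Set (E × ℝ)} (hQ : IsOpen Q) {u : E × ℝ → ℝ} {g : E × ℝ → E}
    (hum : StronglyMeasurable u) (hgm : StronglyMeasurable g) (h : IsWeakGrad Q u g)
    {χ : E × ℝ → ℝ} (hχ : IsTest Q χ) {ε : ENNReal} (hε : ε ≠ 0) :
    ∃ ψ, IsTest Q ψ ∧ eLpNorm (fun p => ψ p - χ p * u p) 2 (volume.restrict Q) ≤ ε ∧
      eLpNorm (fun p => gradx ψ p - (χ p • g p + u p • gradx χ p)) 2 (volume.restrict Q) ≤ ε := by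
  have hχg := contDiff_gradx hχ.1
  obtain ⟨C, hC⟩ := hχ.1.continuous.bounded_above_of_compact_support hχ.2.1
  obtain ⟨C', hC'⟩ := hχg.continuous.bounded_above_of_compact_support hχ.hasCompactSupport_gradx
  set X : E × ℝ → ℝ := Q.indicator fun p => χ p * u p with hX
  set Y : E × ℝ → E := Q.indicator fun p => χ p • g p + u p • gradx χ p with hY
  have m1 : MemLp (fun p => χ p * u p) 2 (volume.restrict Q) :=
    h.1.of_le_mul (c := C) (hχ.1.continuous.aestronglyMeasurable.mul h.1.1)
      (ae_of_all _ fun p => by rw [norm_mul]; gcongr; exact hC p)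
  have m2 : MemLp (fun p => χ p • g p) 2 (volume.restrict Q) :=
    h.2.1.of_le_mul (c := C) (hχ.1.continuous.aestronglyMeasurable.smul h.2.1.1)
      (ae_of_all _ fun p => by rw [norm_smul]; gcongr; exact hC p)
  have m3 : MemLp (fun p => u p • gradx χ p) 2 (volume.restrict Q) :=
    h.1.of_le_mul (c := C') (h.1.1.smul hχg.continuous.aestronglyMeasurable)
      (ae_of_all _ fun p => by rw [norm_smul, mul_comm]; gcongr; exact hC' p)
  have hX2 : MemLp X 2 volume := (memLp_indicator_iff_restrict hQ.measurableSet).2 m1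
  have hY2 : MemLp Y 2 volume := (memLp_indicator_iff_restrict hQ.measurableSet).2 (m2.add m3)
  have hXm : StronglyMeasurable X :=
    (hχ.1.continuous.stronglyMeasurable.mul hum).indicator hQ.measurableSet
  have hYm : StronglyMeasurable Y := ((hχ.1.continuous.stronglyMeasurable.smul hgm).add
    (hum.smul hχg.continuous.stronglyMeasurable)).indicator hQ.measurableSet
  have hXY : ∀ φ : E × ℝ → ℝ, ContDiff ℝ ∞ φ → HasCompactSupport φ →
      ∫ p, X p • gradx φ p = -∫ p, φ p • Y p := by
    intro φ hφ hc
    have hT : IsTest Q fun p => φ p * χ p := hχ.mul_left hφ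
    have e1 : ∫ p, X p • gradx φ p = ∫ p in Q, (χ p * u p) • gradx φ p := by
      rw [← integral_indicator hQ.measurableSet]
      refine integral_congr_ae (ae_of_all _ fun p => ?_)
      by_cases hp : p ∈ Q <;> simp [hX, hp]
    have e2 : ∫ p, φ p • Y p = ∫ p in Q, φ p • (χ p • g p + u p • gradx χ p) := by
      rw [← integral_indicator hQ.measurableSet]
      refine integral_congr_ae (ae_of_all _ fun p => ?_)
      by_cases hp : p ∈ Q <;> simp [hY, hp]
    have hφ2 : MemLp φ 2 (volume.restrict Q) :=
      (hφ.continuous.memLp_of_hasCompactSupport hc).restrict Q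
    have hgφ2 : MemLp (gradx φ) 2 (volume.restrict Q) :=
      ((contDiff_gradx hφ).continuous.memLp_of_hasCompactSupport
        (hc.of_isClosed_subset (isClosed_tsupport _) (tsupport_gradx_subset hφ))).restrict Q
    have key := h.2.2 _ hT
    simp_rw [gradx_mul hφ hχ.1] at key
    have j1 := integrable_smul_of_memLp m1 hgφ2
    have j2 := integrable_smul_of_memLp hφ2 m2
    have j3 := integrable_smul_of_memLp hφ2 m3
    rw [e1, e2]
    simp_rw [smul_add]
    rw [integral_add j2 j3]
    have k1 : ∫ p in Q, u p • (φ p • gradx χ p + χ p • gradx φ p)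
        = (∫ p in Q, φ p • u p • gradx χ p) + ∫ p in Q, (χ p * u p) • gradx φ p := by
      rw [← integral_add j3 j1]
      refine integral_congr_ae (ae_of_all _ fun p => ?_)
      simp only [smul_add, smul_smul]
      rw [mul_comm (u p), mul_comm (u p)]
    have k2 : ∫ p in Q, (φ p * χ p) • g p = ∫ p in Q, φ p • χ p • g p := by
      simp_rw [smul_smul]
    rw [k1, k2] at key
    rw [neg_add, ← key]
    abel
  have hXsub : tsupport X ⊆ tsupport χ := by
    refine closure_minimal (fun p hp => ?_) (isClosed_tsupport χ)
    by_contra hn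
    refine hp ?_
    have h0 := image_eq_zero_of_notMem_tsupport hn
    by_cases hpQ : p ∈ Q <;> simp [hX, hpQ, h0]
  have hXc : HasCompactSupport X := hχ.2.1.of_isClosed_subset (isClosed_tsupport _) hXsub
  obtain ⟨δ₁, hδ₁, H1⟩ := exists_translate_le hX2 hε
  obtain ⟨δ₂, hδ₂, H2⟩ := exists_translate_le hY2 hε
  obtain ⟨δ₃, hδ₃, H3⟩ := hχ.2.1.isCompact.exists_cthickening_subset_open hQ hχ.2.2
  obtain ⟨δ, hδ, hd1, hd2, hd3⟩ : ∃ δ, 0 < δ ∧ δ < δ₁ ∧ δ < δ₂ ∧ δ ≤ δ₃ := by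
    refine ⟨min (min (δ₁ / 2) (δ₂ / 2)) δ₃, by positivity, ?_, ?_, min_le_right _ _⟩
    · exact ((min_le_left _ _).trans (min_le_left _ _)).trans_lt (by linarith)
    · exact ((min_le_left _ _).trans (min_le_right _ _)).trans_lt (by linarith)
  have hs := tsupport_avg_subset hXc (isCompact_closedBall (0 : E × ℝ) δ) (ae_mollMeasure_mem hδ)
  have hnear : ∀ {H : Type} [NormedAddCommGroup H] [InnerProductSpace ℝ H] [CompleteSpace H]
      {Z Z' : E × ℝ → H}, StronglyMeasurable Z → MemLp Z 2 volume → (∀ p ∈ Q, Z p = Z' p) →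
      ∀ δ', δ < δ' → (∀ q : E × ℝ, ‖q‖ < δ' →
        eLpNorm (fun p => Z (p - q) - Z p) 2 volume ≤ ε) →
      eLpNorm (fun p => avg (mollMeasure δ hδ) Z p - Z' p) 2 (volume.restrict Q) ≤ ε := by
    intro H _ _ _ Z Z' hZm hZ2 hZZ' δ' hδ' hle
    have : eLpNorm (fun p => avg (mollMeasure δ hδ) Z p - Z p) 2 volume ≤ ε := by
      refine eLpNorm_avg_sub_le hZm hZ2 ?_
      filter_upwards [ae_mollMeasure_mem hδ] with q hq
      refine hle q (lt_of_le_of_lt ?_ hδ')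
      simpa using hq
    refine le_trans (le_of_eq (eLpNorm_congr_ae ?_))
      ((eLpNorm_mono_measure _ Measure.restrict_le_self).trans this)
    rw [Filter.EventuallyEq, ae_restrict_iff' hQ.measurableSet]
    exact ae_of_all _ fun p hp => by rw [hZZ' p hp]
  refine ⟨avg (mollMeasure δ hδ) X, ⟨contDiff_avg_mollMeasure hδ
    (hX2.locallyIntegrable (by norm_num)), ?_, ?_⟩, ?_, ?_⟩
  · exact (hXc.isCompact.add (isCompact_closedBall (0 : E × ℝ) δ)).of_isClosed_subset
      (isClosed_tsupport _) hs
  · refine hs.trans ((add_subset_add_right hXsub).trans ?_)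
    refine subset_trans ?_ ((Metric.cthickening_mono hd3 _).trans H3)
    rintro _ ⟨x, hx, z, hz, rfl⟩
    refine Metric.mem_cthickening_of_dist_le _ x _ _ hx ?_
    simpa [dist_eq_norm] using hz
  · exact hnear hXm hX2 (fun p hp => by simp [hX, hp]) δ₁ hd1 H1
  · simp_rw [gradx_avg_mollMeasure hδ hX2 hXY]
    exact hnear hYm hY2 (fun p hp => by simp [hY, hp]) δ₂ hd2 H2

/-- A bump in space, equal to `1` on the unit ball. -/
def spaceBump : ContDiffBump (0 : E) := ⟨1, 2, one_pos, one_lt_two⟩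

/-- Cutoffs of `ℝ³ × (0, S)`. -/
def cutoff (S : ℝ) (hS : 0 < S) (n : ℕ) (p : E × ℝ) : ℝ :=
  timeCutoff S (cutScale S n) (cutScale_pos hS n) p.2 * spaceBump (((n : ℝ) + 1)⁻¹ • p.1)

variable {S : ℝ} (hS : 0 < S)

lemma isTest_cutoff (n : ℕ) : IsTest (cyl univ S) (cutoff S hS n) := by
  have hn : (0 : ℝ) < (n : ℝ) + 1 := by positivity
  have hsm : ContDiff ℝ ∞ fun p : E × ℝ => spaceBump (((n : ℝ) + 1)⁻¹ • p.1) :=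
    spaceBump.contDiff.comp (contDiff_fst.const_smul _)
  have hp := cutScale_pos hS n
  have hK : IsCompact (Metric.closedBall (0 : E) (2 * (n + 1)) ×ˢ
      Icc (cutScale S n) (S - cutScale S n)) := (isCompact_closedBall _ _).prod isCompact_Icc
  have hsub : tsupport (cutoff S hS n) ⊆ Metric.closedBall (0 : E) (2 * (n + 1)) ×ˢ
      Icc (cutScale S n) (S - cutScale S n) := by
    refine closure_minimal (fun p hne => ?_) hK.isClosed
    have h1 := left_ne_zero_of_mul hne
    have h2 := right_ne_zero_of_mul hne
    constructor
    · have : ((n : ℝ) + 1)⁻¹ • p.1 ∈ Function.support spaceBump := h2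
      rw [spaceBump.support_eq, mem_ball_zero_iff, norm_smul, norm_inv,
        Real.norm_of_nonneg hn.le, inv_mul_lt_iff₀ hn] at this
      have hr : spaceBump.rOut = 2 := rfl
      rw [hr] at this
      rw [mem_closedBall_zero_iff]
      linarith
    · by_contra hc
      exact h1 (timeCutoff_eq_zero _ (six_mul_cutScale_le hS n) hc)
  refine ⟨(contDiff_comp_snd (contDiff_timeCutoff _)).mul hsm,
    hK.of_isClosed_subset (isClosed_tsupport _) hsub, hsub.trans fun p hp' => ⟨mem_univ _, ?_⟩⟩
  exact ⟨hp.trans_le hp'.2.1, hp'.2.2.trans_lt (by linarith)⟩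

lemma abs_cutoff_le (n : ℕ) (p : E × ℝ) : |cutoff S hS n p| ≤ 2 := by
  rw [cutoff, abs_mul, abs_of_nonneg spaceBump.nonneg]
  calc _ ≤ 2 * 1 := mul_le_mul (abs_timeCutoff_le _ _) spaceBump.le_one spaceBump.nonneg
        zero_le_two
    _ = 2 := by norm_num

lemma tendsto_cutoff {p : E × ℝ} (hp : p ∈ cyl univ S) :
    Tendsto (fun n => cutoff S hS n p) atTop (𝓝 1) := by
  have h1 := tendsto_timeCutoff hS hp.2
  have h2 : Tendsto (fun n : ℕ => spaceBump (((n : ℝ) + 1)⁻¹ • p.1)) atTop (𝓝 1) := by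
    have h3 : Tendsto (fun n : ℕ => ((n : ℝ) + 1)⁻¹ • p.1) atTop (𝓝 0) := by
      have := (tendsto_one_div_add_atTop_nhds_zero_nat (𝕜 := ℝ)).smul_const p.1
      simpa using this
    have h4 := (spaceBump.continuous.tendsto (0 : E)).comp h3
    have h5 : spaceBump (0 : E) = 1 :=
      spaceBump.one_of_mem_closedBall (Metric.mem_closedBall_self zero_le_one)
    rwa [h5] at h4
  simpa [cutoff] using h1.mul h2

/-- Only the spatial factor is differentiated. The steepening of the cutoff in time is thus
harmless, and the spatial scale `n + 1` makes the gradient tend to zero. -/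
lemma exists_norm_gradx_cutoff_le :
    ∃ C, ∀ n p, ‖gradx (cutoff S hS n) p‖ ≤ C * ((n : ℝ) + 1)⁻¹ := by
  have hd : ContDiff ℝ ∞ (spaceBump : E → ℝ) := spaceBump.contDiff
  obtain ⟨C, hC⟩ := (hd.continuous_fderiv (by simp)).bounded_above_of_compact_support
    (spaceBump.hasCompactSupport.fderiv ℝ)
  refine ⟨2 * C, fun n p => ?_⟩
  have hn : (0 : ℝ) < (n : ℝ) + 1 := by positivity
  have hsm : ContDiff ℝ ∞ fun p : E × ℝ => spaceBump (((n : ℝ) + 1)⁻¹ • p.1) :=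
    hd.comp (contDiff_fst.const_smul _)
  have e : gradx (cutoff S hS n) p = timeCutoff S (cutScale S n) (cutScale_pos hS n) p.2 •
      gradx (fun p : E × ℝ => spaceBump (((n : ℝ) + 1)⁻¹ • p.1)) p :=
    gradx_timeMul (contDiff_timeCutoff _) hsm p
  have h1 : ‖gradx (fun p : E × ℝ => spaceBump (((n : ℝ) + 1)⁻¹ • p.1)) p‖
      ≤ C * ((n : ℝ) + 1)⁻¹ := by
    have h0 : HasFDerivAt (fun x : E => ((n : ℝ) + 1)⁻¹ • x)
        (((n : ℝ) + 1)⁻¹ • ContinuousLinearMap.id ℝ E) p.1 :=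
      (((n : ℝ) + 1)⁻¹ • ContinuousLinearMap.id ℝ E).hasFDerivAt
    have hder : HasFDerivAt (fun x : E => spaceBump (((n : ℝ) + 1)⁻¹ • x))
        ((fderiv ℝ spaceBump (((n : ℝ) + 1)⁻¹ • p.1)).comp
          (((n : ℝ) + 1)⁻¹ • ContinuousLinearMap.id ℝ E)) p.1 :=
      ((hd.differentiable (by simp)) _).hasFDerivAt.comp p.1 h0
    rw [gradx, gradient, LinearIsometryEquiv.norm_map, hder.fderiv]
    refine (ContinuousLinearMap.opNorm_comp_le _ _).trans ?_
    refine mul_le_mul (hC _) ?_ (norm_nonneg _) ((norm_nonneg _).trans (hC 0))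
    rw [norm_smul, norm_inv, Real.norm_of_nonneg hn.le]
    exact mul_le_of_le_one_right (by positivity) ContinuousLinearMap.norm_id_le
  rw [e, norm_smul, mul_assoc]
  exact mul_le_mul (abs_timeCutoff_le _ _) h1 (norm_nonneg _) zero_le_two

/-- Test functions are dense in `L²(0, S; H¹(ℝ³))`. -/
theorem IsWeakGrad.exists_tests (hS : 0 < S) {u : E × ℝ → ℝ} {g : E × ℝ → E}
    (h : IsWeakGrad (cyl univ S) u g) :
    ∃ φ : ℕ → E × ℝ → ℝ, (∀ n, IsTest (cyl univ S) (φ n)) ∧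
      Tendsto (fun n => eLpNorm (fun p => φ n p - u p) 2 (volume.restrict (cyl univ S)))
        atTop (𝓝 0) ∧
      Tendsto (fun n => eLpNorm (fun p => gradx (φ n) p - g p) 2
        (volume.restrict (cyl univ S))) atTop (𝓝 0) := by
  wlog hm : StronglyMeasurable u ∧ StronglyMeasurable g generalizing u g
  · obtain ⟨u', hu', huu'⟩ := h.1.1
    obtain ⟨g', hg', hgg'⟩ := h.2.1.1
    obtain ⟨φ, h1, h2, h3⟩ := this (h.congr huu' hgg') ⟨hu', hg'⟩
    refine ⟨φ, h1, h2.congr fun n => eLpNorm_congr_ae ?_, h3.congr fun n => eLpNorm_congr_ae ?_⟩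
    · filter_upwards [huu'] with p hp; rw [hp]
    · filter_upwards [hgg'] with p hp; rw [hp]
  obtain ⟨hum, hgm⟩ := hm
  have hQ := isOpen_cyl isOpen_univ S
  have hpos : ∀ n : ℕ, ((n : ENNReal) + 1)⁻¹ ≠ 0 := fun n => by simp
  choose φ hφ hφu hφg using fun n : ℕ =>
    exists_test_near hQ hum hgm h (isTest_cutoff hS n) (hpos n)
  have hinv : Tendsto (fun n : ℕ => ((n : ENNReal) + 1)⁻¹) atTop (𝓝 0) := by
    have := (tendsto_add_atTop_iff_nat 1).2 ENNReal.tendsto_inv_nat_nhds_zero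
    simpa using this
  have hlim1 : ∀ {F : Type} [NormedAddCommGroup F] [NormedSpace ℝ F] {f : E × ℝ → F},
      MemLp f 2 (volume.restrict (cyl univ S)) →
      Tendsto (fun n => eLpNorm (fun p => (cutoff S hS n p - 1) • f p) 2
        (volume.restrict (cyl univ S))) atTop (𝓝 0) := by
    intro F _ _ f hf
    refine tendsto_eLpNorm_smul_zero (K := 3) hf
      (fun n => ((isTest_cutoff hS n).1.continuous.sub continuous_const).aestronglyMeasurable)
      (fun n p => ?_) ?_
    · refine (abs_sub _ _).trans ?_
      have := abs_cutoff_le hS n p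
      rw [abs_one]
      linarith
    · rw [ae_restrict_iff' hQ.measurableSet]
      refine ae_of_all _ fun p hp => ?_
      simpa using (tendsto_cutoff hS hp).sub_const 1
  obtain ⟨C, hC⟩ := exists_norm_gradx_cutoff_le hS
  have hlim2 : Tendsto (fun n => eLpNorm (fun p => u p • gradx (cutoff S hS n) p) 2
      (volume.restrict (cyl univ S))) atTop (𝓝 0) := by
    have hb : Tendsto (fun n : ℕ => ENNReal.ofReal (C * ((n : ℝ) + 1)⁻¹)
        * eLpNorm u 2 (volume.restrict (cyl univ S))) atTop (𝓝 0) := by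
      have h1 : Tendsto (fun n : ℕ => C * ((n : ℝ) + 1)⁻¹) atTop (𝓝 0) := by
        simpa using (tendsto_one_div_add_atTop_nhds_zero_nat (𝕜 := ℝ)).const_mul C
      have h2 := ENNReal.tendsto_ofReal h1
      rw [ENNReal.ofReal_zero] at h2
      simpa using ENNReal.Tendsto.mul_const h2 (Or.inr h.1.2.ne)
    refine tendsto_of_tendsto_of_tendsto_of_le_of_le tendsto_const_nhds hb
      (fun _ => zero_le) fun n => ?_
    refine eLpNorm_le_mul_eLpNorm_of_ae_le_mul (ae_of_all _ fun p => ?_) 2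
    rw [norm_smul, mul_comm]
    exact mul_le_mul_of_nonneg_right (hC n p) (norm_nonneg _)
  refine ⟨φ, hφ, ?_, ?_⟩
  · have hs := hinv.add (hlim1 h.1)
    rw [add_zero] at hs
    refine tendsto_of_tendsto_of_tendsto_of_le_of_le tendsto_const_nhds hs
      (fun _ => zero_le) fun n => ?_
    have hc := (isTest_cutoff hS n).1.continuous
    have := eLpNorm_add_le (μ := volume.restrict (cyl univ S)) (p := 2)
      (f := fun p => φ n p - cutoff S hS n p * u p) (g := fun p => (cutoff S hS n p - 1) • u p)
      ((hφ n).1.continuous.aestronglyMeasurable.sub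
        (hc.aestronglyMeasurable.mul hum.aestronglyMeasurable))
      ((hc.sub continuous_const).aestronglyMeasurable.smul hum.aestronglyMeasurable) (by norm_num)
    refine le_trans (le_of_eq ?_) (this.trans (add_le_add_left (hφu n) _))
    congr 1
    funext p
    simp only [Pi.add_apply, smul_eq_mul]
    ring
  · have hs := (hinv.add hlim2).add (hlim1 h.2.1)
    rw [add_zero, add_zero] at hs
    refine tendsto_of_tendsto_of_tendsto_of_le_of_le tendsto_const_nhds hs
      (fun _ => zero_le) fun n => ?_
    have hc := (isTest_cutoff hS n).1.continuous
    have hcg := (contDiff_gradx (isTest_cutoff hS n).1).continuous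
    have s1 := (contDiff_gradx (hφ n).1).continuous.aestronglyMeasurable
      (μ := volume.restrict (cyl univ S))
    have s2 : AEStronglyMeasurable (fun p => cutoff S hS n p • g p + u p • gradx (cutoff S hS n) p)
      (volume.restrict (cyl univ S)) := (hc.aestronglyMeasurable.smul hgm.aestronglyMeasurable).add
        (hum.aestronglyMeasurable.smul hcg.aestronglyMeasurable)
    have s3 : AEStronglyMeasurable (fun p => u p • gradx (cutoff S hS n) p)
      (volume.restrict (cyl univ S)) := hum.aestronglyMeasurable.smul hcg.aestronglyMeasurable
    have s4 : AEStronglyMeasurable (fun p => (cutoff S hS n p - 1) • g p)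
      (volume.restrict (cyl univ S)) :=
        (hc.sub continuous_const).aestronglyMeasurable.smul hgm.aestronglyMeasurable
    have a1 := eLpNorm_add_le (p := 2) (s1.sub s2) s3 (by norm_num)
    have a2 := eLpNorm_add_le (p := 2) ((s1.sub s2).add s3) s4 (by norm_num)
    refine le_trans (le_of_eq ?_) (a2.trans (add_le_add_left
      (a1.trans (add_le_add_left (hφg n) _)) _))
    congr 1
    funext p
    simp only [Pi.add_apply, Pi.sub_apply, sub_smul, one_smul]
    abel

end Density

/-! ### The semigroup of the fundamental solution -/

/-- The chain rule in terms of approximating test functions: the gradients of `ψ(φ n)` carry the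
factor `ψ'(φ n)`, which converges only almost everywhere along a subsequence. Being bounded by `1`,
it is handled by dominated convergence. The condition `ψ 0 = 0` preserves compact supports. -/
lemma IsWeakGrad.exists_tests_comp {S : ℝ} (hS : 0 < S) {u : E × ℝ → ℝ} {g : E × ℝ → E}
    (h : IsWeakGrad (cyl univ S) u g) {ψ : ℝ → ℝ} (hψ : ContDiff ℝ ∞ ψ) (h0 : ψ 0 = 0)
    (h1 : ∀ r, |deriv ψ r| ≤ 1) :
    MemLp (fun p => deriv ψ (u p) • g p) 2 (volume.restrict (cyl univ S)) ∧
    ∃ φ : ℕ → E × ℝ → ℝ, (∀ n, IsTest (cyl univ S) (φ n)) ∧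
      Tendsto (fun n => eLpNorm (fun p => φ n p - ψ (u p)) 2 (volume.restrict (cyl univ S)))
        atTop (𝓝 0) ∧
      Tendsto (fun n => eLpNorm (fun p => gradx (φ n) p - deriv ψ (u p) • g p) 2
        (volume.restrict (cyl univ S))) atTop (𝓝 0) := by
  obtain ⟨φ, hφ, hφu, hφg⟩ := h.exists_tests hS
  set m := (volume : Measure (E × ℝ)).restrict (cyl univ S) with hm
  have hmeas : ∀ n, AEStronglyMeasurable (φ n) m := fun n => (hφ n).1.continuous.aestronglyMeasurable
  obtain ⟨ns, hns, hae⟩ := (tendstoInMeasure_of_tendsto_eLpNorm two_ne_zero hmeas h.1.1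
    hφu).exists_seq_tendsto_ae
  have hdc : Continuous (deriv ψ) := hψ.continuous_deriv (by simp)
  have hdm : AEStronglyMeasurable (fun p => deriv ψ (u p)) m := hdc.comp_aestronglyMeasurable h.1.1
  have hL : LipschitzWith 1 ψ := by
    refine lipschitzWith_of_nnnorm_deriv_le (hψ.differentiable (by simp)) fun r => ?_
    rw [← NNReal.coe_le_coe]
    simpa using h1 r
  refine ⟨h.2.1.of_le (hdm.smul h.2.1.1) (ae_of_all _ fun p => ?_),
    fun n p => ψ (φ (ns n) p), fun n => (hφ _).comp_left hψ h0, ?_, ?_⟩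
  · rw [norm_smul]
    exact mul_le_of_le_one_left (norm_nonneg _) (h1 _)
  · refine tendsto_of_tendsto_of_tendsto_of_le_of_le tendsto_const_nhds
      (hφu.comp hns.tendsto_atTop) (fun _ => zero_le) fun n => ?_
    refine eLpNorm_mono fun p => ?_
    simpa [dist_eq_norm] using hL.dist_le_mul (φ (ns n) p) (u p)
  · have t1 := hφg.comp hns.tendsto_atTop
    have t2 : Tendsto (fun n => eLpNorm (fun p => (deriv ψ (φ (ns n) p) - deriv ψ (u p)) • g p) 2 m)
        atTop (𝓝 0) := by
      refine tendsto_eLpNorm_smul_zero (K := 2) h.2.1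
        (fun n => (hdc.comp_aestronglyMeasurable (hmeas _)).sub hdm) (fun n p => ?_) ?_
      · refine (abs_sub _ _).trans ?_
        linarith [h1 (φ (ns n) p), h1 (u p)]
      · filter_upwards [hae] with p hp
        simpa using ((hdc.tendsto (u p)).comp hp).sub_const (deriv ψ (u p))
    have t3 := t1.add t2
    rw [add_zero] at t3
    refine tendsto_of_tendsto_of_tendsto_of_le_of_le tendsto_const_nhds t3
      (fun _ => zero_le) fun n => ?_
    have hg1 : AEStronglyMeasurable (gradx (φ (ns n))) m :=
      (contDiff_gradx (hφ _).1).continuous.aestronglyMeasurable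
    have hd1 : AEStronglyMeasurable (fun p => deriv ψ (φ (ns n) p)) m :=
      hdc.comp_aestronglyMeasurable (hmeas _)
    have a := eLpNorm_add_le (μ := m) (p := 2)
      (f := fun p => deriv ψ (φ (ns n) p) • (gradx (φ (ns n)) p - g p))
      (g := fun p => (deriv ψ (φ (ns n) p) - deriv ψ (u p)) • g p)
      (hd1.smul (hg1.sub h.2.1.1)) ((hd1.sub hdm).smul h.2.1.1) (by norm_num)
    refine le_trans (le_of_eq ?_) (a.trans (add_le_add_left (eLpNorm_mono fun p => ?_) _))
    · congr 1
      funext p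
      simp only [Pi.add_apply]
      rw [gradx_comp (hφ _).1 hψ, smul_sub, sub_smul]
      abel
    · rw [norm_smul]
      exact mul_le_of_le_one_left (norm_nonneg _) (h1 _)

/-- A smooth nondecreasing function vanishing exactly on `(-∞, k]`, with slope at most `1`. -/
def excess (k r : ℝ) : ℝ := ∫ s in k..r, Real.smoothTransition (s - k)

/-- A primitive of `excess k`. -/
def excessInt (k r : ℝ) : ℝ := ∫ s in k..r, excess k s

section Excess

variable {k : ℝ}

lemma continuous_smoothTransition_sub (k : ℝ) :
    Continuous fun s => Real.smoothTransition (s - k) :=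
  Real.smoothTransition.continuous.comp (continuous_sub_right k)

lemma deriv_excess (k r : ℝ) : deriv (excess k) r = Real.smoothTransition (r - k) :=
  Continuous.deriv_integral _ (continuous_smoothTransition_sub k) k r

lemma contDiff_excess (k : ℝ) : ContDiff ℝ ∞ (excess k) := by
  rw [contDiff_infty_iff_deriv]
  refine ⟨fun r => ((continuous_smoothTransition_sub k).integral_hasStrictDerivAt k r
    ).hasDerivAt.differentiableAt, ?_⟩
  rw [show deriv (excess k) = fun r => Real.smoothTransition (r - k) from funext (deriv_excess k)]
  exact Real.smoothTransition.contDiff.comp (contDiff_id.sub contDiff_const)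

lemma excess_eq_zero {r : ℝ} (hr : r ≤ k) : excess k r = 0 := by
  rw [excess, intervalIntegral.integral_symm, neg_eq_zero]
  refine (intervalIntegral.integral_congr (g := fun _ => 0) fun s hs => ?_).trans (by simp)
  rw [uIcc_of_le hr] at hs
  exact Real.smoothTransition.zero_of_nonpos (by linarith [hs.2])

lemma excess_pos {r : ℝ} (hr : k < r) : 0 < excess k r :=
  intervalIntegral.intervalIntegral_pos_of_pos_on
    ((continuous_smoothTransition_sub k).intervalIntegrable _ _)
    (fun s hs => Real.smoothTransition.pos_of_pos (by linarith [hs.1])) hr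

lemma monotone_excess (k : ℝ) : Monotone (excess k) := by
  refine monotone_of_deriv_nonneg ((contDiff_excess k).differentiable (by simp)) fun r => ?_
  rw [deriv_excess]
  exact Real.smoothTransition.nonneg _

lemma excessInt_eq_zero {r : ℝ} (hr : r ≤ k) : excessInt k r = 0 := by
  rw [excessInt, intervalIntegral.integral_symm, neg_eq_zero]
  refine (intervalIntegral.integral_congr (g := fun _ => 0) fun s hs => ?_).trans (by simp)
  rw [uIcc_of_le hr] at hs
  exact excess_eq_zero hs.2

lemma excessInt_pos {r : ℝ} (hr : k < r) : 0 < excessInt k r :=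
  intervalIntegral.intervalIntegral_pos_of_pos_on
    ((contDiff_excess k).continuous.intervalIntegrable _ _) (fun _ hs => excess_pos hs.1) hr

lemma abs_deriv_excess_le (k r : ℝ) : |deriv (excess k) r| ≤ 1 := by
  rw [deriv_excess, abs_of_nonneg (Real.smoothTransition.nonneg _)]
  exact Real.smoothTransition.le_one _

lemma isConvexPair_excess (hk : 0 ≤ k) : IsConvexPair 1 (excessInt k) (excess k) where
  lipschitz := by
    refine lipschitzWith_of_nnnorm_deriv_le ((contDiff_excess k).differentiable (by simp))
      fun r => ?_
    rw [← NNReal.coe_le_coe]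
    simpa using abs_deriv_excess_le k r
  zero := excessInt_eq_zero hk
  deriv_zero := excess_eq_zero hk
  convex r s := by
    have hi : ∀ a b, IntervalIntegrable (excess k) volume a b := fun a b =>
      (contDiff_excess k).continuous.intervalIntegrable a b
    have e : excessInt k r - excessInt k s = ∫ x in s..r, excess k x :=
      intervalIntegral.integral_interval_sub_left (hi _ _) (hi _ _)
    rw [e]
    rcases le_total s r with h | h
    · have := intervalIntegral.integral_mono_on h (hi s r)
        (intervalIntegrable_const (c := excess k r)) fun x hx => monotone_excess k hx.2
      simpa [mul_comm] using this
    · have := intervalIntegral.integral_mono_on h (intervalIntegrable_const (c := excess k r))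
        (hi r s) fun x hx => monotone_excess k hx.1
      rw [intervalIntegral.integral_symm]
      simp at this
      nlinarith

end Excess

lemma isConvexPair_sq : IsConvexPair 1 (fun r => r ^ 2 / 2) id where
  lipschitz := LipschitzWith.id
  zero := by simp
  deriv_zero := rfl
  convex r s := by
    simp only [id]
    nlinarith [sq_nonneg (r - s)]

/-! ### The energy estimate and contraction properties of the semigroup -/

namespace IsFundamentalSolution

variable {b : E → Mat} {G : E → E → ℝ → ℝ} {γ : ℝ} {f : E → ℝ} {S : ℝ}

lemma exists_isDivSolution (hG : IsFundamentalSolution b G) (hγ : 0 < γ)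
    (hb : ∀ i j, Measurable fun x => b x i j) (hell : ∀ x, IsElliptic γ (b x))
    (hf : MemLp f 2) (hS : 0 < S) :
    ∃ W, IsDivSolution univ S (superpose G f)
      (fun p => app (b p.1) (wgrad (cyl univ S) (superpose G f) p)) (fun _ => 0) W := by
  have he := hG.energy f hf S hS
  obtain ⟨W, h1, h2, h3⟩ := he.exists_curve hS.le
  refine ⟨W, h1, h2, h3, he.1.isWeakGrad.1, ?_, MemLp.zero', fun φ hφ => ?_⟩
  · exact memLp_app hγ (fun i j => ((hb i j).comp measurable_fst).aestronglyMeasurable)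
      (ae_of_all _ fun p => hell p.1) he.1.isWeakGrad.2.1
  · simpa [heatOp] using hG.equation f hf S hS φ hφ

lemma superpose_pos {p : E × ℝ} (hp : 0 < p.2) :
    superpose G f p = ∫ y, G y p.1 p.2 * f y := if_pos hp

lemma superpose_zero (x : E) : superpose G f (x, 0) = f x := if_neg (lt_irrefl _)

/-- On the whole space test functions are dense, so the solution may test its own equation, with
`Φ(r) = r²/2`. Besides contraction in `L²`, this gives a gradient bound uniform in `S`, the sole
source of spatial regularity for the potentials below. -/
lemma energy_le (hG : IsFundamentalSolution b G) (hγ : 0 < γ)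
    (hb : ∀ i j, Measurable fun x => b x i j) (hell : ∀ x, IsElliptic γ (b x))
    (hf : MemLp f 2) (hS : 0 < S) :
    (∫ x, (∫ y, G y x S * f y) ^ 2) + 2 * γ⁻¹ *
      ∫ p in cyl univ S, ‖wgrad (cyl univ S) (superpose G f) p‖ ^ 2 ≤ ∫ x, f x ^ 2 := by
  obtain ⟨W, hW⟩ := hG.exists_isDivSolution hγ hb hell hf hS
  have hw := (hG.energy f hf S hS).1.isWeakGrad
  obtain ⟨φ, h1, h2, h3⟩ := hw.exists_tests hS
  have := hW.energy_le isOpen_univ hS isConvexPair_sq hw.2.1 h1 h2 h3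
  simp only [Measure.restrict_univ, superpose_zero, zero_mul, add_zero] at this
  rw [integral_div, integral_div] at this
  simp only [superpose_pos (p := (_, S)) hS] at this
  have hmono : ∫ p in cyl univ S, γ⁻¹ * ‖wgrad (cyl univ S) (superpose G f) p‖ ^ 2
      ≤ ∫ p in cyl univ S, inner ℝ (app (b p.1) (wgrad (cyl univ S) (superpose G f) p))
        (wgrad (cyl univ S) (superpose G f) p) :=
    integral_mono (hw.2.1.integrable_norm_pow two_ne_zero |>.const_mul _)
      (integrable_inner_of_memLp hW.flux hw.2.1) fun p => ((hell p.1).2 _).1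
  rw [integral_const_mul] at hmono
  linarith

variable (hG : IsFundamentalSolution b G) (hγ : 0 < γ)
  (hb : ∀ i j, Measurable fun x => b x i j) (hell : ∀ x, IsElliptic γ (b x))
  (hf : MemLp f 2) {t : ℝ} (ht : 0 < t)

include hG

include hf ht in
lemma memLp_slice : MemLp (fun x => ∫ y, G y x t * f y) 2 := by
  have := (hG.energy f hf t ht).2.1 t ⟨ht.le, le_rfl⟩
  simpa only [Measure.restrict_univ, superpose_pos (p := (_, t)) ht] using this

include hγ hb hell hf

include ht in
/-- Contraction in `L²`. -/
lemma eLpNorm_le : eLpNorm (fun x => ∫ y, G y x t * f y) 2 ≤ eLpNorm f 2 := by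
  have hs := hG.memLp_slice hf ht
  have h := hG.energy_le hγ hb hell hf ht
  have h2 : 0 ≤ ∫ p in cyl univ t, ‖wgrad (cyl univ t) (superpose G f) p‖ ^ 2 :=
    integral_nonneg fun _ => by positivity
  have e1 := integral_norm_sq hs
  have e2 := integral_norm_sq hf
  simp only [Real.norm_eq_abs, sq_abs] at e1 e2
  rw [e1, e2] at h
  have h3 : (eLpNorm (fun x => ∫ y, G y x t * f y) 2).toReal ≤ (eLpNorm f 2).toReal := by
    refine le_of_sq_le_sq ?_ ENNReal.toReal_nonneg
    have : 0 ≤ 2 * γ⁻¹ * ∫ p in cyl univ t, ‖wgrad (cyl univ t) (superpose G f) p‖ ^ 2 := by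
      positivity
    linarith
  exact (ENNReal.toReal_le_toReal hs.2.ne hf.2.ne).1 h3

lemma integral_norm_wgrad_sq_le (hS : 0 < S) :
    ∫ p in cyl univ S, ‖wgrad (cyl univ S) (superpose G f) p‖ ^ 2
      ≤ γ * (eLpNorm f 2).toReal ^ 2 := by
  have h := hG.energy_le hγ hb hell hf hS
  have h1 : 0 ≤ ∫ x, (∫ y, G y x S * f y) ^ 2 := integral_nonneg fun _ => by positivity
  have h2 : 0 ≤ ∫ p in cyl univ S, ‖wgrad (cyl univ S) (superpose G f) p‖ ^ 2 :=
    integral_nonneg fun _ => by positivity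
  have e2 := integral_norm_sq hf
  simp only [Real.norm_eq_abs, sq_abs] at e2
  rw [← e2, ← div_le_iff₀' hγ, div_eq_inv_mul]
  have : 0 ≤ γ⁻¹ * ∫ p in cyl univ S, ‖wgrad (cyl univ S) (superpose G f) p‖ ^ 2 := by positivity
  linarith

include ht in
-- The weak maximum principle by truncation: `excessInt k` vanishes up to `k` and is positive above,
-- and `excess k` is nondecreasing, so the energy inequality forces the integral of `excessInt k` at
-- time `t` to vanish. The truncation is smooth because test functions are composed with it, and `0
-- ≤ k` makes it vanish at `0`.
lemma ae_le_of_ae_le {k : ℝ} (hk : 0 ≤ k) (h : ∀ᵐ y, f y ≤ k) :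
    ∀ᵐ x, ∫ y, G y x t * f y ≤ k := by
  obtain ⟨W, hW⟩ := hG.exists_isDivSolution hγ hb hell hf ht
  have hw := (hG.energy f hf t ht).1.isWeakGrad
  obtain ⟨hm, φ, h1, h2, h3⟩ := hw.exists_tests_comp ht (contDiff_excess k)
    (excess_eq_zero hk) (abs_deriv_excess_le k)
  have := hW.energy_le isOpen_univ ht (isConvexPair_excess hk) hm h1 h2 h3
  simp only [Measure.restrict_univ, superpose_zero, zero_mul, add_zero,
    superpose_pos (p := (_, t)) ht] at this
  have e0 : ∫ x, excessInt k (f x) = 0 :=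
    integral_eq_zero_of_ae (by filter_upwards [h] with x hx using excessInt_eq_zero hx)
  have e1 : 0 ≤ ∫ p in cyl univ t, inner ℝ (app (b p.1) (wgrad (cyl univ t) (superpose G f) p))
      (deriv (excess k) (superpose G f p) • wgrad (cyl univ t) (superpose G f) p) := by
    refine integral_nonneg fun p => ?_
    simp only [inner_smul_right, deriv_excess, Pi.zero_apply]
    exact mul_nonneg (Real.smoothTransition.nonneg _) ((hell p.1).nonneg hγ _)
  have hnn : ∀ r, 0 ≤ excessInt k r := fun r => by
    rcases le_or_gt r k with hr | hr
    · rw [excessInt_eq_zero hr]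
    · exact (excessInt_pos hr).le
  have hi := (isConvexPair_excess hk).integrable (hG.memLp_slice hf ht)
  have hz : ∫ x, excessInt k (∫ y, G y x t * f y) = 0 :=
    le_antisymm (by linarith) (integral_nonneg fun x => hnn _)
  rw [integral_eq_zero_iff_of_nonneg (fun x => hnn _) hi] at hz
  filter_upwards [hz] with x hx
  by_contra! hlt
  exact (excessInt_pos hlt).ne' hx

include ht in
/-- Contraction in `L^∞`. -/
lemma ae_abs_le {k : ℝ} (hk : 0 ≤ k) (h : ∀ᵐ y, |f y| ≤ k) :
    ∀ᵐ x, |∫ y, G y x t * f y| ≤ k := by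
  have h1 := hG.ae_le_of_ae_le hγ hb hell hf ht hk (h.mono fun y hy => (abs_le.1 hy).2)
  have h2 := hG.ae_le_of_ae_le hγ hb hell hf.neg ht hk
    (h.mono fun y hy => by simp only [Pi.neg_apply]; linarith [(abs_le.1 hy).1])
  filter_upwards [h1, h2] with x hx1 hx2
  simp only [Pi.neg_apply, mul_neg, integral_neg] at hx2
  exact abs_le.2 ⟨by linarith, hx1⟩

end IsFundamentalSolution

/-! ### Pairing with a gradient -/

/-- Summation by parts along the diagonal. On each cell of a uniform partition `b(r, r)` is replaced
by `b(r, x_j)`, and Abel summation turns the total into `∫ b(r, 0) dr` plus tails `∫_{x_{j+1}}^S` of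
the increments of `b` in its second variable. In a tail the increment is frozen, the situation
controlled by an energy estimate. The bounds telescope to `V S - V 0`, and the discretisation error
`M S² / n` disappears. -/
lemma norm_integral_diag_le {b : ℝ → ℝ → E} {V : ℝ → ℝ} {S M K : ℝ} (hS : 0 ≤ S)
    (h1 : ∀ r ∈ Ioc 0 S, ∀ s ∈ Icc 0 S, ∀ s' ∈ Icc 0 S, s ≤ s' →
      ‖b r s' - b r s‖ ≤ M * (s' - s))
    (h2 : ∀ ρ ∈ Icc 0 S, ∀ s ∈ Icc 0 S, ∀ s' ∈ Icc 0 S, s ≤ s' →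
      ‖∫ r in ρ..S, (b r s' - b r s)‖ ≤ V s' - V s)
    (h3 : ‖∫ r in 0..S, b r 0‖ ≤ K)
    (hi : ∀ s ∈ Icc 0 S, IntervalIntegrable (fun r => b r s) volume 0 S)
    (hd : IntervalIntegrable (fun r => b r r) volume 0 S) :
    ‖∫ r in 0..S, b r r‖ ≤ K + (V S - V 0) := by
  rcases hS.eq_or_lt with rfl | hSpos
  · simpa using h3
  have main : ∀ n : ℕ, 0 < n → ‖∫ r in 0..S, b r r‖ ≤ K + (V S - V 0) + M * S ^ 2 / n := by
    intro n hn
    have hn' : (0 : ℝ) < n := by exact_mod_cast hn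
    set x : ℕ → ℝ := fun j => j * (S / n) with hx
    have hx0 : x 0 = 0 := by simp [hx]
    have hxn : x n = S := by simp only [hx]; field_simp
    have hxs : ∀ j, x (j + 1) - x j = S / n := fun j => by simp only [hx]; push_cast; ring
    have hxm : Monotone x := monotone_nat_of_le_succ fun j => by
      have := hxs j
      have : 0 < S / n := by positivity
      linarith
    have hmem : ∀ j ≤ n, x j ∈ Icc 0 S := fun j hj =>
      ⟨by rw [← hx0]; exact hxm (Nat.zero_le _), by rw [← hxn]; exact hxm hj⟩
    have sub : ∀ {f : ℝ → E}, IntervalIntegrable f volume 0 S → ∀ u ∈ Icc 0 S, ∀ v ∈ Icc 0 S,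
        IntervalIntegrable f volume u v := fun hf u hu v hv => hf.mono_set (by
      rw [uIcc_of_le hS]
      exact uIcc_subset_Icc hu hv)
    have hSm : S ∈ Icc 0 S := ⟨hS, le_rfl⟩
    have abel : ∀ m ≤ n, ∑ j ∈ Finset.range m, ∫ r in x j..x (j + 1), b r (x j)
        = (∫ r in 0..S, b r 0) - (∫ r in x m..S, b r (x m))
          + ∑ j ∈ Finset.range m, ∫ r in x (j + 1)..S, (b r (x (j + 1)) - b r (x j)) := by
      intro m
      induction m with
      | zero => intro _; simp [hx0]
      | succ m ih =>
        intro hm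
        have hm1 := hmem m (by omega)
        have hm2 := hmem (m + 1) hm
        rw [Finset.sum_range_succ, Finset.sum_range_succ, ih (by omega),
          intervalIntegral.integral_sub (sub (hi _ hm2) _ hm2 _ hSm) (sub (hi _ hm1) _ hm2 _ hSm),
          ← intervalIntegral.integral_add_adjacent_intervals (sub (hi _ hm1) _ hm1 _ hm2)
            (sub (hi _ hm1) _ hm2 _ hSm)]
        abel
    have e1 : ‖∑ j ∈ Finset.range n, ∫ r in x j..x (j + 1), b r (x j)‖ ≤ K + (V S - V 0) := by
      rw [abel n le_rfl, hxn, intervalIntegral.integral_same, sub_zero]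
      refine (norm_add_le _ _).trans (add_le_add h3 ?_)
      refine (norm_sum_le _ _).trans ?_
      rw [← hxn, ← hx0, ← Finset.sum_range_sub (fun j => V (x j)), hxn]
      refine Finset.sum_le_sum fun j hj => ?_
      have hj := Finset.mem_range.1 hj
      exact h2 _ (hmem _ hj) _ (hmem _ hj.le) _ (hmem _ hj) (hxm (Nat.le_succ _))
    have e2 : ‖(∫ r in 0..S, b r r) - ∑ j ∈ Finset.range n, ∫ r in x j..x (j + 1), b r (x j)‖
        ≤ M * S ^ 2 / n := by
      have : ∫ r in 0..S, b r r = ∑ j ∈ Finset.range n, ∫ r in x j..x (j + 1), b r r := by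
        rw [intervalIntegral.sum_integral_adjacent_intervals fun j hj =>
          sub hd _ (hmem _ hj.le) _ (hmem _ hj), hx0, hxn]
      rw [this, ← Finset.sum_sub_distrib]
      have hb : ∀ j ∈ Finset.range n, ‖(∫ r in x j..x (j + 1), b r r)
          - ∫ r in x j..x (j + 1), b r (x j)‖ ≤ M * (S / n) * (S / n) := by
        intro j hj
        have hj := Finset.mem_range.1 hj
        have m1 := hmem j hj.le
        have m2 := hmem (j + 1) hj
        have hle := hxm (Nat.le_succ j)
        rw [← intervalIntegral.integral_sub (sub hd _ m1 _ m2) (sub (hi _ m1) _ m1 _ m2)]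
        refine (intervalIntegral.norm_integral_le_of_norm_le_const (C := M * (S / n))
          fun r hr => ?_).trans_eq ?_
        · rw [uIoc_of_le hle] at hr
          have hr0 : r ∈ Ioc 0 S := ⟨m1.1.trans_lt hr.1, hr.2.trans m2.2⟩
          have hr1 : r ∈ Icc 0 S := ⟨hr0.1.le, hr0.2⟩
          have hM : 0 ≤ M := by
            have := (norm_nonneg _).trans (h1 r hr0 0 ⟨le_rfl, hS⟩ S hSm hS)
            rw [sub_zero] at this
            exact nonneg_of_mul_nonneg_left this hSpos
          refine (h1 r hr0 _ m1 r hr1 hr.1.le).trans ?_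
          gcongr
          rw [← hxs j]
          linarith [hr.2]
        · rw [hxs, abs_of_nonneg (by positivity)]
      refine (norm_sum_le _ _).trans ((Finset.sum_le_sum hb).trans_eq ?_)
      rw [Finset.sum_const, Finset.card_range, nsmul_eq_mul]
      field_simp
    calc ‖∫ r in 0..S, b r r‖
        ≤ ‖∑ j ∈ Finset.range n, ∫ r in x j..x (j + 1), b r (x j)‖
          + ‖(∫ r in 0..S, b r r) - ∑ j ∈ Finset.range n, ∫ r in x j..x (j + 1), b r (x j)‖ :=
          norm_le_norm_add_norm_sub' _ _
      _ ≤ _ := add_le_add e1 e2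
  have hlim : Tendsto (fun n : ℕ => K + (V S - V 0) + M * S ^ 2 / n) atTop
      (𝓝 (K + (V S - V 0) + 0)) :=
    tendsto_const_nhds.add (tendsto_const_div_atTop_nhds_zero_nat _)
  rw [add_zero] at hlim
  exact ge_of_tendsto hlim ((eventually_gt_atTop 0).mono main)

/-- `∫ (∫ G_z(x, r) f(z) dz) ∇ψ(x) dx`. -/
def pairing (G : E → E → ℝ → ℝ) (f ψ : E → ℝ) (r : ℝ) : E :=
  ∫ x, (∫ z, G z x r * f z) • gradient ψ x

section Pairing

lemma contDiff_gradient {ψ : E → ℝ} (hψ : ContDiff ℝ ∞ ψ) : ContDiff ℝ ∞ (gradient ψ) :=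
  (InnerProductSpace.toDual ℝ E).symm.contDiff.comp (hψ.fderiv_right (m := ∞) (by simp))

lemma hasCompactSupport_gradient {ψ : E → ℝ} (hψ : HasCompactSupport ψ) :
    HasCompactSupport (gradient ψ) :=
  (hψ.fderiv ℝ).comp_left (g := (InnerProductSpace.toDual ℝ E).symm) (map_zero _)

lemma memLp_gradient {ψ : E → ℝ} (hψ : ContDiff ℝ ∞ ψ) (hc : HasCompactSupport ψ) :
    MemLp (gradient ψ) 2 :=
  (contDiff_gradient hψ).continuous.memLp_of_hasCompactSupport (hasCompactSupport_gradient hc)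

lemma norm_integral_smul_le {α : Type*} [MeasurableSpace α] {μ : Measure α} {F : Type*}
    [NormedAddCommGroup F] [InnerProductSpace ℝ F]
    {f : α → ℝ} {g : α → F} (hf : MemLp f 2 μ) (hg : MemLp g 2 μ) :
    ‖∫ x, f x • g x ∂μ‖ ≤ (eLpNorm f 2 μ).toReal * (eLpNorm g 2 μ).toReal := by
  refine (norm_integral_le_integral_norm _).trans ?_
  simp_rw [norm_smul]
  have := (le_abs_self _).trans (abs_integral_mul_le hf.norm hg.norm)
  rwa [eLpNorm_norm, eLpNorm_norm] at this

variable {b : E → Mat} {G : E → E → ℝ → ℝ} {γ : ℝ} {f f' ψ : E → ℝ} {S r : ℝ}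

lemma stronglyMeasurable_kernel (hG : IsFundamentalSolution b G) {F : E × ℝ → ℝ}
    (hF : Measurable F) :
    StronglyMeasurable fun p : E × ℝ => ∫ z, G z p.1 p.2 * F (z, p.2) := by
  have h : Measurable fun q : (E × ℝ) × E => G q.2 q.1.1 q.1.2 * F (q.2, q.1.2) :=
    (hG.measurable.comp (by fun_prop : Measurable fun q : (E × ℝ) × E => (q.2, q.1.1, q.1.2))).mul
      (hF.comp (by fun_prop))
  exact h.stronglyMeasurable.integral_prod_right'

lemma stronglyMeasurable_pairing (hG : IsFundamentalSolution b G) (hψ : ContDiff ℝ ∞ ψ)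
    {F : E × ℝ → ℝ} (hF : Measurable F) :
    StronglyMeasurable fun r => pairing G (fun z => F (z, r)) ψ r := by
  have h : StronglyMeasurable fun p : E × ℝ =>
      (∫ z, G z p.1 p.2 * F (z, p.2)) • gradient ψ p.1 :=
    (stronglyMeasurable_kernel hG hF).smul
      ((contDiff_gradient hψ).continuous.comp continuous_fst).stronglyMeasurable
  exact (h.comp_measurable measurable_swap).integral_prod_right'

lemma pairing_sub (hG : IsFundamentalSolution b G) (hψ : ContDiff ℝ ∞ ψ)
    (hc : HasCompactSupport ψ) (hf : MemLp f 2) (hf' : MemLp f' 2) (hr : 0 < r) :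
    pairing G (fun z => f z - f' z) ψ r = pairing G f ψ r - pairing G f' ψ r := by
  rw [pairing, pairing, pairing,
    ← integral_sub (integrable_smul_of_memLp (hG.memLp_slice hf hr) (memLp_gradient hψ hc))
      (integrable_smul_of_memLp (hG.memLp_slice hf' hr) (memLp_gradient hψ hc))]
  refine integral_congr_ae ?_
  filter_upwards [hG.integrable f hf r hr, hG.integrable f' hf' r hr] with x h1 h2
  rw [← sub_smul, ← integral_sub h1 h2]
  simp_rw [mul_sub]

variable (hG : IsFundamentalSolution b G) (hγ : 0 < γ)
  (hb : ∀ i j, Measurable fun x => b x i j) (hell : ∀ x, IsElliptic γ (b x))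
  (hψ : ContDiff ℝ ∞ ψ) (hc : HasCompactSupport ψ)
include hG hγ hb hell hψ hc

/-- This bound by `‖∇ψ‖` serves for integrability and for the discretisation error in
`norm_integral_diag_le`, where the size of the constant is irrelevant. -/
lemma norm_pairing_le (hf : MemLp f 2) (hr : 0 < r) : ‖pairing G f ψ r‖
    ≤ (eLpNorm f 2).toReal * (eLpNorm (gradient ψ) 2).toReal := by
  refine (norm_integral_smul_le (hG.memLp_slice hf hr) (memLp_gradient hψ hc)).trans ?_
  gcongr
  · exact hf.2.ne
  · exact hG.eLpNorm_le hγ hb hell hf hr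

omit hγ hb hell in
-- Testing with products `κ(r) ψ(x)` and localising in `r` moves the gradient onto the solution. The
-- identity holds for almost every `r` only, because the weak gradient is defined on space-time.
lemma ae_pairing_eq (hf : MemLp f 2) (hS : 0 < S) :
    ∀ᵐ r ∂(volume.restrict (Ioo 0 S)),
      pairing G f ψ r = -∫ x, ψ x • wgrad (cyl univ S) (superpose G f) (x, r) := by
  have hw := (hG.energy f hf S hS).1.isWeakGrad
  set U := superpose G f with hU
  set g := wgrad (cyl univ S) U with hg
  have hfin : ∀ {F : Type} [NormedAddCommGroup F] [NormedSpace ℝ F] {k : E → F}, Continuous k →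
      HasCompactSupport k → MemLp (fun p : E × ℝ => k p.1) 2 (volume.restrict (cyl univ S)) := by
    intro F _ _ k hk hkc
    have h1 : MemLp k 2 (volume.restrict (univ : Set E)) := by
      rw [Measure.restrict_univ]
      exact hk.memLp_of_hasCompactSupport hkc
    rw [volume_restrict_cyl]
    exact h1.comp_fst _
  have i1 : Integrable (fun p => U p • gradient ψ p.1) (volume.restrict (cyl univ S)) :=
    integrable_smul_of_memLp hw.1
      (hfin (contDiff_gradient hψ).continuous (hasCompactSupport_gradient hc))
  have i2 : Integrable (fun p => ψ p.1 • g p) (volume.restrict (cyl univ S)) :=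
    integrable_smul_of_memLp (hfin hψ.continuous hc) hw.2.1
  have hL : LocallyIntegrableOn (fun r => ∫ x in (univ : Set E),
      (U (x, r) • gradient ψ x + ψ x • g (x, r))) (Ioo 0 S) :=
    (integrableOn_integral_slice (i1.add i2)).locallyIntegrableOn
  have key := isOpen_Ioo.ae_eq_zero_of_integral_contDiff_smul_eq_zero hL ?_
  · rw [ae_restrict_iff' measurableSet_Ioo]
    have s1 := ae_integrable_slice i1
    have s2 := ae_integrable_slice i2
    rw [ae_restrict_iff' measurableSet_Ioo] at s1 s2
    filter_upwards [key, s1, s2] with r hr h1 h2 hrS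
    have h := hr hrS
    rw [integral_add (h1 hrS) (h2 hrS), Measure.restrict_univ] at h
    rw [← add_eq_zero_iff_eq_neg, ← h, pairing]
    simp_rw [hU, IsFundamentalSolution.superpose_pos (p := (_, r)) hrS.1]
  · intro κ hκ hκc hκS
    have hT : IsTest (cyl univ S) fun p : E × ℝ => κ p.2 * ψ p.1 := by
      refine ⟨(contDiff_comp_snd hκ).mul (hψ.comp contDiff_fst), ?_, ?_⟩
      · refine HasCompactSupport.of_support_subset_isCompact (hc.isCompact.prod hκc.isCompact)
          fun p hp => ?_
        exact ⟨subset_tsupport _ (right_ne_zero_of_mul hp),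
          subset_tsupport _ (left_ne_zero_of_mul hp)⟩
      · refine (closure_minimal (t := univ ×ˢ tsupport κ) (fun p hp => ?_)
          (isClosed_univ.prod (isClosed_tsupport _))).trans (prod_mono_right hκS)
        exact ⟨mem_univ _, subset_tsupport _ (left_ne_zero_of_mul hp)⟩
    have e := hw.2.2 _ hT
    have hgr : ∀ p : E × ℝ, gradx (fun p : E × ℝ => κ p.2 * ψ p.1) p = κ p.2 • gradient ψ p.1 :=
      fun p => gradx_timeMul (φ := fun p => ψ p.1) hκ (hψ.comp contDiff_fst) p
    simp_rw [hgr] at e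
    have j1 : Integrable (fun p => U p • κ p.2 • gradient ψ p.1) (volume.restrict (cyl univ S)) :=
      integrable_smul_of_memLp hw.1 ((funext hgr : gradx _ = _) ▸ hT.memLp_gradx (cyl univ S))
    have j2 : Integrable (fun p => (κ p.2 * ψ p.1) • g p) (volume.restrict (cyl univ S)) :=
      integrable_smul_of_memLp (hT.memLp _) hw.2.1
    have ej := integral_cyl (j1.add j2)
    simp only [Pi.add_apply] at ej
    rw [← add_eq_zero_iff_eq_neg, ← integral_add j1 j2, ej] at e
    have hsub : Function.support (fun r => κ r • ∫ x in (univ : Set E),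
        (U (x, r) • gradient ψ x + ψ x • g (x, r))) ⊆ Ioo 0 S := by
      intro r hr
      exact hκS (subset_tsupport _ (left_ne_zero_of_smul hr))
    rw [← setIntegral_eq_integral_of_forall_compl_eq_zero (s := Ioo 0 S)
      (fun r hr => Function.notMem_support.1 fun h => hr (hsub h)), ← e]
    refine integral_congr_ae (ae_of_all _ fun r => ?_)
    simp only []
    rw [← integral_smul]
    refine integral_congr_ae (ae_of_all _ fun x => ?_)
    simp only [smul_add, smul_smul, mul_comm (κ r)]

/-- Only `‖ψ‖` appears, not `‖∇ψ‖`: once the gradient sits on the solution, its square integral over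
time is controlled by the energy estimate, uniformly in `S`. -/
lemma eLpNorm_pairing_le (hf : MemLp f 2) (hfm : Measurable f) (hS : 0 < S) :
    MemLp (pairing G f ψ) 2 (volume.restrict (Ioo 0 S)) ∧
    (eLpNorm (pairing G f ψ) 2 (volume.restrict (Ioo 0 S))).toReal
      ≤ √γ * ((eLpNorm f 2).toReal * (eLpNorm ψ 2).toReal) := by
  have hw := (hG.energy f hf S hS).1.isWeakGrad
  set g := wgrad (cyl univ S) (superpose G f) with hg
  have hψ2 : MemLp ψ 2 := hψ.continuous.memLp_of_hasCompactSupport hc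
  have hm : MemLp (pairing G f ψ) 2 (volume.restrict (Ioo 0 S)) := by
    refine MemLp.of_bound (stronglyMeasurable_pairing hG hψ
      (F := fun p => f p.1) (hfm.comp measurable_fst)).aestronglyMeasurable
      ((eLpNorm f 2).toReal * (eLpNorm (gradient ψ) 2).toReal) ?_
    rw [ae_restrict_iff' measurableSet_Ioo]
    exact ae_of_all _ fun r hr => norm_pairing_le hG hγ hb hell hψ hc hf hr.1
  refine ⟨hm, ?_⟩
  have hg2 := hw.2.1.integrable_norm_pow two_ne_zero
  have h1 : ∫ r in Ioo 0 S, ‖pairing G f ψ r‖ ^ 2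
      ≤ ∫ r in Ioo 0 S, (eLpNorm ψ 2).toReal ^ 2 * ∫ x in (univ : Set E), ‖g (x, r)‖ ^ 2 := by
    refine integral_mono_ae (hm.integrable_norm_pow two_ne_zero)
      ((integrableOn_integral_slice hg2).const_mul _) ?_
    have hgm : ∀ᵐ r ∂(volume.restrict (Ioo 0 S)),
        AEStronglyMeasurable (fun x => g (x, r)) (volume.restrict (univ : Set E)) := by
      have := hw.2.1.1
      rw [volume_restrict_cyl] at this
      exact this.prodMk_right
    filter_upwards [ae_pairing_eq hG hψ hc hf hS, ae_integrable_slice hg2, hgm] with r h1 h2 h3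
    rw [h1, norm_neg]
    rw [Measure.restrict_univ] at h2 h3 ⊢
    have hgr : MemLp (fun x => g (x, r)) 2 := by
      refine (memLp_two_iff_integrable_sq_norm h3).2 h2
    rw [integral_norm_sq hgr, ← mul_pow]
    exact pow_le_pow_left₀ (norm_nonneg _) (norm_integral_smul_le hψ2 hgr) 2
  rw [integral_const_mul, ← integral_cyl hg2, integral_norm_sq hm] at h1
  have h2 := hG.integral_norm_wgrad_sq_le hγ hb hell hf hS
  refine le_of_sq_le_sq (h1.trans ?_) (by positivity)
  rw [mul_pow, mul_pow, Real.sq_sqrt hγ.le]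
  calc _ ≤ (eLpNorm ψ 2).toReal ^ 2 * (γ * (eLpNorm f 2).toReal ^ 2) := by gcongr
    _ = _ := by ring

/-- Cauchy–Schwarz in `r`: the exponential is square integrable on the half line, so the bound is
uniform in `ρ` and `S`. -/
lemma norm_integral_pairing_le {κ : ℝ} (hκ : 0 < κ) (hf : MemLp f 2) (hfm : Measurable f)
    {ρ : ℝ} (hρ : 0 ≤ ρ) (hρS : ρ ≤ S) :
    ‖∫ r in ρ..S, Real.exp (-(κ * r)) • pairing G f ψ r‖
      ≤ (eLpNorm (fun r => Real.exp (-(κ * r))) 2 (volume.restrict (Ioi 0))).toReal *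
        (√γ * ((eLpNorm f 2).toReal * (eLpNorm ψ 2).toReal)) := by
  have hS : 0 < S + 1 := by linarith
  obtain ⟨h1, h2⟩ := eLpNorm_pairing_le hG hγ hb hell hψ hc hf hfm hS
  have he : MemLp (fun r => Real.exp (-(κ * r))) 2 (volume.restrict (Ioi 0)) := by
    refine (memLp_two_iff_integrable_sq (by fun_prop)).2 ?_
    have := exp_neg_integrableOn_Ioi 0 (b := 2 * κ) (by positivity)
    refine this.congr (ae_of_all _ fun r => ?_)
    simp only [← Real.exp_nat_mul]
    congr 1
    push_cast
    ring
  have hss : Ioc ρ S ⊆ Ioo 0 (S + 1) := fun r hr => ⟨hρ.trans_lt hr.1, by linarith [hr.2]⟩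
  rw [intervalIntegral.integral_of_le hρS]
  have m1 := he.mono_measure (Measure.restrict_mono (hss.trans Ioo_subset_Ioi_self) le_rfl)
  have m2 := h1.mono_measure (Measure.restrict_mono hss le_rfl)
  refine (norm_integral_smul_le m1 m2).trans ?_
  refine mul_le_mul ?_ (le_trans ?_ h2) ENNReal.toReal_nonneg ENNReal.toReal_nonneg
  · exact ENNReal.toReal_mono he.2.ne (eLpNorm_mono_measure _
      (Measure.restrict_mono (hss.trans Ioo_subset_Ioi_self) le_rfl))
  · exact ENNReal.toReal_mono h1.2.ne (eLpNorm_mono_measure _ (Measure.restrict_mono hss le_rfl))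

end Pairing

/-! ### A duality criterion for weak differentiability -/

/-- The bound makes `l` vanish on the kernel of `ι`, so it factors through the range as a continuous
functional. Hahn–Banach extends it to `H` and Riesz represents it. -/
lemma exists_inner_eq_of_le {V H : Type*} [AddCommGroup V] [Module ℝ V] [NormedAddCommGroup H]
    [InnerProductSpace ℝ H] [CompleteSpace H] (ι : V →ₗ[ℝ] H) (l : V →ₗ[ℝ] ℝ) {C : ℝ}
    (h : ∀ v, |l v| ≤ C * ‖ι v‖) : ∃ g : H, ∀ v, l v = inner ℝ g (ι v) := by
  have hl : l ∈ LinearMap.range ι.dualMap := by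
    rw [LinearMap.range_dualMap_eq_dualAnnihilator_ker, Submodule.mem_dualAnnihilator]
    intro v hv
    have := h v
    rw [LinearMap.mem_ker.1 hv, norm_zero, mul_zero] at this
    exact abs_nonpos_iff.1 this
  obtain ⟨L, rfl⟩ := hl
  let f : LinearMap.range ι →L[ℝ] ℝ := (L.domRestrict (LinearMap.range ι)).mkContinuous C (by
    rintro ⟨_, v, rfl⟩
    exact h v)
  obtain ⟨g, hg, -⟩ := exists_extension_norm_eq (LinearMap.range ι) f
  refine ⟨(InnerProductSpace.toDual ℝ H).symm g, fun v => ?_⟩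
  rw [InnerProductSpace.toDual_symm_apply]
  exact (hg ⟨ι v, v, rfl⟩).symm

/-- The space `C_c^∞(Q)`. -/
def testSubmodule (Q : Set (E × ℝ)) : Submodule ℝ (E × ℝ → ℝ) where
  carrier := {φ | IsTest Q φ}
  add_mem' h h' := h.add h'
  zero_mem' := ⟨contDiff_const, HasCompactSupport.zero, by simp⟩
  smul_mem' c _ h := h.const_mul c

lemma gradx_const_mul {φ : E × ℝ → ℝ} (hφ : ContDiff ℝ ∞ φ) (c : ℝ) (p : E × ℝ) :
    gradx (fun p => c * φ p) p = c • gradx φ p :=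
  gradx_timeMul (κ := fun _ => c) contDiff_const hφ p

/-- Each component of `φ ↦ ∫ u ∇φ` is a linear functional bounded in the `L²` norm of `φ`, hence
represented by an `L²` function. These functions, with the opposite sign, are the components of the
gradient. -/
lemma memH_of_norm_integral_le {Q : Set (E × ℝ)} {u : E × ℝ → ℝ}
    (hu : MemLp u 2 (volume.restrict Q)) {C : ℝ}
    (h : ∀ φ, IsTest Q φ → ‖∫ p in Q, u p • gradx φ p‖
      ≤ C * (eLpNorm φ 2 (volume.restrict Q)).toReal) : MemH Q u := by
  have hint : ∀ φ, IsTest Q φ → Integrable (fun p => u p • gradx φ p) (volume.restrict Q) :=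
    fun φ hφ => integrable_smul_of_memLp hu (hφ.memLp_gradx Q)
  have key : ∀ i : Fin 3, ∃ g : E × ℝ → ℝ, MemLp g 2 (volume.restrict Q) ∧
      ∀ φ, IsTest Q φ → (∫ p in Q, u p • gradx φ p) i = ∫ p in Q, φ p * g p := by
    intro i
    let ι : testSubmodule Q →ₗ[ℝ] Lp ℝ 2 ((volume : Measure (E × ℝ)).restrict Q) :=
      { toFun := fun φ => (IsTest.memLp (Q := Q) φ.2 Q).toLp φ.1
        map_add' := fun φ ψ => MemLp.toLp_add _ _
        map_smul' := fun c φ => MemLp.toLp_const_smul c _ }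
    let l : testSubmodule Q →ₗ[ℝ] ℝ :=
      { toFun := fun φ => (EuclideanSpace.proj i : E →L[ℝ] ℝ) (∫ p in Q, u p • gradx φ.1 p)
        map_add' := fun φ ψ => by
          rw [← map_add, ← integral_add (hint _ φ.2) (hint _ ψ.2)]
          refine congrArg _ (integral_congr_ae (ae_of_all _ fun p => ?_))
          have := gradx_add (IsTest.contDiff (Q := Q) φ.2) (IsTest.contDiff (Q := Q) ψ.2) p
          simp only [← smul_add, ← this]
          rfl
        map_smul' := fun c φ => by
          rw [RingHom.id_apply, ← map_smul, ← integral_smul]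
          refine congrArg _ (integral_congr_ae (ae_of_all _ fun p => ?_))
          have := gradx_const_mul (IsTest.contDiff (Q := Q) φ.2) c p
          simp only [smul_comm c (u p), ← this]
          rfl }
    obtain ⟨g, hg⟩ := exists_inner_eq_of_le ι l (C := C) fun φ => by
      refine ((PiLp.norm_apply_le (∫ p in Q, u p • gradx φ.1 p) i).trans (h φ.1 φ.2)).trans_eq ?_
      have := Lp.norm_toLp φ.1 (IsTest.memLp (Q := Q) φ.2 Q)
      exact congrArg (C * ·) this.symm
    refine ⟨g, Lp.memLp g, fun φ hφ => ?_⟩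
    refine (hg ⟨φ, hφ⟩).trans ?_
    rw [L2.inner_def]
    refine integral_congr_ae ?_
    filter_upwards [(hφ.memLp Q).coeFn_toLp] with p hp
    change inner ℝ (g p) (((hφ.memLp Q).toLp φ : Lp ℝ 2 _) p) = _
    rw [hp]
    simp
  choose g hg hgu using key
  refine ⟨fun p => ∑ i, (-g i p) • (EuclideanSpace.single i (1 : ℝ) : E), hu, ?_, fun φ hφ => ?_⟩
  · exact memLp_finsetSum _ fun i _ => (ContinuousLinearMap.toSpanSingleton ℝ
      (EuclideanSpace.single i (1 : ℝ) : E)).comp_memLp' (hg i).neg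
  · have e : ∀ v : E, v = ∑ i, v i • (EuclideanSpace.single i (1 : ℝ) : E) := by
      intro v
      ext j
      simp [Finset.sum_apply, Pi.single_apply]
    rw [e (∫ p in Q, u p • gradx φ p)]
    simp_rw [Finset.smul_sum, smul_smul]
    have hi : ∀ i, Integrable (fun p => φ p * -g i p) (volume.restrict Q) := fun i =>
      integrable_smul_of_memLp (hφ.memLp Q) (hg i).neg
    rw [integral_finsetSum _ fun i _ => (hi i).smul_const _, ← Finset.sum_neg_distrib]
    refine Finset.sum_congr rfl fun i _ => ?_
    rw [integral_smul_const, hgu i φ hφ, ← neg_smul]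
    simp [integral_neg]

/-! ### Potentials -/

/-- `∫₀^∞ ∫ h(z, r) G_z(x, r) dz dr`. -/
def potential (G : E → E → ℝ → ℝ) (h : E × ℝ → ℝ) (x : E) : ℝ :=
  ∫ r in Ioi (0 : ℝ), ∫ z, G z x r * h (z, r)

/-- `h` is measurable and `‖h(·, r)‖ ≤ A e^{-κ r}` in `L²(ℝ³)`. -/
structure Decays (A κ : ℝ) (h : E × ℝ → ℝ) : Prop where
  measurable : Measurable h
  le : ∀ r > 0, eLpNorm (fun z => h (z, r)) 2 ≤ ENNReal.ofReal (A * Real.exp (-(κ * r)))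

lemma integrableOn_exp_decay (A : ℝ) {κ : ℝ} (hκ : 0 < κ) :
    IntegrableOn (fun r => A * Real.exp (-(κ * r))) (Ioi 0) := by
  have := (exp_neg_integrableOn_Ioi 0 hκ).const_mul A
  simp only [neg_mul] at this
  exact this

lemma lintegral_exp_decay {A κ : ℝ} (hA : 0 ≤ A) (hκ : 0 < κ) :
    ∫⁻ r in Ioi (0 : ℝ), ENNReal.ofReal (A * Real.exp (-(κ * r))) = ENNReal.ofReal (A / κ) := by
  have hi := integrableOn_exp_decay A hκ
  rw [← ofReal_integral_eq_lintegral_ofReal hi (ae_of_all _ fun r => by positivity),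
    integral_const_mul]
  have := integral_exp_mul_Ioi (neg_neg_of_pos hκ) 0
  simp only [neg_mul, mul_zero, Real.exp_zero] at this
  rw [this]
  congr 1
  field_simp

namespace Decays

variable {A κ : ℝ} {h h' : E × ℝ → ℝ}

lemma memLp (hh : Decays A κ h) {r : ℝ} (hr : 0 < r) : MemLp (fun z => h (z, r)) 2 :=
  ⟨(hh.measurable.comp (by fun_prop)).aestronglyMeasurable,
    (hh.le r hr).trans_lt ENNReal.ofReal_lt_top⟩

lemma toReal_le (hA : 0 ≤ A) (hh : Decays A κ h) {r : ℝ} (hr : 0 < r) :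
    (eLpNorm (fun z => h (z, r)) 2).toReal ≤ A * Real.exp (-(κ * r)) :=
  ENNReal.toReal_le_of_le_ofReal (by positivity) (hh.le r hr)

variable {b : E → Mat} {G : E → E → ℝ → ℝ} {γ : ℝ} (hG : IsFundamentalSolution b G) (hγ : 0 < γ)
  (hb : ∀ i j, Measurable fun x => b x i j) (hell : ∀ x, IsElliptic γ (b x))
  (hA : 0 < A) (hκ : 0 < κ) (hh : Decays A κ h)

include hG hγ hb hell hh in
lemma ae_eLpNorm_kernel_le : ∀ᵐ r ∂(volume.restrict (Ioi (0 : ℝ))),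
    eLpNorm (fun x => ∫ z, G z x r * h (z, r)) 2 ≤ ENNReal.ofReal (A * Real.exp (-(κ * r))) := by
  rw [ae_restrict_iff' measurableSet_Ioi]
  exact ae_of_all _ fun r hr =>
    (hG.eLpNorm_le hγ hb hell (hh.memLp hr) hr).trans (hh.le r hr)

include hG hγ hb hell hA hh

lemma eLpNorm_potential_le (hκ : 0 < κ) :
    eLpNorm (potential G h) 2 ≤ ENNReal.ofReal (A / κ) := by
  rw [← lintegral_exp_decay hA.le hκ]
  exact eLpNorm_integral_le (h := fun p : E × ℝ => ∫ z, G z p.1 p.2 * h (z, p.2))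
    (stronglyMeasurable_kernel hG hh.measurable).aestronglyMeasurable (by fun_prop)
    (fun r => by simp; positivity) (fun r => ENNReal.ofReal_ne_top)
    (hh.ae_eLpNorm_kernel_le hG hγ hb hell)

include hκ

lemma ae_integrable : ∀ᵐ x, Integrable (fun r => ∫ z, G z x r * h (z, r))
    (volume.restrict (Ioi (0 : ℝ))) :=
  ae_integrable_of_eLpNorm_le (h := fun p : E × ℝ => ∫ z, G z p.1 p.2 * h (z, p.2))
    (stronglyMeasurable_kernel hG hh.measurable).aestronglyMeasurable (by fun_prop)
    (fun r => by simp; positivity) (fun r => ENNReal.ofReal_ne_top)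
    (by rw [lintegral_exp_decay hA.le hκ]; exact ENNReal.ofReal_ne_top)
    (hh.ae_eLpNorm_kernel_le hG hγ hb hell)

/-- For each `r` the inner integral is additive outside a null set of `x` that depends on `r`. Joint
measurability exchanges the two quantifiers before integration in `r`. -/
lemma potential_sub {A' : ℝ} (hA' : 0 < A') (hh' : Decays A' κ h') :
    (fun x => potential G h x - potential G h' x) =ᵐ[volume] potential G fun q => h q - h' q := by
  have key : ∀ᵐ x, ∀ᵐ r ∂(volume.restrict (Ioi (0 : ℝ))),
      (∫ z, G z x r * h (z, r)) - (∫ z, G z x r * h' (z, r))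
        = ∫ z, G z x r * (h (z, r) - h' (z, r)) := by
    refine (Measure.ae_ae_comm (p := fun x r => (∫ z, G z x r * h (z, r))
      - (∫ z, G z x r * h' (z, r)) = ∫ z, G z x r * (h (z, r) - h' (z, r)))
      (measurableSet_eq_fun ((stronglyMeasurable_kernel hG hh.measurable).measurable.sub
        (stronglyMeasurable_kernel hG hh'.measurable).measurable)
      (stronglyMeasurable_kernel hG (hh.measurable.sub hh'.measurable)).measurable)).2 ?_
    rw [ae_restrict_iff' measurableSet_Ioi]
    refine ae_of_all _ fun r hr => ?_
    filter_upwards [hG.integrable _ (hh.memLp hr) r hr, hG.integrable _ (hh'.memLp hr) r hr]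
      with x h1 h2
    rw [← integral_sub h1 h2]
    simp_rw [mul_sub]
  filter_upwards [hh.ae_integrable hG hγ hb hell hA hκ, hh'.ae_integrable hG hγ hb hell hA' hκ, key]
    with x h1 h2 h3
  rw [potential, potential, ← integral_sub h1 h2]
  exact integral_congr_ae h3

omit hA in
lemma ae_abs_potential_le {k : ℝ} (hk : 0 ≤ k)
    (hle : ∀ r > 0, ∀ z, |h (z, r)| ≤ k * Real.exp (-(κ * r))) :
    ∀ᵐ x, |potential G h x| ≤ k / κ := by
  have key : ∀ᵐ x, ∀ᵐ r ∂(volume.restrict (Ioi (0 : ℝ))),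
      ‖∫ z, G z x r * h (z, r)‖ ≤ k * Real.exp (-(κ * r)) := by
    refine (Measure.ae_ae_comm
      (p := fun x r => ‖∫ z, G z x r * h (z, r)‖ ≤ k * Real.exp (-(κ * r)))
      (measurableSet_le (stronglyMeasurable_kernel hG hh.measurable).measurable.norm
        (by fun_prop))).2 ?_
    rw [ae_restrict_iff' measurableSet_Ioi]
    exact ae_of_all _ fun r hr => hG.ae_abs_le hγ hb hell (hh.memLp hr) hr (by positivity)
      (ae_of_all _ fun z => hle r hr z)
  filter_upwards [key] with x hx
  have hi := integrableOn_exp_decay k hκ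
  refine (norm_integral_le_of_norm_le hi hx).trans_eq ?_
  have := integral_exp_mul_Ioi (neg_neg_of_pos hκ) 0
  simp only [neg_mul, mul_zero, Real.exp_zero] at this
  rw [integral_const_mul, this]
  field_simp

lemma integral_potential_smul_gradient {ψ : E → ℝ} (hψ : ContDiff ℝ ∞ ψ)
    (hc : HasCompactSupport ψ) :
    IntegrableOn (fun r => pairing G (fun z => h (z, r)) ψ r) (Ioi 0) ∧
    ∫ x, potential G h x • gradient ψ x = ∫ r in Ioi (0 : ℝ), pairing G (fun z => h (z, r)) ψ r := by
  have hm := stronglyMeasurable_kernel hG hh.measurable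
  have hF : StronglyMeasurable (fun p : E × ℝ => (∫ z, G z p.1 p.2 * h (z, p.2)) • gradient ψ p.1) :=
    hm.smul ((contDiff_gradient hψ).continuous.comp continuous_fst).stronglyMeasurable
  have hg2 := memLp_gradient hψ hc
  have hi : Integrable (fun p : E × ℝ => (∫ z, G z p.1 p.2 * h (z, p.2)) • gradient ψ p.1)
      (volume.prod (volume.restrict (Ioi (0 : ℝ)))) := by
    rw [integrable_prod_iff' hF.aestronglyMeasurable]
    refine ⟨?_, ?_⟩
    · rw [ae_restrict_iff' measurableSet_Ioi]
      exact ae_of_all _ fun r hr => integrable_smul_of_memLp (hG.memLp_slice (hh.memLp hr) hr) hg2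
    · have hd : IntegrableOn (fun r => A * Real.exp (-(κ * r)) * (eLpNorm (gradient ψ) 2).toReal)
          (Ioi 0) := (integrableOn_exp_decay A hκ).mul_const _
      refine hd.mono' ?_ ?_
      · exact (hF.norm.comp_measurable measurable_swap).integral_prod_right'.aestronglyMeasurable
      · rw [ae_restrict_iff' measurableSet_Ioi]
        refine ae_of_all _ fun r hr => ?_
        rw [Real.norm_of_nonneg (integral_nonneg fun _ => norm_nonneg _)]
        have hs := hG.memLp_slice (hh.memLp hr) hr
        simp_rw [norm_smul]
        have := (le_abs_self _).trans (abs_integral_mul_le hs.norm hg2.norm)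
        rw [eLpNorm_norm, eLpNorm_norm] at this
        refine this.trans ?_
        gcongr
        refine (ENNReal.toReal_mono (hh.memLp hr).2.ne
          (hG.eLpNorm_le hγ hb hell (hh.memLp hr) hr)).trans (hh.toReal_le hA.le hr)
  refine ⟨hi.integral_prod_right, ?_⟩
  refine Eq.trans ?_
    (integral_integral_swap (f := fun x r => (∫ z, G z x r * h (z, r)) • gradient ψ x) hi)
  refine integral_congr_ae (ae_of_all _ fun x => ?_)
  simp only [potential]
  rw [← integral_smul_const]

end Decays

/-! ### Potentials of Lipschitz sources -/

/-- `β(z, s)` is measurable, bounded by `A`, supported in `|z| ≤ R`, and `L`-Lipschitz in `s`. -/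
structure IsSource (A L R : ℝ) (β : E × ℝ → ℝ) : Prop where
  measurable : Measurable β
  abs_le : ∀ q, |β q| ≤ A
  eq_zero : ∀ z s, z ∉ Metric.closedBall (0 : E) R → β (z, s) = 0
  lipschitz : ∀ z s s', |β (z, s) - β (z, s')| ≤ L * |s - s'|

/-- `e^{-κ r} β(z, t + ε r)`. -/
def shift (κ ε t : ℝ) (β : E × ℝ → ℝ) (q : E × ℝ) : ℝ :=
  Real.exp (-(κ * q.2)) * β (q.1, t + ε * q.2)

/-- `∫₀^∞ ∫ e^{-κ r} β(z, t + ε r) G_z(x, r) dz dr`. -/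
def timePotential (G : E → E → ℝ → ℝ) (κ ε : ℝ) (β : E × ℝ → ℝ) (p : E × ℝ) : ℝ :=
  potential G (shift κ ε p.2 β) p.1

lemma toReal_eLpNorm_le {h : E → ℝ} {c : ℝ} (hc : 0 ≤ c) {B : Set E} (hB : MeasurableSet B)
    (hBf : volume B ≠ ⊤) (hle : ∀ x, ‖h x‖ ≤ c) (h0 : ∀ x, x ∉ B → h x = 0) :
    eLpNorm h 2 volume ≤ ENNReal.ofReal (c * √(volume B).toReal) := by
  refine (eLpNorm_le_of_support hc hB hle h0).trans_eq ?_
  rw [ENNReal.ofReal_mul hc, Real.sqrt_eq_rpow, ENNReal.toReal_rpow,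
    ENNReal.ofReal_toReal (by finiteness)]

lemma decays_of_abs_le {A κ : ℝ} (hA : 0 ≤ A) {h : E × ℝ → ℝ} (hm : Measurable h) {B : Set E}
    (hB : MeasurableSet B) (hBf : volume B ≠ ⊤)
    (hle : ∀ z, ∀ r > 0, |h (z, r)| ≤ A * Real.exp (-(κ * r)))
    (h0 : ∀ z, ∀ r > 0, z ∉ B → h (z, r) = 0) :
    Decays (A * √(volume B).toReal) κ h where
  measurable := hm
  le r hr := by
    rw [mul_right_comm]
    exact toReal_eLpNorm_le (by positivity) hB hBf (fun z => hle z r hr) fun z hz => h0 z r hr hz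

lemma memLp_of_abs_le {h : E → ℝ} {c : ℝ} (hc : 0 ≤ c) (hm : Measurable h) {B : Set E}
    (hB : MeasurableSet B) (hBf : volume B ≠ ⊤) (hle : ∀ x, ‖h x‖ ≤ c)
    (h0 : ∀ x, x ∉ B → h x = 0) : MemLp h 2 :=
  ⟨hm.aestronglyMeasurable,
    (toReal_eLpNorm_le hc hB hBf hle h0).trans_lt ENNReal.ofReal_lt_top⟩

lemma pairing_const_mul (G : E → E → ℝ → ℝ) (f ψ : E → ℝ) (r c : ℝ) :
    pairing G (fun z => c * f z) ψ r = c • pairing G f ψ r := by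
  rw [pairing, pairing, ← integral_smul]
  refine integral_congr_ae (ae_of_all _ fun x => ?_)
  simp only [mul_left_comm _ c, integral_const_mul, mul_smul]

/-- The square root of the volume of the ball of radius `R`. -/
def ballSize (R : ℝ) : ℝ := √(volume (Metric.closedBall (0 : E) R)).toReal

lemma volume_closedBall_ne_top (y : E) (R : ℝ) : volume (Metric.closedBall y R) ≠ ⊤ :=
  measure_closedBall_lt_top.ne

lemma ballSize_pos {R : ℝ} (hR : 0 < R) : 0 < ballSize R :=
  Real.sqrt_pos.2 (ENNReal.toReal_pos (Metric.measure_closedBall_pos volume _ hR).ne'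
    (volume_closedBall_ne_top _ _))

lemma exp_diff_bounds {κ s s' : ℝ} (hκ : 0 < κ) (hs : 0 ≤ s) (h : s ≤ s') :
    Real.exp (-(κ * s')) * (s' - s) ≤ κ⁻¹ * (Real.exp (-(κ * s)) - Real.exp (-(κ * s'))) ∧
    0 ≤ Real.exp (-(κ * s)) - Real.exp (-(κ * s')) ∧
    Real.exp (-(κ * s)) - Real.exp (-(κ * s')) ≤ κ * (s' - s) := by
  have e1 : Real.exp (-(κ * s)) = Real.exp (-(κ * s')) * Real.exp (κ * (s' - s)) := by
    rw [← Real.exp_add]; ring_nf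
  have e2 : Real.exp (-(κ * s')) = Real.exp (-(κ * s)) * Real.exp (-(κ * (s' - s))) := by
    rw [← Real.exp_add]; ring_nf
  have h1 := Real.add_one_le_exp (κ * (s' - s))
  have h2 := Real.add_one_le_exp (-(κ * (s' - s)))
  have h3 : Real.exp (-(κ * s)) ≤ 1 := Real.exp_le_one_iff.2 (by nlinarith)
  have p1 := Real.exp_pos (-(κ * s))
  have p2 := Real.exp_pos (-(κ * s'))
  refine ⟨?_, ?_, ?_⟩
  · rw [inv_mul_eq_div, le_div_iff₀ hκ, e1]
    nlinarith
  · rw [sub_nonneg]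
    exact Real.exp_le_exp.2 (by nlinarith)
  · have h4 : 0 ≤ κ * (s' - s) := mul_nonneg hκ.le (by linarith)
    have h5 : Real.exp (-(κ * s)) - Real.exp (-(κ * s'))
        ≤ Real.exp (-(κ * s)) * (κ * (s' - s)) := by
      nlinarith
    nlinarith

namespace IsSource

variable {A L R : ℝ} {β : E × ℝ → ℝ} {κ ε t : ℝ}

lemma nonneg (hβ : IsSource A L R β) : 0 ≤ A := (abs_nonneg _).trans (hβ.abs_le 0)

lemma lip_nonneg (hβ : IsSource A L R β) : 0 ≤ L := by
  have := (abs_nonneg _).trans (hβ.lipschitz 0 1 0)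
  simpa using this

lemma measurable_shift (hβ : IsSource A L R β) : Measurable (shift κ ε t β) := by
  unfold shift
  have := hβ.measurable
  fun_prop

lemma decays (hβ : IsSource A L R β) : Decays (A * ballSize R) κ (shift κ ε t β) :=
  decays_of_abs_le hβ.nonneg hβ.measurable_shift Metric.isClosed_closedBall.measurableSet
    (volume_closedBall_ne_top _ _)
    (fun z r _ => by
      rw [shift, abs_mul, Real.abs_exp, mul_comm]
      exact mul_le_mul_of_nonneg_right (hβ.abs_le _) (Real.exp_pos _).le)
    fun z r _ hz => by rw [shift, hβ.eq_zero _ _ hz, mul_zero]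

lemma decays_sub (hβ : IsSource A L R β) (s t : ℝ) :
    Decays (L * |s - t| * ballSize R) κ fun q => shift κ ε s β q - shift κ ε t β q :=
  decays_of_abs_le (mul_nonneg hβ.lip_nonneg (abs_nonneg _))
    (hβ.measurable_shift.sub hβ.measurable_shift) Metric.isClosed_closedBall.measurableSet
    (volume_closedBall_ne_top _ _)
    (fun z r _ => by
      change |shift κ ε s β (z, r) - shift κ ε t β (z, r)| ≤ _
      rw [shift, shift, ← mul_sub, abs_mul, Real.abs_exp, mul_comm]
      refine mul_le_mul_of_nonneg_right ((hβ.lipschitz _ _ _).trans_eq ?_) (Real.exp_pos _).le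
      rw [add_sub_add_right_eq_sub])
    fun z r _ hz => by
      change shift κ ε s β (z, r) - shift κ ε t β (z, r) = 0
      rw [shift, shift, hβ.eq_zero _ _ hz, hβ.eq_zero _ _ hz, mul_zero, sub_zero]

/-- The increments are dominated by those of a monotone function of time, so they telescope along
every partition. The Lipschitz part enters through `e^{-κ s'} (s' - s) ≤ κ⁻¹ (e^{-κ s} - e^{-κ
s'})`. -/
lemma abs_weighted_sub_le (hβ : IsSource A L R β) (hκ : 0 < κ) (hε : |ε| ≤ 1) {s s' : ℝ}
    (hs : 0 ≤ s) (h : s ≤ s') (z : E) :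
    |Real.exp (-(κ * s')) * β (z, t + ε * s') - Real.exp (-(κ * s)) * β (z, t + ε * s)|
      ≤ (A + L * κ⁻¹) * (Real.exp (-(κ * s)) - Real.exp (-(κ * s'))) := by
  obtain ⟨h1, h2, -⟩ := exp_diff_bounds hκ hs h
  have e : Real.exp (-(κ * s')) * β (z, t + ε * s') - Real.exp (-(κ * s)) * β (z, t + ε * s)
      = Real.exp (-(κ * s')) * (β (z, t + ε * s') - β (z, t + ε * s))
        - (Real.exp (-(κ * s)) - Real.exp (-(κ * s'))) * β (z, t + ε * s) := by ring
  have hL := hβ.lip_nonneg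
  have a1 : |β (z, t + ε * s') - β (z, t + ε * s)| ≤ L * (s' - s) := by
    refine (hβ.lipschitz _ _ _).trans (mul_le_mul_of_nonneg_left ?_ hL)
    rw [add_sub_add_left_eq_sub, ← mul_sub, abs_mul, abs_of_nonneg (sub_nonneg.2 h)]
    exact mul_le_of_le_one_left (sub_nonneg.2 h) hε
  rw [e]
  refine (abs_sub _ _).trans ?_
  rw [abs_mul, abs_mul, Real.abs_exp, abs_of_nonneg h2]
  have b1 : Real.exp (-(κ * s')) * |β (z, t + ε * s') - β (z, t + ε * s)|
      ≤ L * (κ⁻¹ * (Real.exp (-(κ * s)) - Real.exp (-(κ * s')))) := by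
    calc _ ≤ Real.exp (-(κ * s')) * (L * (s' - s)) := by gcongr
      _ = L * (Real.exp (-(κ * s')) * (s' - s)) := by ring
      _ ≤ _ := by gcongr
  have b2 := mul_le_mul_of_nonneg_left (hβ.abs_le (z, t + ε * s)) h2
  linarith

variable {b : E → Mat} {G : E → E → ℝ → ℝ} {γ : ℝ} (hG : IsFundamentalSolution b G) (hγ : 0 < γ)
  (hb : ∀ i j, Measurable fun x => b x i j) (hell : ∀ x, IsElliptic γ (b x))
  (hA : 0 < A) (hR : 0 < R) (hκ : 0 < κ) (hε : |ε| ≤ 1) (hβ : IsSource A L R β)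
include hG hγ hb hell hA hR hκ hε hβ

/-- On the diagonal `s = r` the weight `e^{-2κ r}` splits as `e^{-κ r} e^{-κ s}`. The first factor
pairs with the energy estimate for a frozen source; the second makes `s ↦ e^{-κ s} β(·, t + ε s)` a
curve of finite variation in `L²`. The constant does not depend on `t`, which allows integration
over time afterwards. -/
lemma norm_integral_potential_le : ∃ C, 0 ≤ C ∧ ∀ t, ∀ ψ : E → ℝ, ContDiff ℝ ∞ ψ →
    HasCompactSupport ψ → ‖∫ x, potential G (shift (2 * κ) ε t β) x • gradient ψ x‖
      ≤ C * (eLpNorm ψ 2).toReal := by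
  set c₁ := (eLpNorm (fun r => Real.exp (-(κ * r))) 2 (volume.restrict (Ioi 0))).toReal with hc₁
  have hL := hβ.lip_nonneg
  set q := (A + L * κ⁻¹) * ballSize R with hq
  have hq0 : 0 ≤ q := by have := ballSize_pos hR; positivity
  have hAq : A * ballSize R ≤ q := by
    have := (ballSize_pos hR).le
    rw [hq, add_mul]
    have : 0 ≤ L * κ⁻¹ * ballSize R := by positivity
    linarith
  refine ⟨c₁ * √γ * (2 * q), by positivity, fun t ψ hψ hc => ?_⟩
  set N := (eLpNorm ψ 2).toReal with hN
  set k := c₁ * √γ * N with hk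
  have hk0 : 0 ≤ k := by positivity
  set F : ℝ → E → ℝ := fun s z => Real.exp (-(κ * s)) * β (z, t + ε * s) with hF
  have hFm : ∀ s, Measurable (F s) := fun s => by
    have := hβ.measurable
    simp only [hF]
    fun_prop
  have hBm : MeasurableSet (Metric.closedBall (0 : E) R) :=
    Metric.isClosed_closedBall.measurableSet
  have hBf := volume_closedBall_ne_top 0 R
  have hFle : ∀ s ≥ 0, ∀ z, |F s z| ≤ A := fun s hs z => by
    rw [hF, abs_mul, Real.abs_exp]
    have h1 : Real.exp (-(κ * s)) ≤ 1 := Real.exp_le_one_iff.2 (by nlinarith)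
    have := mul_le_mul h1 (hβ.abs_le (z, t + ε * s)) (abs_nonneg _) zero_le_one
    linarith
  have hF0 : ∀ s z, z ∉ Metric.closedBall (0 : E) R → F s z = 0 := fun s z hz => by
    simp only [hF]; rw [hβ.eq_zero _ _ hz, mul_zero]
  have hF2 : ∀ s ≥ 0, MemLp (F s) 2 := fun s hs =>
    memLp_of_abs_le hA.le (hFm s) hBm hBf (hFle s hs) (hF0 s)
  have hFn : ∀ s ≥ 0, (eLpNorm (F s) 2).toReal ≤ q := fun s hs =>
    (ENNReal.toReal_le_of_le_ofReal (mul_nonneg hA.le (ballSize_pos hR).le)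
      (toReal_eLpNorm_le hA.le hBm hBf (hFle s hs) (hF0 s))).trans hAq
  set D : ℝ → ℝ → E → ℝ := fun s s' z => F s' z - F s z with hD
  have hDn : ∀ s ≥ 0, ∀ s' ≥ s, (eLpNorm (D s s') 2).toReal
      ≤ q * (Real.exp (-(κ * s)) - Real.exp (-(κ * s'))) := fun s hs s' hs' => by
    have h2 := (exp_diff_bounds hκ hs hs').2.1
    have hc0 : 0 ≤ (A + L * κ⁻¹) * (Real.exp (-(κ * s)) - Real.exp (-(κ * s'))) := by positivity
    refine (ENNReal.toReal_le_of_le_ofReal (mul_nonneg hc0 (ballSize_pos hR).le)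
      (toReal_eLpNorm_le hc0 hBm hBf (hβ.abs_weighted_sub_le hκ hε hs hs')
        fun z hz => ?_)).trans_eq (by rw [hq]; ring)
    exact (congrArg₂ (· - ·) (hF0 s' z hz) (hF0 s z hz)).trans (sub_zero 0)
  have hDm : ∀ s s', Measurable (D s s') := fun s s' => (hFm s').sub (hFm s)
  have hD2 : ∀ s ≥ 0, ∀ s' ≥ s, MemLp (D s s') 2 := fun s hs s' hs' =>
    (hF2 s' (hs.le.trans hs')).sub (hF2 s hs)
  set B : ℝ → ℝ → E := fun r s => Real.exp (-(κ * r)) • pairing G (F s) ψ r with hB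
  have hBsub : ∀ r > 0, ∀ s ≥ 0, ∀ s' ≥ s,
      B r s' - B r s = Real.exp (-(κ * r)) • pairing G (D s s') ψ r := fun r hr s hs s' hs' => by
    simp only [hB]
    rw [← smul_sub, ← pairing_sub hG hψ hc (hF2 s' (hs.le.trans hs')) (hF2 s hs) hr]
  have hdiag : ∀ r, B r r = pairing G (fun z => shift (2 * κ) ε t β (z, r)) ψ r := fun r => by
    simp only [hB]
    rw [← pairing_const_mul]
    congr 1
    funext z
    simp only [hF, shift]
    rw [← mul_assoc, ← Real.exp_add]
    ring_nf
  obtain ⟨hint, heq⟩ := (hβ.decays (κ := 2 * κ) (ε := ε) (t := t)).integral_potential_smul_gradient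
    hG hγ hb hell (mul_pos hA (ballSize_pos hR)) (by positivity : 0 < 2 * κ) hψ hc
  have hds : IntegrableOn (fun r => B r r) (Ioi 0) := by simpa only [hdiag] using hint
  rw [heq]
  simp_rw [← hdiag]
  refine le_of_tendsto (intervalIntegral_tendsto_integral_Ioi 0 hds tendsto_id).norm
    ((eventually_ge_atTop 0).mono fun S hS => ?_)
  have hsub : ∀ {f : ℝ → E}, IntegrableOn f (Ioi 0) → IntervalIntegrable f volume 0 S :=
    fun hf => (intervalIntegrable_iff_integrableOn_Ioc_of_le hS).2
      (hf.mono_set Ioc_subset_Ioi_self)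
  -- The value `K = k q` bounds the source frozen at `s = 0`, and the variation `V S - V 0` is again
  -- at most `k q`, whence the factor `2` in the constant.
  have main := norm_integral_diag_le (b := B) (V := fun s => -(k * q * Real.exp (-(κ * s))))
    (M := (eLpNorm (gradient ψ) 2).toReal * (q * κ)) (K := k * q) hS ?_ ?_ ?_ ?_ (hsub hds)
  · refine main.trans ?_
    have := Real.exp_pos (-(κ * S))
    simp only [mul_zero, neg_zero, Real.exp_zero, mul_one]
    have : 0 ≤ k * q * Real.exp (-(κ * S)) := by positivity
    rw [hk] at this ⊢
    linarith
  · intro r hr s hs s' _ hss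
    rw [hBsub r hr.1 s hs.1 s' hss, norm_smul, Real.norm_eq_abs, Real.abs_exp]
    have h1 : Real.exp (-(κ * r)) ≤ 1 :=
      Real.exp_le_one_iff.2 (by have := mul_pos hκ hr.1; linarith)
    have h2 := norm_pairing_le hG hγ hb hell hψ hc (hD2 s hs.1 s' hss) hr.1
    have h3 := (hDn s hs.1 s' hss).trans (mul_le_mul_of_nonneg_left
      (exp_diff_bounds hκ hs.1 hss).2.2 hq0)
    calc _ ≤ ‖pairing G (D s s') ψ r‖ := mul_le_of_le_one_left (norm_nonneg _) h1
      _ ≤ q * (κ * (s' - s)) * (eLpNorm (gradient ψ) 2).toReal := h2.trans (by gcongr)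
      _ = _ := by ring
  · intro ρ hρ s hs s' _ hss
    have e : ∫ r in ρ..S, (B r s' - B r s)
        = ∫ r in ρ..S, Real.exp (-(κ * r)) • pairing G (D s s') ψ r := by
      refine intervalIntegral.integral_congr_ae (ae_of_all _ fun r hr => ?_)
      rw [uIoc_of_le hρ.2] at hr
      exact hBsub r (hρ.1.trans_lt hr.1) s hs.1 s' hss
    rw [e]
    refine (norm_integral_pairing_le hG hγ hb hell hψ hc hκ (hD2 s hs.1 s' hss) (hDm s s') hρ.1
      hρ.2).trans ?_
    calc _ = k * (eLpNorm (D s s') 2).toReal := by rw [hk]; ring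
      _ ≤ k * (q * (Real.exp (-(κ * s)) - Real.exp (-(κ * s')))) := by
        gcongr
        exact hDn s hs.1 s' hss
      _ = _ := by ring
  · refine (norm_integral_pairing_le hG hγ hb hell hψ hc hκ (hF2 0 le_rfl) (hFm 0) le_rfl
      hS).trans ?_
    calc _ = k * (eLpNorm (F 0) 2).toReal := by rw [hk]; ring
      _ ≤ k * q := by
        gcongr
        exact hFn 0 le_rfl
  · intro s hs
    refine hsub ?_
    have hdec : Decays (A * ballSize R) κ fun p : E × ℝ => Real.exp (-(κ * p.2)) * F s p.1 :=
      decays_of_abs_le hA.le (by have := hFm s; fun_prop) hBm hBf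
        (fun z r _ => by
          rw [abs_mul, Real.abs_exp, mul_comm]
          exact mul_le_mul_of_nonneg_right (hFle s hs.1 z) (Real.exp_pos _).le)
        fun z r _ hz => by simp only [hF0 s z hz, mul_zero]
    have := (hdec.integral_potential_smul_gradient hG hγ hb hell
      (mul_pos hA (ballSize_pos hR)) hκ hψ hc).1
    simpa only [pairing_const_mul] using this

end IsSource

/-! ### Restriction and multiplication by functions of time -/

lemma IsWeakGrad.mono {Q Q' : Set (E × ℝ)} (hQ : MeasurableSet Q) (hQQ : Q' ⊆ Q)
    {u : E × ℝ → ℝ} {g : E × ℝ → E} (h : IsWeakGrad Q u g) : IsWeakGrad Q' u g := by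
  refine ⟨h.1.mono_measure (Measure.restrict_mono hQQ le_rfl),
    h.2.1.mono_measure (Measure.restrict_mono hQQ le_rfl), fun φ hφ => ?_⟩
  rw [← setIntegral_eq_of_subset_of_forall_sdiff_eq_zero hQ hQQ fun p hp => by
      rw [hφ.gradx_eq_zero_of_notMem hp.2, smul_zero],
    ← setIntegral_eq_of_subset_of_forall_sdiff_eq_zero hQ hQQ fun p hp => by
      rw [hφ.eq_zero_of_notMem hp.2, zero_smul]]
  exact h.2.2 φ (hφ.mono hQQ)

lemma MemH.mono {Q Q' : Set (E × ℝ)} (hQ : MeasurableSet Q) (hQQ : Q' ⊆ Q)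
    {u : E × ℝ → ℝ} (h : MemH Q u) : MemH Q' u :=
  ⟨_, h.isWeakGrad.mono hQ hQQ⟩

lemma MemEnergy.restrict {T : ℝ} {u : E × ℝ → ℝ} (h : MemEnergy univ T u) (Ω : Set E) :
    MemEnergy Ω T u := by
  refine ⟨h.1.mono (isOpen_cyl isOpen_univ T).measurableSet
    (prod_mono_left (subset_univ Ω)), fun t ht => ?_, fun t ht => ?_⟩
  · exact (h.2.1 t ht).mono_measure (Measure.restrict_mono (subset_univ Ω) le_rfl)
  · exact tendsto_of_tendsto_of_tendsto_of_le_of_le tendsto_const_nhds (h.2.2 t ht)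
      (fun _ => zero_le) fun s =>
        eLpNorm_mono_measure _ (Measure.restrict_mono (subset_univ Ω) le_rfl)

lemma eLpNorm_mul_sub_mul_le {α : Type*} [MeasurableSpace α] {μ : Measure α} {f g : α → ℝ}
    (hf : AEStronglyMeasurable f μ) (hg : AEStronglyMeasurable g μ) (c d : ℝ) :
    eLpNorm (fun x => c * f x - d * g x) 2 μ ≤ ENNReal.ofReal |c| * eLpNorm (fun x => f x - g x) 2 μ
      + ENNReal.ofReal |c - d| * eLpNorm g 2 μ := by
  have e : (fun x => c * f x - d * g x) = c • (f - g) + (c - d) • g := by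
    funext x
    simp only [Pi.add_apply, Pi.smul_apply, Pi.sub_apply, smul_eq_mul]
    ring
  rw [e, ← Real.enorm_eq_ofReal_abs, ← Real.enorm_eq_ofReal_abs]
  exact (eLpNorm_add_le ((hf.sub hg).const_smul c) (hg.const_smul (c - d)) (by norm_num)).trans
    (add_le_add eLpNorm_const_smul_le eLpNorm_const_smul_le)

lemma MemEnergy.timeMul {Ω : Set E} (hΩ : IsOpen Ω) {T : ℝ} {u : E × ℝ → ℝ}
    (h : MemEnergy Ω T u) {κ : ℝ → ℝ} (hκ : Continuous κ) :
    MemEnergy Ω T fun p => κ p.2 * u p := by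
  have hH : MemH (cyl Ω T) fun p => κ p.2 * u p := ⟨_, h.1.isWeakGrad.timeMul hΩ hκ⟩
  refine ⟨hH, fun t ht => (h.2.1 t ht).const_mul (κ t), fun t ht => ?_⟩
  have l1 : Tendsto (fun s => ENNReal.ofReal |κ s| *
      eLpNorm (fun x => u (x, s) - u (x, t)) 2 (volume.restrict Ω)) (𝓝[Icc 0 T] t) (𝓝 0) := by
    have h1 : Tendsto (fun s => ENNReal.ofReal |κ s|) (𝓝[Icc 0 T] t)
        (𝓝 (ENNReal.ofReal |κ t|)) :=
      ENNReal.tendsto_ofReal ((hκ.abs.tendsto t).mono_left nhdsWithin_le_nhds)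
    simpa using ENNReal.Tendsto.mul h1 (Or.inr (by simp)) (h.2.2 t ht)
      (Or.inr ENNReal.ofReal_ne_top)
  have l2 : Tendsto (fun s => ENNReal.ofReal |κ s - κ t| *
      eLpNorm (fun x => u (x, t)) 2 (volume.restrict Ω)) (𝓝[Icc 0 T] t) (𝓝 0) := by
    have h1 : Tendsto (fun s => ENNReal.ofReal |κ s - κ t|) (𝓝[Icc 0 T] t) (𝓝 0) := by
      have : Continuous fun s => |κ s - κ t| := by fun_prop
      have := ENNReal.tendsto_ofReal ((this.tendsto t).mono_left
        (nhdsWithin_le_nhds (s := Icc 0 T)))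
      simpa using this
    simpa using ENNReal.Tendsto.mul_const h1 (Or.inr (h.2.1 t ht).2.ne)
  have l3 := l1.add l2
  rw [add_zero] at l3
  refine tendsto_of_tendsto_of_tendsto_of_le_of_le' tendsto_const_nhds l3
    (Eventually.of_forall fun _ => zero_le) ?_
  filter_upwards [self_mem_nhdsWithin] with s hs
  exact eLpNorm_mul_sub_mul_le (h.2.1 s hs).1 (h.2.1 t ht).1 (κ s) (κ t)

lemma eLpNorm_cyl_sq {Ω : Set E} {T : ℝ} {F : Type*} [NormedAddCommGroup F] {u : E × ℝ → F}
    (hu : StronglyMeasurable u) : eLpNorm u 2 (volume.restrict (cyl Ω T)) ^ 2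
      = ∫⁻ t in Ioo 0 T, eLpNorm (fun x => u (x, t)) 2 (volume.restrict Ω) ^ 2 := by
  rw [eLpNorm_two_sq, volume_restrict_cyl, lintegral_prod_symm' _ (hu.enorm.pow_const 2)]
  simp_rw [eLpNorm_two_sq]

lemma Decays.mono {A A' κ : ℝ} {h : E × ℝ → ℝ} (hh : Decays A κ h) (hA : A ≤ A') :
    Decays A' κ h :=
  ⟨hh.measurable, fun r hr => (hh.le r hr).trans (ENNReal.ofReal_le_ofReal (by gcongr))⟩

/-! ### Potentials of Lipschitz sources belong to the energy class -/

namespace IsSource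

variable {A L R : ℝ} {β : E × ℝ → ℝ} {κ ε t : ℝ}
variable {b : E → Mat} {G : E → E → ℝ → ℝ} {γ : ℝ} (hG : IsFundamentalSolution b G) (hγ : 0 < γ)
  (hb : ∀ i j, Measurable fun x => b x i j) (hell : ∀ x, IsElliptic γ (b x))
  (hA : 0 < A) (hR : 0 < R) (hκ : 0 < κ) (hε : |ε| ≤ 1) (hβ : IsSource A L R β)
include hG hβ

lemma stronglyMeasurable_timePotential : StronglyMeasurable (timePotential G κ ε β) := by
  have h1 : Measurable fun q : ((E × ℝ) × ℝ) × E =>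
      G q.2 q.1.1.1 q.1.2 * shift κ ε q.1.1.2 β (q.2, q.1.2) := by
    refine (hG.measurable.comp (by fun_prop : Measurable fun q : ((E × ℝ) × ℝ) × E =>
      (q.2, q.1.1.1, q.1.2))).mul ?_
    have := hβ.measurable
    unfold shift
    fun_prop
  exact h1.stronglyMeasurable.integral_prod_right'.integral_prod_right'

include hγ hb hell hA hR hκ

lemma eLpNorm_timePotential_le (t : ℝ) : eLpNorm (fun x => timePotential G κ ε β (x, t)) 2
    ≤ ENNReal.ofReal (A * ballSize R / κ) := by
  have h := (hβ.decays (κ := κ) (ε := ε) (t := t)).eLpNorm_potential_le hG hγ hb hell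
    (mul_pos hA (ballSize_pos hR)) hκ
  exact h

/-- By linearity the difference is the potential of a source of amplitude `L |s - t|`. The constant
`L + 1` keeps the amplitude strictly positive when `L = 0`. -/
lemma eLpNorm_timePotential_sub_le (s t : ℝ) :
    eLpNorm (fun x => timePotential G κ ε β (x, s) - timePotential G κ ε β (x, t)) 2
      ≤ ENNReal.ofReal ((L + 1) * |s - t| * ballSize R / κ) := by
  rcases eq_or_ne s t with rfl | hst
  · simp
  have hpos : 0 < |s - t| := abs_pos.2 (sub_ne_zero.2 hst)
  have hv := ballSize_pos hR
  have hL := hβ.lip_nonneg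
  have hA' : 0 < A * ballSize R := mul_pos hA hv
  have e := eLpNorm_congr_ae (p := 2) ((hβ.decays (κ := κ) (ε := ε) (t := s)).potential_sub hG hγ
    hb hell hA' hκ hA' (hβ.decays (κ := κ) (ε := ε) (t := t)))
  refine (le_of_eq e).trans ?_
  refine ((hβ.decays_sub s t).mono ?_).eLpNorm_potential_le hG hγ hb hell (by positivity) hκ
  gcongr
  linarith

include hε

/-- Continuity in time comes from the Lipschitz dependence of the source on `t`, without using an
equation for the potential. The gradient comes from the duality criterion: the bound at fixed time
is uniform, and Cauchy–Schwarz over `(0, T)` integrates it. -/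
theorem memEnergy (T : ℝ) : MemEnergy univ T (timePotential G (2 * κ) ε β) := by
  have h2κ : 0 < 2 * κ := by positivity
  set V := timePotential G (2 * κ) ε β with hV
  have hVm : StronglyMeasurable V := hβ.stronglyMeasurable_timePotential hG
  have hle := hβ.eLpNorm_timePotential_le hG hγ hb hell hA hR h2κ (ε := ε)
  have hV2 : MemLp V 2 (volume.restrict (cyl univ T)) := by
    refine ⟨hVm.aestronglyMeasurable, ?_⟩
    refine ((ENNReal.pow_lt_top_iff (n := 2)).1 ?_).resolve_right two_ne_zero
    rw [eLpNorm_cyl_sq hVm]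
    refine (lintegral_mono (g := fun _ => ENNReal.ofReal (A * ballSize R / (2 * κ)) ^ 2)
      fun t => ?_).trans_lt ?_
    · simp only [Measure.restrict_univ]
      exact pow_le_pow_left' (hle t) 2
    · rw [lintegral_const]
      simp only [Measure.restrict_apply_univ, Real.volume_Ioo]
      finiteness
  refine ⟨?_, fun t _ => ?_, fun t _ => ?_⟩
  · obtain ⟨C, hC, hb'⟩ := hβ.norm_integral_potential_le hG hγ hb hell hA hR hκ hε
    set m := (volume : Measure ℝ).restrict (Ioo 0 T) with hm
    refine memH_of_norm_integral_le hV2 (C := (eLpNorm (fun _ => (1 : ℝ)) 2 m).toReal * C)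
      fun φ hφ => ?_
    have hi : Integrable (fun p => V p • gradx φ p) (volume.restrict (cyl univ T)) :=
      integrable_smul_of_memLp hV2 (hφ.memLp_gradx _)
    rw [integral_cyl hi]
    have him := integrableOn_integral_slice hi
    simp only [Measure.restrict_univ] at him ⊢
    set X : ℝ → E := fun t => ∫ x, V (x, t) • gradx φ (x, t) with hX
    have hX1 : ∀ t, ‖X t‖ₑ ≤ ENNReal.ofReal C * eLpNorm (fun x => φ (x, t)) 2 := by
      intro t
      have hs : ContDiff ℝ ∞ fun x => φ (x, t) := hφ.1.comp (contDiff_id.prodMk contDiff_const)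
      have hc : HasCompactSupport fun x => φ (x, t) :=
        HasCompactSupport.of_support_subset_isCompact (hφ.2.1.isCompact.image continuous_fst)
          fun x hx => ⟨(x, t), subset_tsupport φ hx, rfl⟩
      have h2 : MemLp (fun x => φ (x, t)) 2 := hs.continuous.memLp_of_hasCompactSupport hc
      have := hb' t _ hs hc
      rw [← ENNReal.ofReal_toReal h2.2.ne, ← ENNReal.ofReal_mul hC, ← ofReal_norm]
      exact ENNReal.ofReal_le_ofReal this
    have hX2 : eLpNorm X 2 m ≤ ENNReal.ofReal C * eLpNorm φ 2 (volume.restrict (cyl univ T)) := by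
      refine (ENNReal.pow_right_strictMono two_ne_zero).le_iff_le.1 ?_
      rw [mul_pow, eLpNorm_cyl_sq hφ.1.continuous.stronglyMeasurable, eLpNorm_two_sq,
        ← lintegral_const_mul' _ _ (by finiteness)]
      refine lintegral_mono fun t => ?_
      rw [← mul_pow, Measure.restrict_univ]
      exact pow_le_pow_left' (hX1 t) 2
    have hφ2 := hφ.memLp (cyl univ T)
    have hXm : MemLp X 2 m := ⟨him.1, hX2.trans_lt (by have := hφ2.2.ne; finiteness)⟩
    have h1 : MemLp (fun _ => (1 : ℝ)) 2 m := memLp_const 1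
    have := norm_integral_smul_le h1 hXm
    simp only [one_smul] at this
    refine this.trans ?_
    rw [mul_assoc]
    gcongr
    refine (ENNReal.toReal_mono (by have := hφ2.2.ne; finiteness) hX2).trans_eq ?_
    rw [ENNReal.toReal_mul, ENNReal.toReal_ofReal hC]
  · rw [Measure.restrict_univ]
    exact ⟨(hVm.comp_measurable (by fun_prop)).aestronglyMeasurable,
      (hle t).trans_lt ENNReal.ofReal_lt_top⟩
  · simp only [Measure.restrict_univ]
    have hl : Tendsto (fun s => ENNReal.ofReal ((L + 1) * |s - t| * ballSize R / (2 * κ)))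
        (𝓝[Icc 0 T] t) (𝓝 0) := by
      have hc : Continuous fun s => (L + 1) * |s - t| * ballSize R / (2 * κ) := by fun_prop
      have := ENNReal.tendsto_ofReal ((hc.tendsto t).mono_left
        (nhdsWithin_le_nhds (s := Icc 0 T)))
      simpa using this
    exact tendsto_of_tendsto_of_tendsto_of_le_of_le tendsto_const_nhds hl (fun _ => zero_le)
      fun s => hβ.eLpNorm_timePotential_sub_le hG hγ hb hell hA hR h2κ s t

end IsSource

/-! ### Bounds on a bounded domain -/

lemma volume_le_diam {Ω : Set E} (hΩ : Bornology.IsBounded Ω) :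
    volume Ω ≤ ENNReal.ofReal (4 * Real.pi / 3 * Metric.diam Ω ^ 3) := by
  rcases Ω.eq_empty_or_nonempty with rfl | ⟨x, hx⟩
  · simp
  have h1 : Ω ⊆ Metric.closedBall x (Metric.diam Ω) := fun y hy =>
    Metric.dist_le_diam_of_mem hΩ hy hx
  refine (measure_mono h1).trans_eq ?_
  rw [EuclideanSpace.volume_closedBall_fin_three, ← ENNReal.ofReal_pow Metric.diam_nonneg,
    ← ENNReal.ofReal_mul (by positivity)]
  ring_nf

lemma volume_closedBall_one (y : E) :
    (volume (Metric.closedBall y 1)).toReal = 4 * Real.pi / 3 := by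
  rw [EuclideanSpace.volume_closedBall_fin_three]
  simp only [ENNReal.ofReal_one, one_pow, one_mul]
  rw [ENNReal.toReal_ofReal (by positivity)]
  ring

section Bounded

variable {b : E → Mat} {G : E → E → ℝ → ℝ} {γ : ℝ}

/-- Sources supported in unit balls, whose centres may move with `r`, have `L²` norm at most `A
√(4π/3) e^{-κ r}`. Contraction in `L²` and in `L^∞`, with `κ ≥ 1`, bounds the integral by `(4π/3) A²
min(1, d³)`, where `d` is the diameter, and `min(1, d³) ≤ d`. -/
lemma integral_potential_sq_le (hG : IsFundamentalSolution b G) (hγ : 0 < γ)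
    (hb : ∀ i j, Measurable fun x => b x i j) (hell : ∀ x, IsElliptic γ (b x))
    {A κ : ℝ} (hA : 0 < A) (hκ : 1 ≤ κ) {h : E × ℝ → ℝ} (hm : Measurable h) (c : ℝ → E)
    (hle : ∀ z, ∀ r > 0, |h (z, r)| ≤ A * Real.exp (-(κ * r)))
    (h0 : ∀ z, ∀ r > 0, z ∉ Metric.closedBall (c r) 1 → h (z, r) = 0)
    {Ω : Set E} (hΩb : Bornology.IsBounded Ω) :
    ∫ x in Ω, potential G h x ^ 2 ≤ 4 * Real.pi / 3 * (A ^ 2 * Metric.diam Ω) := by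
  have hκ0 : 0 < κ := by linarith
  have hv : 0 < 4 * Real.pi / 3 := by positivity
  have hD : Decays (A * √(4 * Real.pi / 3)) κ h := by
    refine ⟨hm, fun r hr => ?_⟩
    rw [mul_right_comm, ← volume_closedBall_one (c r)]
    exact toReal_eLpNorm_le (by positivity) Metric.isClosed_closedBall.measurableSet
      (volume_closedBall_ne_top _ _) (fun z => hle z r hr) fun z hz => h0 z r hr hz
  have hA' : 0 < A * √(4 * Real.pi / 3) := by positivity
  have n2 := hD.eLpNorm_potential_le hG hγ hb hell hA' hκ0
  have ninf := hD.ae_abs_potential_le hG hγ hb hell hκ0 hA.le fun r hr z => hle z r hr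
  have hpm : StronglyMeasurable (potential G h) :=
    (stronglyMeasurable_kernel hG hm).integral_prod_right'
  have hp2 : MemLp (potential G h) 2 := ⟨hpm.aestronglyMeasurable, n2.trans_lt ENNReal.ofReal_lt_top⟩
  have hdiv : ∀ a : ℝ, 0 ≤ a → a / κ ≤ a := fun a ha => div_le_self ha hκ
  have b1 : ∫ x in Ω, potential G h x ^ 2 ≤ 4 * Real.pi / 3 * A ^ 2 := by
    refine (setIntegral_le_integral hp2.integrable_sq (ae_of_all _ fun x => by positivity)).trans ?_
    have e := integral_norm_sq hp2
    simp only [Real.norm_eq_abs, sq_abs] at e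
    rw [e]
    have h1 : (eLpNorm (potential G h) 2).toReal ≤ A * √(4 * Real.pi / 3) :=
      (ENNReal.toReal_le_of_le_ofReal (by positivity) n2).trans (hdiv _ hA'.le)
    refine (pow_le_pow_left₀ ENNReal.toReal_nonneg h1 2).trans_eq ?_
    rw [mul_pow, Real.sq_sqrt hv.le, mul_comm]
  have b2 : ∫ x in Ω, potential G h x ^ 2 ≤ 4 * Real.pi / 3 * (A ^ 2 * Metric.diam Ω ^ 3) := by
    have hvol := volume_le_diam hΩb
    have hfin : volume Ω ≠ ⊤ := ne_top_of_le_ne_top ENNReal.ofReal_ne_top hvol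
    have hae : ∀ᵐ x ∂(volume.restrict Ω), potential G h x ^ 2 ≤ A ^ 2 := by
      filter_upwards [ae_restrict_of_ae ninf] with x hx
      exact sq_le_sq' (by linarith [(abs_le.1 hx).1, hdiv A hA.le])
        (by linarith [(abs_le.1 hx).2, hdiv A hA.le])
    have hc : IntegrableOn (fun _ : E => A ^ 2) Ω := integrableOn_const hfin
    refine (integral_mono_ae (hp2.integrable_sq.mono_measure Measure.restrict_le_self) hc
      hae).trans ?_
    rw [setIntegral_const, smul_eq_mul, measureReal_def]
    have hd : 0 ≤ Metric.diam Ω := Metric.diam_nonneg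
    have := ENNReal.toReal_le_of_le_ofReal (by positivity) hvol
    calc _ ≤ 4 * Real.pi / 3 * Metric.diam Ω ^ 3 * A ^ 2 := by gcongr
      _ = _ := by ring
  have hd : 0 ≤ Metric.diam Ω := Metric.diam_nonneg
  rcases le_total 1 (Metric.diam Ω) with h1 | h1
  · refine b1.trans ?_
    gcongr
    exact le_mul_of_one_le_right (by positivity) h1
  · refine b2.trans ?_
    gcongr
    exact pow_le_of_le_one hd h1 (by norm_num)

end Bounded

/-! ### The special solutions -/

/-- The weighted source `e^{-τ μ |s - θ|} m_τ(z, s)`. -/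
def weightedSource (T : ℝ) (y : ℝ → E) (θ μ τ : ℝ) (q : E × ℝ) : ℝ :=
  Real.exp (-(τ * μ * |q.2 - θ|)) * mτ T y τ q.1 q.2

section Source

variable {T : ℝ} {y : ℝ → E} {θ μ τ : ℝ} {K : NNReal}

lemma M₀_eq {r : ℝ} (hr : 0 ≤ r) : M₀ r = max (1 - r) 0 := by
  rw [M₀, abs_of_nonneg hr]
  split_ifs with h
  · rw [abs_of_nonneg (by linarith), max_eq_left (by linarith)]
  · rw [max_eq_right (by linarith)]

lemma mτ_eq (hτ : 0 ≤ τ) (x : E) (t : ℝ) :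
    mτ T y τ x t = max (1 - τ * ‖x - extendCurve T y t‖) 0 :=
  M₀_eq (by positivity)

lemma abs_mτ_le (hτ : 0 ≤ τ) (x : E) (t : ℝ) : |mτ T y τ x t| ≤ 1 := by
  rw [mτ_eq hτ, abs_of_nonneg (le_max_right _ _)]
  refine max_le ?_ zero_le_one
  have : 0 ≤ τ * ‖x - extendCurve T y t‖ := by positivity
  linarith

lemma mτ_eq_zero (hτ : 1 ≤ τ) {x : E} {t : ℝ}
    (h : x ∉ Metric.closedBall (extendCurve T y t) 1) : mτ T y τ x t = 0 := by
  rw [mτ_eq (by linarith), max_eq_right]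
  rw [Metric.mem_closedBall, dist_eq_norm, not_le] at h
  nlinarith [norm_nonneg (x - extendCurve T y t)]

lemma abs_exp_neg_sub_le {a b : ℝ} (ha : 0 ≤ a) (hb : 0 ≤ b) :
    |Real.exp (-a) - Real.exp (-b)| ≤ |a - b| := by
  wlog h : a ≤ b generalizing a b
  · rw [abs_sub_comm, abs_sub_comm a]
    exact this hb ha (le_of_not_ge h)
  obtain ⟨-, h2, h3⟩ := exp_diff_bounds one_pos ha h
  simp only [one_mul] at h2 h3
  rw [abs_of_nonneg h2, abs_sub_comm, abs_of_nonneg (by linarith)]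
  exact h3

variable (hT : 0 ≤ T) (hy : LipschitzOnWith K y (Icc 0 T))
include hT hy

lemma lipschitzWith_extendCurve : LipschitzWith K (extendCurve T y) := by
  refine LipschitzWith.of_dist_le_mul fun s t => ?_
  have hcl : ∀ t : ℝ, max 0 (min t T) ∈ Icc 0 T := fun t =>
    ⟨le_max_left _ _, max_le hT (min_le_right _ _)⟩
  refine (hy.dist_le_mul _ (hcl s) _ (hcl t)).trans ?_
  gcongr
  have h := (((LipschitzWith.id (α := ℝ)).min_const T).const_max 0).dist_le_mul s t
  simpa using h

lemma norm_extendCurve_le (t : ℝ) : ‖extendCurve T y t‖ ≤ ‖y 0‖ + K * T := by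
  have h0 : (0 : ℝ) ∈ Icc 0 T := ⟨le_rfl, hT⟩
  have hcl : max 0 (min t T) ∈ Icc 0 T := ⟨le_max_left _ _, max_le hT (min_le_right _ _)⟩
  have h1 := hy.dist_le_mul _ hcl _ h0
  rw [dist_eq_norm, Real.dist_eq, sub_zero, abs_of_nonneg hcl.1] at h1
  have h2 : (K : ℝ) * max 0 (min t T) ≤ K * T := by
    gcongr
    exact hcl.2
  have h3 := norm_le_norm_add_norm_sub' (extendCurve T y t) (y 0)
  have h4 : ‖extendCurve T y t - y 0‖ ≤ K * T := h1.trans h2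
  linarith

lemma abs_mτ_sub_le (hτ : 0 ≤ τ) (x : E) (s t : ℝ) :
    |mτ T y τ x s - mτ T y τ x t| ≤ τ * K * |s - t| := by
  rw [mτ_eq hτ, mτ_eq hτ]
  refine (abs_max_sub_max_le_abs _ _ _).trans ?_
  have e : 1 - τ * ‖x - extendCurve T y s‖ - (1 - τ * ‖x - extendCurve T y t‖)
      = τ * (‖x - extendCurve T y t‖ - ‖x - extendCurve T y s‖) := by ring
  rw [e, abs_mul, abs_of_nonneg hτ, mul_assoc]
  refine mul_le_mul_of_nonneg_left ((abs_norm_sub_norm_le _ _).trans ?_) hτ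
  have h := (lipschitzWith_extendCurve hT hy).dist_le_mul s t
  rw [dist_eq_norm, Real.dist_eq] at h
  refine le_trans (le_of_eq ?_) h
  congr 1
  abel

lemma measurable_mτ (hτ : 0 ≤ τ) : Measurable fun q : E × ℝ => mτ T y τ q.1 q.2 := by
  simp_rw [mτ_eq hτ]
  have := (lipschitzWith_extendCurve hT hy).continuous
  fun_prop

lemma eq_zero_of_notMem_closedBall (hτ : 1 ≤ τ) {x : E} (t : ℝ)
    (hx : x ∉ Metric.closedBall (0 : E) (‖y 0‖ + K * T + 1)) : mτ T y τ x t = 0 := by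
  refine mτ_eq_zero hτ fun h => hx ?_
  rw [mem_closedBall_zero_iff]
  rw [Metric.mem_closedBall, dist_eq_norm] at h
  have h1 := norm_extendCurve_le hT hy t
  have h2 := norm_le_norm_add_norm_sub' x (extendCurve T y t)
  linarith

lemma isSource_mτ (hτ : 1 ≤ τ) :
    IsSource 1 (τ * K) (‖y 0‖ + K * T + 1) fun q => mτ T y τ q.1 q.2 where
  measurable := measurable_mτ hT hy (by linarith)
  abs_le q := abs_mτ_le (by linarith) _ _
  eq_zero z s hz := eq_zero_of_notMem_closedBall hT hy hτ s hz
  lipschitz z s t := abs_mτ_sub_le hT hy (by linarith) z s t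

lemma isSource_weightedSource (hτ : 1 ≤ τ) (hμ : 0 ≤ μ) :
    IsSource 1 (τ * μ + τ * K) (‖y 0‖ + K * T + 1) (weightedSource T y θ μ τ) where
  measurable := by
    have := measurable_mτ hT hy (τ := τ) (by linarith)
    unfold weightedSource
    fun_prop
  abs_le q := by
    rw [weightedSource, abs_mul, Real.abs_exp]
    refine mul_le_one₀ (Real.exp_le_one_iff.2 ?_) (abs_nonneg _) (abs_mτ_le (by linarith) _ _)
    have : 0 ≤ τ * μ * |q.2 - θ| := by positivity
    linarith
  eq_zero z s hz := by
    simp only [weightedSource, eq_zero_of_notMem_closedBall hT hy hτ s hz, mul_zero]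
  lipschitz z s t := by
    have e : weightedSource T y θ μ τ (z, s) - weightedSource T y θ μ τ (z, t)
        = Real.exp (-(τ * μ * |s - θ|)) * (mτ T y τ z s - mτ T y τ z t)
          + (Real.exp (-(τ * μ * |s - θ|)) - Real.exp (-(τ * μ * |t - θ|))) * mτ T y τ z t := by
      simp only [weightedSource]
      ring
    have hτμ : 0 ≤ τ * μ := by positivity
    have a1 : Real.exp (-(τ * μ * |s - θ|)) ≤ 1 := Real.exp_le_one_iff.2 (by
      have : 0 ≤ τ * μ * |s - θ| := by positivity
      linarith)
    have a2 : |Real.exp (-(τ * μ * |s - θ|)) - Real.exp (-(τ * μ * |t - θ|))|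
        ≤ τ * μ * |s - t| := by
      refine (abs_exp_neg_sub_le (by positivity) (by positivity)).trans ?_
      rw [← mul_sub, abs_mul, abs_of_nonneg hτμ]
      refine mul_le_mul_of_nonneg_left ((abs_abs_sub_abs_le _ _).trans_eq ?_) hτμ
      rw [sub_sub_sub_cancel_right]
    have a3 := abs_mτ_sub_le hT hy (by linarith : 0 ≤ τ) z s t
    have a4 := abs_mτ_le (T := T) (y := y) (by linarith : 0 ≤ τ) z t
    rw [e]
    refine (abs_add_le _ _).trans ?_
    rw [abs_mul, abs_mul, Real.abs_exp]
    have b1 := mul_le_mul a1 a3 (abs_nonneg _) zero_le_one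
    have b2 := mul_le_mul a2 a4 (abs_nonneg _) (by positivity)
    linarith

end Source

section Identification

variable {b : E → Mat} {G : E → E → ℝ → ℝ} (hG : IsFundamentalSolution b G)
  (T : ℝ) (y : ℝ → E) (θ μ τ : ℝ)

include hG in
lemma integral_causal (F : E → ℝ → ℝ) (x : E) :
    ∫ r, ∫ z, F z r * G z x r = ∫ r in Ioi (0 : ℝ), ∫ z, F z r * G z x r := by
  refine (setIntegral_eq_integral_of_ae_compl_eq_zero ?_).symm
  -- Causality says nothing at `r = 0`, which is a null set.
  have h0 : ∀ᵐ r : ℝ, r ≠ 0 := by simp [ae_iff]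
  filter_upwards [h0] with r hr hr'
  have hlt : r < 0 := lt_of_le_of_ne (not_lt.1 hr') hr
  simp [hG.causal _ _ _ hlt]

include hG in
-- The substitution `s = t - r` splits `e^{τ²(s+T)}` into the weight `e^{τ²(T+t)}` and the decaying
-- factor `e^{-τ² r}`. The remaining potential looks into the past, `ε = -1`; for `u_τ^*` it looks
-- into the future, `ε = 1`.
lemma uτ_eq (p : E × ℝ) : uτ G T y θ μ τ p = Real.exp (τ ^ 2 * (T + p.2)) *
    timePotential G (τ ^ 2) (-1) (weightedSource T y θ μ τ) p := by
  rw [uτ, ← integral_sub_left_eq_self _ volume p.2]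
  simp only [sub_sub_cancel]
  rw [integral_causal hG (fun z r => Real.exp (τ ^ 2 * (p.2 - r + T)) *
    Real.exp (-(τ * μ * |p.2 - r - θ|)) * mτ T y τ z (p.2 - r)), timePotential, potential,
    ← integral_const_mul]
  refine integral_congr_ae (ae_of_all _ fun r => ?_)
  simp only [← integral_const_mul]
  refine integral_congr_ae (ae_of_all _ fun z => ?_)
  simp only [shift, weightedSource]
  have e : Real.exp (τ ^ 2 * (p.2 - r + T))
      = Real.exp (τ ^ 2 * (T + p.2)) * Real.exp (-(τ ^ 2 * r)) := by
    rw [← Real.exp_add]; ring_nf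
  rw [e, show p.2 + -1 * r = p.2 - r by ring]
  ring

include hG in
lemma uτs_eq (p : E × ℝ) : uτs G T y θ μ τ p = Real.exp (-(τ ^ 2 * (T + p.2))) *
    timePotential G (τ ^ 2) 1 (weightedSource T y θ μ τ) p := by
  rw [uτs, ← integral_add_left_eq_self _ p.2]
  simp only [add_sub_cancel_left]
  rw [integral_causal hG (fun z r => Real.exp (-(τ ^ 2 * (T + (p.2 + r)))) *
    Real.exp (-(τ * μ * |p.2 + r - θ|)) * mτ T y τ z (p.2 + r)), timePotential, potential,
    ← integral_const_mul]
  refine integral_congr_ae (ae_of_all _ fun r => ?_)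
  simp only [← integral_const_mul]
  refine integral_congr_ae (ae_of_all _ fun z => ?_)
  simp only [shift, weightedSource]
  have e : Real.exp (-(τ ^ 2 * (T + (p.2 + r))))
      = Real.exp (-(τ ^ 2 * (T + p.2))) * Real.exp (-(τ ^ 2 * r)) := by
    rw [← Real.exp_add]; ring_nf
  rw [e, one_mul]
  ring

lemma Pτ_eq (p : E × ℝ) : Pτ G T y τ p
    = timePotential G (τ ^ 2) 0 (fun q => mτ T y τ q.1 q.2) p := by
  rw [Pτ, timePotential, potential]
  refine integral_congr_ae (ae_of_all _ fun r => ?_)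
  refine integral_congr_ae (ae_of_all _ fun z => ?_)
  simp only [shift, zero_mul, add_zero]
  ring

end Identification

section Special

variable {b : E → Mat} {G : E → E → ℝ → ℝ} {γ : ℝ} (hG : IsFundamentalSolution b G) (hγ : 0 < γ)
  (hb : ∀ i j, Measurable fun x => b x i j) (hell : ∀ x, IsElliptic γ (b x))
  {T : ℝ} (hT : 0 < T) {y : ℝ → E} {K : NNReal} (hy : LipschitzOnWith K y (Icc 0 T))
  {θ μ τ : ℝ} (hμ : 0 < μ) (hτ : μ + 1 < τ)
include hG hγ hb hell hT hy hμ hτ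

lemma memEnergy_timePotential {ε : ℝ} (hε : |ε| ≤ 1) :
    MemEnergy univ T (timePotential G (τ ^ 2) ε (weightedSource T y θ μ τ)) := by
  have hK : 0 ≤ (K : ℝ) * T := by positivity
  -- The choice `κ = τ² / 2` matches the decay rate `2 κ` in `memEnergy`.
  have := (isSource_weightedSource (θ := θ) hT.le hy (by linarith : 1 ≤ τ) hμ.le).memEnergy hG hγ hb
    hell one_pos (by positivity) (κ := τ ^ 2 / 2) (by have : 0 < τ := by linarith
                                                      positivity) hε T
  rwa [mul_div_cancel₀ _ (two_ne_zero' ℝ)] at this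

omit hμ in
lemma memEnergy_Pτ (hμ : 0 ≤ μ) : MemEnergy univ T (Pτ G T y τ) := by
  have hK : 0 ≤ (K : ℝ) * T := by positivity
  have := (isSource_mτ hT.le hy (by linarith : 1 ≤ τ)).memEnergy hG hγ hb
    hell one_pos (by positivity) (κ := τ ^ 2 / 2) (by have : 0 < τ := by linarith
                                                      positivity) (ε := 0) (by simp) T
  rw [mul_div_cancel₀ _ (two_ne_zero' ℝ)] at this
  rwa [← funext (Pτ_eq T y τ)] at this

variable {Ω : Set E} (hΩ : Bornology.IsBounded Ω)
include hΩ

/-- At `t = 0` the potential only sees source times `s = -r ≤ 0`, where `|s - θ| ≥ θ`. -/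
lemma integral_timePotential_zero_sq_le :
    ∫ x in Ω, timePotential G (τ ^ 2) (-1) (weightedSource T y θ μ τ) (x, 0) ^ 2
      ≤ 4 * Real.pi / 3 * (Real.exp (-(τ * μ * θ)) ^ 2 * Metric.diam Ω) := by
  suffices H : ∀ t, t = 0 →
      ∫ x in Ω, timePotential G (τ ^ 2) (-1) (weightedSource T y θ μ τ) (x, t) ^ 2
        ≤ 4 * Real.pi / 3 * (Real.exp (-(τ * μ * θ)) ^ 2 * Metric.diam Ω) from H 0 rfl
  intro t ht
  have hτ1 : 1 ≤ τ := by linarith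
  have hτμ : 0 < τ * μ := by have : 0 < τ := by linarith
                             positivity
  have hs := isSource_weightedSource (θ := θ) hT.le hy hτ1 hμ.le
  refine integral_potential_sq_le hG hγ hb hell (Real.exp_pos _) (by nlinarith : 1 ≤ τ ^ 2)
    hs.measurable_shift (fun r => extendCurve T y (t + -1 * r)) (fun z r hr => ?_)
    (fun z r hr hz => ?_) hΩ
  · rw [shift, weightedSource, abs_mul, abs_mul, Real.abs_exp, Real.abs_exp, mul_comm]
    refine mul_le_mul_of_nonneg_right ?_ (Real.exp_pos _).le
    refine (mul_le_of_le_one_right (Real.exp_pos _).le (abs_mτ_le (by linarith) _ _)).trans ?_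
    refine Real.exp_le_exp.2 (neg_le_neg (mul_le_mul_of_nonneg_left ?_ hτμ.le))
    refine le_trans ?_ (neg_le_abs _)
    simp only
    linarith
  · simp only [shift, weightedSource, mτ_eq_zero hτ1 hz, mul_zero]

/-- At `t = T` the adjoint potential only sees source times `s = T + r ≥ T`, where `|s - θ| ≥ T -
θ`. -/
lemma integral_timePotential_final_sq_le :
    ∫ x in Ω, timePotential G (τ ^ 2) 1 (weightedSource T y θ μ τ) (x, T) ^ 2
      ≤ 4 * Real.pi / 3 * (Real.exp (-(τ * μ * (T - θ))) ^ 2 * Metric.diam Ω) := by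
  have hτ1 : 1 ≤ τ := by linarith
  have hτμ : 0 < τ * μ := by have : 0 < τ := by linarith
                             positivity
  have hs := isSource_weightedSource (θ := θ) hT.le hy hτ1 hμ.le
  refine integral_potential_sq_le hG hγ hb hell (Real.exp_pos _) (by nlinarith : 1 ≤ τ ^ 2)
    hs.measurable_shift (fun r => extendCurve T y (T + 1 * r)) (fun z r hr => ?_)
    (fun z r hr hz => ?_) hΩ
  · rw [shift, weightedSource, abs_mul, abs_mul, Real.abs_exp, Real.abs_exp, mul_comm]
    refine mul_le_mul_of_nonneg_right ?_ (Real.exp_pos _).le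
    refine (mul_le_of_le_one_right (Real.exp_pos _).le (abs_mτ_le (by linarith) _ _)).trans ?_
    refine Real.exp_le_exp.2 (neg_le_neg (mul_le_mul_of_nonneg_left ?_ hτμ.le))
    refine le_trans ?_ (le_abs_self _)
    simp only
    linarith
  · simp only [shift, weightedSource, mτ_eq_zero hτ1 hz, mul_zero]

/-- Here the potential looks forward across the time `θ`, where the source is not small. Smallness
comes from the decay instead: `|r - θ| ≥ θ - r` gives `e^{-τ² r} e^{-τμ|r-θ|} ≤ e^{-τμθ} e^{-(τ² -
τμ) r}`. The remaining rate `τ(τ - μ)` is at least `1` because `τ > μ + 1`. -/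
lemma integral_timePotential_adjoint_zero_sq_le :
    ∫ x in Ω, timePotential G (τ ^ 2) 1 (weightedSource T y θ μ τ) (x, 0) ^ 2
      ≤ 4 * Real.pi / 3 * (Real.exp (-(τ * μ * θ)) ^ 2 * Metric.diam Ω) := by
  suffices H : ∀ t, t = 0 →
      ∫ x in Ω, timePotential G (τ ^ 2) 1 (weightedSource T y θ μ τ) (x, t) ^ 2
        ≤ 4 * Real.pi / 3 * (Real.exp (-(τ * μ * θ)) ^ 2 * Metric.diam Ω) from H 0 rfl
  intro t ht
  have hτ1 : 1 ≤ τ := by linarith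
  have hτμ : 0 < τ * μ := by have : 0 < τ := by linarith
                             positivity
  have hs := isSource_weightedSource (θ := θ) hT.le hy hτ1 hμ.le
  refine integral_potential_sq_le hG hγ hb hell (Real.exp_pos _)
    (by nlinarith : 1 ≤ τ ^ 2 - τ * μ)
    hs.measurable_shift (fun r => extendCurve T y (t + 1 * r)) (fun z r hr => ?_)
    (fun z r hr hz => ?_) hΩ
  · rw [shift, weightedSource, abs_mul, abs_mul, Real.abs_exp, Real.abs_exp, ← mul_assoc,
      ← Real.exp_add, ← Real.exp_add]
    refine (mul_le_of_le_one_right (Real.exp_pos _).le (abs_mτ_le (by linarith) _ _)).trans ?_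
    refine Real.exp_le_exp.2 ?_
    simp only
    have h1 : θ - r ≤ |t + 1 * r - θ| := by
      refine le_trans (le_of_eq ?_) (neg_le_abs _)
      rw [ht]
      ring
    have := mul_le_mul_of_nonneg_left h1 hτμ.le
    nlinarith
  · simp only [shift, weightedSource, mτ_eq_zero hτ1 hz, mul_zero]

end Special

/-! ### The energy inequality for the perturbed solution -/

lemma MemEnergy.sub {Ω : Set E} {T : ℝ} {u v : E × ℝ → ℝ} (h : MemEnergy Ω T u)
    (h' : MemEnergy Ω T v) : MemEnergy Ω T fun p => u p - v p := by
  have hH : MemH (cyl Ω T) fun p => u p - v p := ⟨_, h.1.isWeakGrad.sub h'.1.isWeakGrad⟩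
  refine ⟨hH, fun t ht => (h.2.1 t ht).sub (h'.2.1 t ht), fun t ht => ?_⟩
  have hs := (h.2.2 t ht).add (h'.2.2 t ht)
  rw [add_zero] at hs
  refine tendsto_of_tendsto_of_tendsto_of_le_of_le' tendsto_const_nhds hs
    (Eventually.of_forall fun _ => zero_le) ?_
  filter_upwards [self_mem_nhdsWithin] with s hs
  have := eLpNorm_sub_le (p := 2) ((h.2.1 s hs).1.sub (h.2.1 t ht).1)
    ((h'.2.1 s hs).1.sub (h'.2.1 t ht).1) (by norm_num)
  refine le_trans (le_of_eq ?_) this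
  congr 1
  funext x
  simp only [Pi.sub_apply]
  ring

section Perturbed

variable {Ω : Set E} {T : ℝ} {a : E × ℝ → Mat} {b : E → Mat} {γ lam : ℝ}
  {u us v : E × ℝ → ℝ} {v₀ : E → ℝ}

/-- The weight `e^{-λ (T + t)}`. -/
def weight (lam T t : ℝ) : ℝ := Real.exp (-(lam * (T + t)))

lemma contDiff_weight (lam T : ℝ) : ContDiff ℝ ∞ (weight lam T) := by
  unfold weight
  fun_prop

lemma deriv_weight (lam T t : ℝ) : deriv (weight lam T) t = -(lam * weight lam T t) := by
  have h : HasDerivAt (weight lam T) (Real.exp (-(lam * (T + t))) * -(lam * 1)) t :=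
    (((hasDerivAt_id t).const_add T).const_mul lam).neg.exp
  rw [h.deriv, weight]
  ring

lemma weight_pos (lam T t : ℝ) : 0 < weight lam T t := Real.exp_pos _

lemma weight_le_one (hlam : 0 ≤ lam) {t : ℝ} (hT : 0 ≤ T) (ht : 0 ≤ t) : weight lam T t ≤ 1 := by
  refine Real.exp_le_one_iff.2 ?_
  have := mul_nonneg hlam (add_nonneg hT ht)
  linarith

lemma eLpNorm_weight_le {F : Type*} [NormedAddCommGroup F] [NormedSpace ℝ F] (hΩ : IsOpen Ω)
    (hlam : 0 ≤ lam) (hT : 0 ≤ T) (f : E × ℝ → F) :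
    eLpNorm (fun p => weight lam T p.2 • f p) 2 (volume.restrict (cyl Ω T))
      ≤ eLpNorm f 2 (volume.restrict (cyl Ω T)) := by
  refine eLpNorm_mono_ae ?_
  rw [ae_restrict_iff' (isOpen_cyl hΩ T).measurableSet]
  refine ae_of_all _ fun p hp => ?_
  rw [norm_smul, Real.norm_of_nonneg (weight_pos _ _ _).le]
  exact mul_le_of_le_one_left (norm_nonneg _) (weight_le_one hlam hT hp.2.1.le)

variable (hΩ : IsOpen Ω) (hT : 0 < T) (hγ : 0 < γ)
  (hb_meas : ∀ i j, Measurable fun x => b x i j) (hb_ell : ∀ x ∈ Ω, IsElliptic γ (b x))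
  (ha_meas : ∀ i j, Measurable fun p => a p i j)
  (ha_ell : ∀ p ∈ Ω ×ˢ Icc 0 T, IsElliptic γ (a p))

include hΩ hγ in
omit hT in
lemma memLp_app_cyl (ha_meas : ∀ i j, Measurable fun p => a p i j)
    (ha_ell : ∀ p ∈ Ω ×ˢ Icc 0 T, IsElliptic γ (a p)) {f : E × ℝ → E}
    (hf : MemLp f 2 (volume.restrict (cyl Ω T))) :
    MemLp (fun p => app (a p) (f p)) 2 (volume.restrict (cyl Ω T)) := by
  refine memLp_app hγ (fun i j => (ha_meas i j).aestronglyMeasurable) ?_ hf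
  rw [ae_restrict_iff' (isOpen_cyl hΩ T).measurableSet]
  exact ae_of_all _ fun p hp => ha_ell p ⟨hp.1, Ioo_subset_Icc_self hp.2⟩

include hΩ hT hγ hb_meas hb_ell ha_meas ha_ell

/-- The weight is smooth, so it may be moved onto test functions. Its derivative `-λ ρ` creates the
zero-order term `λ ρ w`. -/
lemma IsPerturbedSolution.exists_isDivSolution (hv : IsPerturbedSolution Ω T a b u v₀ v)
    (hu : MemEnergy Ω T u) (lam : ℝ) :
    ∃ W, IsDivSolution Ω T (fun p => weight lam T p.2 * (v p - u p))
      (fun p => weight lam T p.2 • (app (a p) (wgrad (cyl Ω T) v p)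
        - app (b p.1) (wgrad (cyl Ω T) u p)))
      (fun p => lam * (weight lam T p.2 * (v p - u p))) W := by
  set ρ := weight lam T with hρ
  have hρs : ContDiff ℝ ∞ ρ := contDiff_weight lam T
  have hw : MemEnergy Ω T fun p => ρ p.2 * (v p - u p) :=
    (hv.energy.sub hu).timeMul hΩ hρs.continuous
  obtain ⟨W, h1, h2, h3⟩ := hw.exists_curve hT.le
  have hva := hv.energy.1.isWeakGrad
  have hua := hu.1.isWeakGrad
  have hav := memLp_app_cyl hΩ hγ ha_meas ha_ell hva.2.1
  have hbu := memLp_app_cyl (a := fun p => b p.1) hΩ hγ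
    (fun i j => (hb_meas i j).comp measurable_fst) (fun p hp => hb_ell p.1 hp.1) hua.2.1
  have hw2 : MemLp (fun p => ρ p.2 * (v p - u p)) 2 (volume.restrict (cyl Ω T)) :=
    hw.1.isWeakGrad.1
  have hF := memLp_timeMul hΩ hρs.continuous (hav.sub hbu)
  refine ⟨W, h1, h2, h3, hw2, hF, hw2.const_mul lam, fun φ hφ => ?_⟩
  have hφ' : IsTest (cyl Ω T) fun p => ρ p.2 * φ p := hφ.mul_left (contDiff_comp_snd hρs)
  have e := hv.equation _ hφ'
  rw [heatOp, heatOp, ← sub_eq_zero] at e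
  have iv : ∀ {w : E × ℝ → ℝ} {X : E × ℝ → E}, MemLp w 2 (volume.restrict (cyl Ω T)) →
      MemLp X 2 (volume.restrict (cyl Ω T)) →
      Integrable (fun p => -(w p * dt (fun p => ρ p.2 * φ p) p)
        + inner ℝ (X p) (gradx (fun p => ρ p.2 * φ p) p)) (volume.restrict (cyl Ω T)) :=
    fun hw hX => (integrable_smul_of_memLp hw (hφ'.memLp_dt _)).neg.add
      (integrable_inner_of_memLp hX (hφ'.memLp_gradx _))
  rw [← integral_sub (iv hva.1 hav) (iv hua.1 hbu)] at e
  rw [← e]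
  refine integral_congr_ae (ae_of_all _ fun p => ?_)
  have hd : deriv ρ p.2 = -(lam * ρ p.2) := deriv_weight lam T p.2
  simp only [dt_timeMul hρs hφ.1, gradx_timeMul hρs hφ.1, inner_smul_left, inner_smul_right,
    inner_sub_left, RCLike.conj_to_real, hd]
  ring

/-- The lateral condition supplies test functions converging to `w` together with their gradients,
so no trace theory enters. The flux `ρ (a ∇v - b ∇u)` equals `a k + (a - b) g`, and the zero-order
contribution `λ ∫ (ρ w)²` is dropped by its sign. -/
lemma IsPerturbedSolution.energy_le (hv : IsPerturbedSolution Ω T a b u v₀ v)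
    (hu : MemEnergy Ω T u) (hlam : 0 ≤ lam) {k g : E × ℝ → E}
    (hk : ∀ p, k p = weight lam T p.2 • (wgrad (cyl Ω T) v p - wgrad (cyl Ω T) u p))
    (hg : ∀ p, g p = weight lam T p.2 • wgrad (cyl Ω T) u p) :
    ∫ p in cyl Ω T, (inner ℝ (app (a p) (k p)) (k p) + inner ℝ (app (a p - b p.1) (g p)) (k p))
      ≤ (∫ x in Ω, (weight lam T 0 * (v (x, 0) - u (x, 0))) ^ 2) / 2
        - (∫ x in Ω, (weight lam T T * (v (x, T) - u (x, T))) ^ 2) / 2 := by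
  obtain ⟨W, hW⟩ := hv.exists_isDivSolution hΩ hT hγ hb_meas hb_ell ha_meas ha_ell hu lam
  set ρ := weight lam T with hρ
  have hρs : ContDiff ℝ ∞ ρ := contDiff_weight lam T
  have hQ := isOpen_cyl hΩ T
  have hva := hv.energy.1.isWeakGrad
  have hua := hu.1.isWeakGrad
  have hk2 : MemLp k 2 (volume.restrict (cyl Ω T)) :=
    (memLp_timeMul hΩ hρs.continuous (hva.2.1.sub hua.2.1)).ae_eq
      (ae_of_all _ fun p => (hk p).symm)
  obtain ⟨hwH, φ, hφ, hlim, hlimG⟩ := hv.lateral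
  have hwg : wgrad (cyl Ω T) (fun p => v p - u p) =ᵐ[volume.restrict (cyl Ω T)]
      fun p => wgrad (cyl Ω T) v p - wgrad (cyl Ω T) u p :=
    IsWeakGrad.wgrad_ae_eq hQ (hva.sub hua)
  have t1 : Tendsto (fun n => eLpNorm (fun p => ρ p.2 * φ n p - id (ρ p.2 * (v p - u p))) 2
      (volume.restrict (cyl Ω T))) atTop (𝓝 0) := by
    refine tendsto_of_tendsto_of_tendsto_of_le_of_le tendsto_const_nhds hlim
      (fun _ => zero_le) fun n => ?_
    refine le_trans (le_of_eq ?_) (eLpNorm_weight_le hΩ hlam hT.le fun p => φ n p - (v p - u p))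
    congr 1
    funext p
    simp only [id, smul_eq_mul]
    ring
  have t2 : Tendsto (fun n => eLpNorm (fun p => gradx (fun p => ρ p.2 * φ n p) p - k p) 2
      (volume.restrict (cyl Ω T))) atTop (𝓝 0) := by
    refine tendsto_of_tendsto_of_tendsto_of_le_of_le tendsto_const_nhds hlimG
      (fun _ => zero_le) fun n => ?_
    refine le_trans (le_of_eq (eLpNorm_congr_ae ?_)) (eLpNorm_weight_le hΩ hlam hT.le
      fun p => gradx (φ n) p - wgrad (cyl Ω T) (fun p => v p - u p) p)
    filter_upwards [hwg] with p hp
    rw [gradx_timeMul hρs (hφ n).1, hk, hp, ← smul_sub]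
  have main := hW.energy_le hΩ hT isConvexPair_sq hk2
    (fun n => (hφ n).mul_left (contDiff_comp_snd hρs)) t1 t2
  rw [integral_div, integral_div] at main
  have hF2 := hW.flux
  have hmono : ∫ p in cyl Ω T, (inner ℝ (app (a p) (k p)) (k p)
      + inner ℝ (app (a p - b p.1) (g p)) (k p))
      ≤ ∫ p in cyl Ω T, (inner ℝ (ρ p.2 • (app (a p) (wgrad (cyl Ω T) v p)
        - app (b p.1) (wgrad (cyl Ω T) u p))) (k p)
          + lam * (ρ p.2 * (v p - u p)) * id (ρ p.2 * (v p - u p))) := by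
    have e : ∀ p, inner ℝ (app (a p) (k p)) (k p) + inner ℝ (app (a p - b p.1) (g p)) (k p)
        = inner ℝ (ρ p.2 • (app (a p) (wgrad (cyl Ω T) v p)
          - app (b p.1) (wgrad (cyl Ω T) u p))) (k p) := fun p => by
      rw [← inner_add_left]
      congr 1
      rw [hk, hg, sub_app, app_smul, app_smul, app_smul, app_sub, smul_sub, smul_sub]
      abel
    have hi := integrable_inner_of_memLp hF2 hk2
    have hs : Integrable (fun p => lam * (ρ p.2 * (v p - u p)) * id (ρ p.2 * (v p - u p)))
        (volume.restrict (cyl Ω T)) := integrable_smul_of_memLp hW.source hW.memLp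
    refine integral_mono (hi.congr (ae_of_all _ fun p => (e p).symm)) (hi.add hs) fun p => ?_
    simp only [e, id]
    have : 0 ≤ lam * ((ρ p.2 * (v p - u p)) * (ρ p.2 * (v p - u p))) :=
      mul_nonneg hlam (mul_self_nonneg _)
    nlinarith
  linarith

end Perturbed

/-! ### Bounds on the indicator function -/

lemma zero_app (ξ : E) : app 0 ξ = 0 := by simp [app]

section Indicator

variable {Ω : Set E} {T : ℝ} {D : Set (E × ℝ)} {a : E × ℝ → Mat} {b : E → Mat} {γ lam : ℝ}
  {u us v : E × ℝ → ℝ} {v₀ : E → ℝ}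

/-- The set `D` may contain points with `t = 0` or `t = T`, whereas the cylinder is open in time;
these times form a null set. -/
lemma ae_eq_inter_cyl (hD : D ⊆ Ω ×ˢ Icc 0 T) :
    (D : Set (E × ℝ)) =ᵐ[volume] (D ∩ cyl Ω T : Set (E × ℝ)) := by
  have h0 : volume ((univ : Set E) ×ˢ ({0, T} : Set ℝ)) = 0 := by
    rw [Measure.volume_eq_prod, Measure.prod_prod]
    simp [(Set.toFinite ({0, T} : Set ℝ)).measure_zero]
  refine (ae_eq_set.2 ⟨measure_mono_null ?_ h0, ?_⟩)
  · rintro p ⟨hp, hn⟩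
    have := hD hp
    refine ⟨mem_univ _, ?_⟩
    by_contra hne
    simp only [mem_insert_iff, mem_singleton_iff, not_or] at hne
    exact hn ⟨hp, this.1, lt_of_le_of_ne this.2.1 (Ne.symm hne.1), lt_of_le_of_ne this.2.2 hne.2⟩
  · rw [sdiff_eq_empty.2 inter_subset_left, measure_empty]

lemma setIntegral_eq_indicator (hD_meas : MeasurableSet D)
    (hD : D ⊆ Ω ×ˢ Icc 0 T) (f : E × ℝ → ℝ) :
    ∫ p in D, f p = ∫ p in cyl Ω T, D.indicator f p := by
  rw [setIntegral_congr_set (ae_eq_inter_cyl hD), setIntegral_indicator hD_meas, inter_comm]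

/-- The bound for the contribution of `t = 0` and `t = T`. -/
def endpointBound (Ω : Set E) (T lam : ℝ) (u us v : E × ℝ → ℝ) : ℝ :=
  (∫ x in Ω, (weight lam T 0 * (v (x, 0) - u (x, 0))) ^ 2)
    + (∫ x in Ω, ((weight lam T T)⁻¹ * us (x, T)) ^ 2) / 2
    + (∫ x in Ω, ((weight lam T 0)⁻¹ * us (x, 0)) ^ 2) / 2

lemma abs_integral_mul_le_half {μ : Measure E} {f g : E → ℝ} (hf : MemLp f 2 μ)
    (hg : MemLp g 2 μ) : |∫ x, f x * g x ∂μ| ≤ (∫ x, f x ^ 2 ∂μ) / 2 + (∫ x, g x ^ 2 ∂μ) / 2 := by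
  have i1 := hf.integrable_sq.div_const 2
  have i2 := hg.integrable_sq.div_const 2
  rw [← integral_div, ← integral_div, ← integral_add i1 i2]
  refine (abs_integral_le_integral_abs).trans ?_
  refine integral_mono (integrable_smul_of_memLp hf hg).abs (i1.add i2) fun x => ?_
  simp only [abs_mul]
  nlinarith [sq_nonneg (|f x| - |g x|), sq_abs (f x), sq_abs (g x)]

variable (hΩ : IsOpen Ω) (hT : 0 < T) (hD_meas : MeasurableSet D) (hD : D ⊆ Ω ×ˢ Icc 0 T)
  (hγ : 0 < γ)
  (hb_meas : ∀ i j, Measurable fun x => b x i j) (hb_ell : ∀ x ∈ Ω, IsElliptic γ (b x))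
  (ha_meas : ∀ i j, Measurable fun p => a p i j)
  (ha_ell : ∀ p ∈ Ω ×ˢ Icc 0 T, IsElliptic γ (a p))
  (hab : ∀ p ∈ Ω ×ˢ Icc 0 T, p ∉ D → a p = b p.1)
  (hv : IsPerturbedSolution Ω T a b u v₀ v) (hu : MemEnergy Ω T u) (hus : MemEnergy Ω T us)
  (hlam : 0 ≤ lam) {g e : E × ℝ → E}
  (hg : ∀ p, g p = weight lam T p.2 • wgrad (cyl Ω T) u p)
  (he : ∀ p, e p = (weight lam T p.2)⁻¹ • wgrad (cyl Ω T) us p - g p)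

include hT hv hu hus in
-- Young's inequality after weighting `w` by `ρ` and `u^*` by `ρ⁻¹`. The last two terms are arranged
-- to cancel the right side of the energy inequality; this is why `endpointBound` contains the
-- whole, not half, of the integral of `(ρ w)²` at `t = 0`.
lemma abs_endpoints_le (lam : ℝ) :
    |∫ x in Ω, ((v (x, T) - u (x, T)) * us (x, T) - (v (x, 0) - u (x, 0)) * us (x, 0))|
      ≤ endpointBound Ω T lam u us v
        + (∫ x in Ω, (weight lam T T * (v (x, T) - u (x, T))) ^ 2) / 2
        - (∫ x in Ω, (weight lam T 0 * (v (x, 0) - u (x, 0))) ^ 2) / 2 := by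
  have hw := hv.energy.sub hu
  have m : ∀ t ∈ Icc 0 T, ∀ c : ℝ, MemLp (fun x => c * (v (x, t) - u (x, t))) 2
    (volume.restrict Ω) := fun t ht c => (hw.2.1 t ht).const_mul c
  have m' : ∀ t ∈ Icc 0 T, ∀ c : ℝ, MemLp (fun x => c * us (x, t)) 2
    (volume.restrict Ω) := fun t ht c => (hus.2.1 t ht).const_mul c
  have h0 : (0 : ℝ) ∈ Icc 0 T := ⟨le_rfl, hT.le⟩
  have hTm : T ∈ Icc 0 T := ⟨hT.le, le_rfl⟩
  have key : ∀ t ∈ Icc 0 T, |∫ x in Ω, (v (x, t) - u (x, t)) * us (x, t)|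
      ≤ (∫ x in Ω, (weight lam T t * (v (x, t) - u (x, t))) ^ 2) / 2
        + (∫ x in Ω, ((weight lam T t)⁻¹ * us (x, t)) ^ 2) / 2 := fun t ht => by
    refine le_trans (le_of_eq ?_) (abs_integral_mul_le_half (m t ht (weight lam T t))
      (m' t ht (weight lam T t)⁻¹))
    congr 1
    refine integral_congr_ae (ae_of_all _ fun x => ?_)
    have := (weight_pos lam T t).ne'
    field_simp
  have i1 : Integrable (fun x => (v (x, T) - u (x, T)) * us (x, T)) (volume.restrict Ω) :=
    integrable_smul_of_memLp (hw.2.1 T hTm) (hus.2.1 T hTm)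
  have i2 : Integrable (fun x => (v (x, 0) - u (x, 0)) * us (x, 0)) (volume.restrict Ω) :=
    integrable_smul_of_memLp (hw.2.1 0 h0) (hus.2.1 0 h0)
  rw [integral_sub i1 i2]
  refine (abs_sub _ _).trans ?_
  have k1 := key T hTm
  have k2 := key 0 h0
  rw [endpointBound]
  linarith

include hΩ hγ hb_meas hb_ell ha_meas ha_ell in
lemma memLp_app_sub {f : E × ℝ → E} (hf : MemLp f 2 (volume.restrict (cyl Ω T))) :
    MemLp (fun p => app (a p - b p.1) (f p)) 2 (volume.restrict (cyl Ω T)) := by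
  have h := (memLp_app_cyl hΩ hγ ha_meas ha_ell hf).sub
    (memLp_app_cyl (a := fun p => b p.1) hΩ hγ
      (fun i j => (hb_meas i j).comp measurable_fst) (fun p hp => hb_ell p.1 hp.1) hf)
  exact h.ae_eq (ae_of_all _ fun p => (sub_app _ _ _).symm)

include hΩ hu hus hg he in
lemma memLp_weighted : MemLp g 2 (volume.restrict (cyl Ω T)) ∧
    MemLp e 2 (volume.restrict (cyl Ω T)) := by
  have hc : Continuous (weight lam T) := (contDiff_weight lam T).continuous
  have h1 : MemLp g 2 (volume.restrict (cyl Ω T)) :=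
    (memLp_timeMul hΩ hc hu.1.isWeakGrad.2.1).ae_eq (ae_of_all _ fun p => (hg p).symm)
  exact ⟨h1, ((memLp_timeMul hΩ (hc.inv₀ fun t => (weight_pos lam T t).ne')
    hus.1.isWeakGrad.2.1).sub h1).ae_eq (ae_of_all _ fun p => (he p).symm)⟩

include hΩ hT hγ hb_meas hb_ell ha_meas ha_ell hv hu hus hlam hg he

/-- One inequality serves both directions: removing the absolute value with either sign bounds the
indicator above by the density minus the energy integrand, or below by their sum. -/
lemma exists_indicatorI_split : ∃ k : E × ℝ → E,
    Integrable (fun p => inner ℝ (app (a p - b p.1) (g p + k p)) (g p + e p))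
      (volume.restrict (cyl Ω T)) ∧
    Integrable (fun p => inner ℝ (app (a p) (k p)) (k p) + inner ℝ (app (a p - b p.1) (g p)) (k p))
      (volume.restrict (cyl Ω T)) ∧
    |indicatorI Ω T a b u us v
        - ∫ p in cyl Ω T, inner ℝ (app (a p - b p.1) (g p + k p)) (g p + e p)|
      + ∫ p in cyl Ω T,
          (inner ℝ (app (a p) (k p)) (k p) + inner ℝ (app (a p - b p.1) (g p)) (k p))
      ≤ endpointBound Ω T lam u us v := by
  obtain ⟨hg2, he2⟩ := memLp_weighted hΩ hu hus hg he
  have hk2 : MemLp (fun p => weight lam T p.2 • (wgrad (cyl Ω T) v p - wgrad (cyl Ω T) u p)) 2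
      (volume.restrict (cyl Ω T)) :=
    memLp_timeMul hΩ (contDiff_weight lam T).continuous
      (hv.energy.1.isWeakGrad.2.1.sub hu.1.isWeakGrad.2.1)
  refine ⟨_, integrable_inner_of_memLp (memLp_app_sub hΩ hγ hb_meas hb_ell ha_meas ha_ell
    (hg2.add hk2)) (hg2.add he2), (integrable_inner_of_memLp
      (memLp_app_cyl hΩ hγ ha_meas ha_ell hk2) hk2).add (integrable_inner_of_memLp
        (memLp_app_sub hΩ hγ hb_meas hb_ell ha_meas ha_ell hg2) hk2), ?_⟩
  have h1 := hv.energy_le hΩ hT hγ hb_meas hb_ell ha_meas ha_ell hu hlam (fun _ => rfl) hg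
  have h2 := abs_endpoints_le hT hv hu hus lam
  have h3 : ∫ p in cyl Ω T,
      inner ℝ (app (a p - b p.1) (wgrad (cyl Ω T) v p)) (wgrad (cyl Ω T) us p)
      = ∫ p in cyl Ω T, inner ℝ (app (a p - b p.1) (g p
        + weight lam T p.2 • (wgrad (cyl Ω T) v p - wgrad (cyl Ω T) u p))) (g p + e p) := by
    refine integral_congr_ae (ae_of_all _ fun p => ?_)
    have h0 := (weight_pos lam T p.2).ne'
    simp only [he, hg, ← smul_add, add_sub_cancel, app_smul, inner_smul_left, inner_smul_right,
      RCLike.conj_to_real]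
    rw [← mul_assoc, inv_mul_cancel₀ h0, one_mul]
  rw [indicatorI, h3, add_sub_cancel_left]
  linarith

include hD_meas hD hab

/-- The algebraic inequality is applied pointwise on `D`. Off `D` the density vanishes with `a - b`
and the energy integrand reduces to `a k · k ≥ 0`, so nothing is lost there. -/
lemma indicatorI_le {C : ℝ} (hC : ∀ A B : Mat, IsElliptic γ A → IsElliptic γ B → ∀ g k e : E,
      inner ℝ (app (A - B) (g + k)) (g + e) - inner ℝ (app A k) k - inner ℝ (app (A - B) g) k
        ≤ C * (‖g‖ ^ 2 + ‖e‖ ^ 2)) :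
    indicatorI Ω T a b u us v ≤ (∫ p in D, C * (‖g p‖ ^ 2 + ‖e p‖ ^ 2))
      + endpointBound Ω T lam u us v := by
  obtain ⟨hg2, he2⟩ := memLp_weighted hΩ hu hus hg he
  obtain ⟨k, i1, i2, h⟩ := exists_indicatorI_split hΩ hT hγ hb_meas hb_ell ha_meas ha_ell hv hu
    hus hlam hg he
  have i3 : Integrable (fun p => C * (‖g p‖ ^ 2 + ‖e p‖ ^ 2)) (volume.restrict (cyl Ω T)) :=
    (hg2.integrable_norm_pow two_ne_zero |>.add
      (he2.integrable_norm_pow two_ne_zero)).const_mul C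
  have key : (∫ p in cyl Ω T, inner ℝ (app (a p - b p.1) (g p + k p)) (g p + e p))
      - ∫ p in cyl Ω T,
          (inner ℝ (app (a p) (k p)) (k p) + inner ℝ (app (a p - b p.1) (g p)) (k p))
      ≤ ∫ p in D, C * (‖g p‖ ^ 2 + ‖e p‖ ^ 2) := by
    rw [setIntegral_eq_indicator hD_meas hD, ← integral_sub i1 i2]
    refine setIntegral_mono_on (i1.sub i2) (i3.indicator hD_meas)
      (isOpen_cyl hΩ T).measurableSet fun p hp => ?_
    have hp' : p ∈ Ω ×ˢ Icc 0 T := ⟨hp.1, Ioo_subset_Icc_self hp.2⟩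
    by_cases hpD : p ∈ D
    · rw [indicator_of_mem hpD]
      have := hC _ _ (ha_ell p hp') (hb_ell p.1 hp.1) (g p) (k p) (e p)
      linarith
    · rw [indicator_of_notMem hpD]
      have := (ha_ell p hp').nonneg hγ (k p)
      simp only [hab p hp' hpD, sub_self, zero_app, inner_zero_left] at this ⊢
      linarith
  have := (abs_le.1 (le_sub_iff_add_le.2 h)).2
  linarith

lemma le_indicatorI {δ c C : ℝ} (hδ : H0b δ D a b)
    (hC : ∀ A B : Mat, IsElliptic γ A → IsElliptic γ B → GeScalar (B⁻¹ - A⁻¹) δ → ∀ g k e : E,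
      c * ‖g‖ ^ 2 - C * ‖e‖ ^ 2 ≤
        inner ℝ (app (A - B) (g + k)) (g + e) + inner ℝ (app A k) k
          + inner ℝ (app (A - B) g) k) :
    (∫ p in D, (c * ‖g p‖ ^ 2 - C * ‖e p‖ ^ 2)) - endpointBound Ω T lam u us v
      ≤ indicatorI Ω T a b u us v := by
  obtain ⟨hg2, he2⟩ := memLp_weighted hΩ hu hus hg he
  obtain ⟨k, i1, i2, h⟩ := exists_indicatorI_split hΩ hT hγ hb_meas hb_ell ha_meas ha_ell hv hu
    hus hlam hg he
  have i3 : Integrable (fun p => c * ‖g p‖ ^ 2 - C * ‖e p‖ ^ 2) (volume.restrict (cyl Ω T)) :=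
    ((hg2.integrable_norm_pow two_ne_zero).const_mul c).sub
      ((he2.integrable_norm_pow two_ne_zero).const_mul C)
  have key : ∫ p in D, (c * ‖g p‖ ^ 2 - C * ‖e p‖ ^ 2)
      ≤ (∫ p in cyl Ω T, inner ℝ (app (a p - b p.1) (g p + k p)) (g p + e p))
      + ∫ p in cyl Ω T,
          (inner ℝ (app (a p) (k p)) (k p) + inner ℝ (app (a p - b p.1) (g p)) (k p)) := by
    rw [setIntegral_eq_indicator hD_meas hD, ← integral_add i1 i2]
    refine setIntegral_mono_on (i3.indicator hD_meas) (i1.add i2)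
      (isOpen_cyl hΩ T).measurableSet fun p hp => ?_
    have hp' : p ∈ Ω ×ˢ Icc 0 T := ⟨hp.1, Ioo_subset_Icc_self hp.2⟩
    by_cases hpD : p ∈ D
    · rw [indicator_of_mem hpD]
      have := hC _ _ (ha_ell p hp') (hb_ell p.1 hp.1) (hδ p hpD).1 (g p) (k p) (e p)
      linarith
    · rw [indicator_of_notMem hpD]
      have := (ha_ell p hp').nonneg hγ (k p)
      simp only [hab p hp' hpD, sub_self, zero_app, inner_zero_left] at this ⊢
      linarith
  have := (abs_le.1 (le_sub_iff_add_le.2 h)).1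
  linarith

end Indicator

/-! ### The special solutions -/

section Extension

variable {Ω : Set E} {b : E → Mat} {γ : ℝ}

lemma measurable_extendId (hΩ : IsOpen Ω) (hb : ∀ i j, Measurable fun x => b x i j) (i j : Fin 3) :
    Measurable fun x => extendId Ω b x i j := by
  classical
  have : (fun x => extendId Ω b x i j) = fun x => if x ∈ Ω then b x i j else (1 : Mat) i j := by
    funext x
    unfold extendId
    split_ifs <;> rfl
  rw [this]
  exact Measurable.ite hΩ.measurableSet (hb i j) measurable_const

lemma isElliptic_extendId (hγ : 0 < γ) (hb : ∀ x ∈ Ω, IsElliptic γ (b x)) (x : E) :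
    IsElliptic (max γ 1) (extendId Ω b x) := by
  unfold extendId
  split_ifs with h
  · exact (hb x h).mono hγ (le_max_left _ _)
  · exact isElliptic_one (le_max_right _ _)

end Extension

/-! ### From the weighted gradients to those of `P_τ`, `q_τ` and `q_τ^*` -/

section Comparison

variable {α : Type*} [MeasurableSpace α] {ν : Measure α} {g e p q r : α → E}

lemma sq_norm_add_le (x y : E) : ‖x + y‖ ^ 2 ≤ 2 * ‖x‖ ^ 2 + 2 * ‖y‖ ^ 2 := by
  nlinarith [parallelogram_law_with_norm ℝ x y, sq_nonneg ‖x - y‖]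

lemma sq_norm_sub_le (x y : E) : ‖x - y‖ ^ 2 ≤ 2 * ‖x‖ ^ 2 + 2 * ‖y‖ ^ 2 := by
  nlinarith [parallelogram_law_with_norm ℝ x y, sq_nonneg ‖x + y‖]

variable (hg : MemLp g 2 ν) (he : MemLp e 2 ν) (hp : MemLp p 2 ν) (hq : q =ᵐ[ν] fun x => g x - p x)
  (hr : r =ᵐ[ν] fun x => e x + g x - p x)
include hg he hp hq hr

/-- Since `g = p + q` and `e = r - q`, the parallelogram law bounds `|g|² + |e|²` by `2|p|² + 4|q|²
+ 2|r|²`. -/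
lemma integral_sq_add_sq_le {C : ℝ} (hC : 0 ≤ C) : ∫ x, C * (‖g x‖ ^ 2 + ‖e x‖ ^ 2) ∂ν
    ≤ 4 * C * (∫ x, ‖p x‖ ^ 2 ∂ν) + 4 * C * ∫ x, (‖q x‖ ^ 2 + ‖r x‖ ^ 2) ∂ν := by
  have hq2 : MemLp q 2 ν := (hg.sub hp).ae_eq hq.symm
  have hr2 : MemLp r 2 ν := ((he.add hg).sub hp).ae_eq hr.symm
  have i : ∀ {f : α → E}, MemLp f 2 ν → Integrable (fun x => ‖f x‖ ^ 2) ν :=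
    fun hf => hf.integrable_norm_pow two_ne_zero
  have j : Integrable (fun x => ‖q x‖ ^ 2 + ‖r x‖ ^ 2) ν := (i hq2).add (i hr2)
  rw [← integral_const_mul, ← integral_const_mul,
    ← integral_add ((i hp).const_mul _) (j.const_mul _)]
  refine integral_mono_ae (((i hg).add (i he)).const_mul C)
    (((i hp).const_mul _).add (j.const_mul _)) ?_
  filter_upwards [hq, hr] with x h1 h2
  have e1 : g x = p x + q x := by rw [h1]; abel
  have e2 : e x = r x - q x := by rw [h1, h2]; abel
  simp only [← mul_add, mul_comm 4 C, mul_assoc]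
  refine mul_le_mul_of_nonneg_left ?_ hC
  have a1 := sq_norm_add_le (p x) (q x)
  have a2 := sq_norm_sub_le (r x) (q x)
  rw [← e1] at a1
  rw [← e2] at a2
  nlinarith [sq_nonneg ‖p x‖, sq_nonneg ‖r x‖]

/-- From `p = g - q` one gets `c|g|² ≥ (c/2)|p|² - c|q|²`, and `e = r - q` gives `C|e|² ≤ 2C(|r|² +
|q|²)`. -/
lemma le_integral_sq_sub_sq {c C : ℝ} (hc : 0 ≤ c) (hC : 0 ≤ C) :
    c / 2 * (∫ x, ‖p x‖ ^ 2 ∂ν) - (c + 2 * C) * ∫ x, (‖q x‖ ^ 2 + ‖r x‖ ^ 2) ∂ν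
      ≤ ∫ x, (c * ‖g x‖ ^ 2 - C * ‖e x‖ ^ 2) ∂ν := by
  have hq2 : MemLp q 2 ν := (hg.sub hp).ae_eq hq.symm
  have hr2 : MemLp r 2 ν := ((he.add hg).sub hp).ae_eq hr.symm
  have i : ∀ {f : α → E}, MemLp f 2 ν → Integrable (fun x => ‖f x‖ ^ 2) ν :=
    fun hf => hf.integrable_norm_pow two_ne_zero
  have j : Integrable (fun x => ‖q x‖ ^ 2 + ‖r x‖ ^ 2) ν := (i hq2).add (i hr2)
  rw [← integral_const_mul, ← integral_const_mul,
    ← integral_sub ((i hp).const_mul _) (j.const_mul _)]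
  refine integral_mono_ae (((i hp).const_mul _).sub (j.const_mul _))
    (((i hg).const_mul c).sub ((i he).const_mul C)) ?_
  filter_upwards [hq, hr] with x h1 h2
  have e1 : p x = g x - q x := by rw [h1]; abel
  have e2 : e x = r x - q x := by rw [h1, h2]; abel
  have a1 := sq_norm_sub_le (g x) (q x)
  have a2 := sq_norm_sub_le (r x) (q x)
  rw [← e1] at a1
  rw [← e2] at a2
  nlinarith [mul_le_mul_of_nonneg_left a1 hc, mul_le_mul_of_nonneg_left a2 hC,
    mul_nonneg hc (sq_nonneg ‖r x‖)]

end Comparison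

lemma restrict_le_restrict_cyl {Ω : Set E} {T : ℝ} {D : Set (E × ℝ)} (hD : D ⊆ Ω ×ˢ Icc 0 T) :
    (volume : Measure (E × ℝ)).restrict D ≤ volume.restrict (cyl Ω T) := by
  rw [Measure.restrict_congr_set (ae_eq_inter_cyl hD)]
  exact Measure.restrict_mono inter_subset_right le_rfl

section Special

variable {Ω : Set E} {b : E → Mat} {G : E → E → ℝ → ℝ} {γ : ℝ} (hΩ : IsOpen Ω)
  (hG : IsFundamentalSolution (extendId Ω b) G) (hγ : 0 < γ)
  (hb : ∀ i j, Measurable fun x => b x i j) (hell : ∀ x ∈ Ω, IsElliptic γ (b x))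
  {T : ℝ} (hT : 0 < T) {y : ℝ → E} {K : NNReal} (hy : LipschitzOnWith K y (Icc 0 T))
  {θ μ τ : ℝ} (hμ : 0 < μ) (hτ : μ + 1 < τ)

lemma weight_inv (lam T t : ℝ) : (weight lam T t)⁻¹ = Real.exp (lam * (T + t)) := by
  rw [weight, Real.exp_neg, inv_inv]

include hΩ hG hγ hb hell hT hy hμ hτ

lemma memEnergy_timePotential_restrict {ε : ℝ} (hε : |ε| ≤ 1) :
    MemEnergy Ω T (timePotential G (τ ^ 2) ε (weightedSource T y θ μ τ)) :=
  (memEnergy_timePotential hG (lt_max_of_lt_left hγ) (measurable_extendId hΩ hb)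
    (isElliptic_extendId hγ hell) hT hy hμ hτ hε).restrict Ω

lemma memEnergy_uτ : MemEnergy Ω T (uτ G T y θ μ τ) := by
  have h := (memEnergy_timePotential_restrict hΩ hG hγ hb hell hT hy (θ := θ) hμ hτ
    (ε := -1) (by simp)).timeMul hΩ (κ := fun t => Real.exp (τ ^ 2 * (T + t))) (by fun_prop)
  rwa [← funext (uτ_eq hG T y θ μ τ)] at h

lemma memEnergy_uτs : MemEnergy Ω T (uτs G T y θ μ τ) := by
  have h := (memEnergy_timePotential_restrict hΩ hG hγ hb hell hT hy (θ := θ) hμ hτ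
    (ε := 1) (by simp)).timeMul hΩ (κ := fun t => Real.exp (-(τ ^ 2 * (T + t)))) (by fun_prop)
  rwa [← funext (uτs_eq hG T y θ μ τ)] at h

lemma memH_Pτ : MemH (cyl Ω T) (Pτ G T y τ) :=
  ((memEnergy_Pτ hG (lt_max_of_lt_left hγ) (measurable_extendId hΩ hb)
    (isElliptic_extendId hγ hell) hT hy hτ hμ.le).restrict Ω).1

lemma wgrad_qτ_ae_eq : wgrad (cyl Ω T) (qτ G T y θ μ τ) =ᵐ[volume.restrict (cyl Ω T)] fun p =>
    weight (τ ^ 2) T p.2 • wgrad (cyl Ω T) (uτ G T y θ μ τ) p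
      - Real.exp (-(τ * μ * |p.2 - θ|)) • wgrad (cyl Ω T) (Pτ G T y τ) p :=
  IsWeakGrad.wgrad_ae_eq (isOpen_cyl hΩ T)
    (((memEnergy_uτ hΩ hG hγ hb hell hT hy hμ hτ).1.isWeakGrad.timeMul hΩ
      (contDiff_weight (τ ^ 2) T).continuous).sub
    ((memH_Pτ hΩ hG hγ hb hell hT hy hμ hτ).isWeakGrad.timeMul hΩ
      (κ := fun t => Real.exp (-(τ * μ * |t - θ|))) (by fun_prop)))

lemma wgrad_qτs_ae_eq : wgrad (cyl Ω T) (qτs G T y θ μ τ) =ᵐ[volume.restrict (cyl Ω T)] fun p =>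
    (weight (τ ^ 2) T p.2)⁻¹ • wgrad (cyl Ω T) (uτs G T y θ μ τ) p
      - Real.exp (-(τ * μ * |p.2 - θ|)) • wgrad (cyl Ω T) (Pτ G T y τ) p := by
  simp only [weight_inv]
  exact IsWeakGrad.wgrad_ae_eq (isOpen_cyl hΩ T)
    (((memEnergy_uτs hΩ hG hγ hb hell hT hy hμ hτ).1.isWeakGrad.timeMul hΩ
      (κ := fun t => Real.exp (τ ^ 2 * (T + t))) (by fun_prop)).sub
    ((memH_Pτ hΩ hG hγ hb hell hT hy hμ hτ).isWeakGrad.timeMul hΩ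
      (κ := fun t => Real.exp (-(τ * μ * |t - θ|))) (by fun_prop)))

/-- The contribution of `t = 0` and `t = T` is bounded by the boundary term. -/
lemma endpointBound_le (hΩb : Bornology.IsBounded Ω) (hθ : θ ∈ Ioo 0 T) {v₀ : E → ℝ}
    (hv₀ : MemLp v₀ 2 (volume.restrict Ω)) {v : E × ℝ → ℝ}
    (hv : ∀ᵐ x ∂(volume.restrict Ω), v (x, 0) = v₀ x) :
    endpointBound Ω T (τ ^ 2) (uτ G T y θ μ τ) (uτs G T y θ μ τ) v
      ≤ boundaryTerm Ω T v₀ θ μ τ := by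
  have hτ0 : 0 < τ := by linarith
  have hγ' : 0 < max γ 1 := lt_max_of_lt_left hγ
  have hb' := measurable_extendId hΩ hb
  have hell' := isElliptic_extendId hγ hell
  have B1 := integral_timePotential_zero_sq_le hG hγ' hb' hell' hT hy (θ := θ) hμ hτ hΩb
  have B2 := integral_timePotential_final_sq_le hG hγ' hb' hell' hT hy (θ := θ) hμ hτ hΩb
  have B3 := integral_timePotential_adjoint_zero_sq_le hG hγ' hb' hell' hT hy (θ := θ) hμ hτ hΩb
  have hU := (memEnergy_timePotential_restrict hΩ hG hγ hb hell hT hy (θ := θ) hμ hτ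
    (ε := -1) (by simp)).2.1 0 ⟨le_rfl, hT.le⟩
  have e2 : ∀ t : ℝ, ∀ x, (weight (τ ^ 2) T t)⁻¹ * uτs G T y θ μ τ (x, t)
      = timePotential G (τ ^ 2) 1 (weightedSource T y θ μ τ) (x, t) := fun t x => by
    rw [uτs_eq hG, ← weight, inv_mul_cancel_left₀ (weight_pos _ _ _).ne']
  -- Young's inequality in the form `(A - B)² ≤ 10 A² + (10/9) B²`. The small second coefficient
  -- leaves room for the constant `10`: the three potentials contribute `(10/9 + 1/2 + 1/2) · 4π/3 <
  -- 10`.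
  have W : ∫ x in Ω, (weight (τ ^ 2) T 0 * (v (x, 0) - uτ G T y θ μ τ (x, 0))) ^ 2
      ≤ 10 * (weight (τ ^ 2) T 0) ^ 2 * (∫ x in Ω, v₀ x ^ 2)
        + 10 / 9 * ∫ x in Ω, timePotential G (τ ^ 2) (-1) (weightedSource T y θ μ τ) (x, 0) ^ 2 := by
    have i1 := (hv₀.integrable_sq).const_mul (10 * (weight (τ ^ 2) T 0) ^ 2)
    have i2 := (hU.integrable_sq).const_mul (10 / 9)
    rw [← integral_const_mul, ← integral_const_mul, ← integral_add i1 i2]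
    refine integral_mono_of_nonneg (ae_of_all _ fun x => sq_nonneg _) (i1.add i2) ?_
    filter_upwards [hv] with x hx
    have e1 : weight (τ ^ 2) T 0 * (v (x, 0) - uτ G T y θ μ τ (x, 0)) = weight (τ ^ 2) T 0 * v₀ x
        - timePotential G (τ ^ 2) (-1) (weightedSource T y θ μ τ) (x, 0) := by
      rw [uτ_eq hG, ← weight_inv, mul_sub, mul_inv_cancel_left₀ (weight_pos _ _ _).ne', hx]
    simp only [e1]
    nlinarith [sq_nonneg (9 * (weight (τ ^ 2) T 0 * v₀ x)
      + timePotential G (τ ^ 2) (-1) (weightedSource T y θ μ τ) (x, 0))]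
  have hd : 0 ≤ Metric.diam Ω := Metric.diam_nonneg
  have hm1 := min_le_left (T - θ) θ
  have hm2 := min_le_right (T - θ) θ
  have hm0 : 0 < min (T - θ) θ := lt_min (sub_pos.2 hθ.2) hθ.1
  have hτμ : 0 < τ * μ := by positivity
  rw [endpointBound, boundaryTerm]
  simp only [e2]
  set m := min (T - θ) θ with hm
  have X : ∀ s, m ≤ s → Real.exp (-(τ * μ * s)) ^ 2 ≤ Real.exp (-(τ * μ * m)) := fun s hs => by
    rw [← Real.exp_nat_mul]
    refine Real.exp_le_exp.2 ?_
    have h1 := mul_le_mul_of_nonneg_left hs hτμ.le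
    have h2 := mul_pos hτμ hm0
    push_cast
    linarith
  -- The square is `e^{-2τ² T}`, and `τ μ m ≤ τ² T` because `μ ≤ τ` and `m ≤ T`.
  have X0 : weight (τ ^ 2) T 0 ^ 2 ≤ Real.exp (-(τ * μ * m)) := by
    rw [weight, ← Real.exp_nat_mul]
    refine Real.exp_le_exp.2 ?_
    have h1 : τ * μ * m ≤ τ * τ * T := by
      have hmT : m ≤ T := by linarith [hθ.2]
      have hμτ : μ ≤ τ := by linarith
      gcongr
    have h2 : 0 < τ * τ * T := by positivity
    push_cast
    nlinarith
  have X1 := mul_le_mul_of_nonneg_right (X θ hm2) hd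
  have X2 := mul_le_mul_of_nonneg_right (X (T - θ) hm1) hd
  have hv0 : 0 ≤ ∫ x in Ω, v₀ x ^ 2 := integral_nonneg fun x => sq_nonneg _
  have X3 := mul_le_mul_of_nonneg_right X0 hv0
  have hpi := Real.pi_lt_d2
  have hpi0 := Real.pi_pos
  set R := Real.exp (-(τ * μ * m)) * Metric.diam Ω with hR
  have hR0 : 0 ≤ R := mul_nonneg (Real.exp_pos _).le hd
  have hK : 4 * Real.pi / 3 * R ≤ 4.2 * R := mul_le_mul_of_nonneg_right (by linarith) hR0
  have Y1 := mul_le_mul_of_nonneg_left X1 (by positivity : 0 ≤ 4 * Real.pi / 3)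
  have Y2 := mul_le_mul_of_nonneg_left X2 (by positivity : 0 ≤ 4 * Real.pi / 3)
  rw [show 10 * ((∫ x in Ω, v₀ x ^ 2) + Metric.diam Ω) * Real.exp (-(τ * μ * m))
    = 10 * (Real.exp (-(τ * μ * m)) * ∫ x in Ω, v₀ x ^ 2) + 10 * R by rw [hR]; ring]
  linarith

end Special

end HeatProbe

end

/-! ### The two-sided bound on the indicator function -/

theorem mainTheorem5
    (Ω : Set E) (hΩ_open : IsOpen Ω) (hΩ_bdd : Bornology.IsBounded Ω)
    (T : ℝ) (hT : 0 < T)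
    (D : Set (E × ℝ)) (hD_meas : MeasurableSet D) (hD : D ⊆ Ω ×ˢ Icc 0 T)
    (γ : ℝ) (hγ : 0 < γ)
    (b : E → Mat) (hb_meas : ∀ i j, Measurable fun x => b x i j)
    (hb_ell : ∀ x ∈ Ω, IsElliptic γ (b x))
    (a : E × ℝ → Mat) (ha_meas : ∀ i j, Measurable fun p => a p i j)
    (ha_ell : ∀ p ∈ Ω ×ˢ Icc 0 T, IsElliptic γ (a p))
    (hab : ∀ p ∈ Ω ×ˢ Icc 0 T, p ∉ D → a p = b p.1)
    (δ₁ : ℝ) (hδ₁ : 0 < δ₁) (hH0b : H0b δ₁ D a b) :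
    ∃ C : ℝ, 1 ≤ C ∧
      ∀ G : E → E → ℝ → ℝ, IsFundamentalSolution (extendId Ω b) G →
      ∀ y : ℝ → E, (∃ K, LipschitzOnWith K y (Icc 0 T)) →
        (∀ t ∈ Icc 0 T, y t ∉ closure {x | (x, t) ∈ D}) →
      ∀ θ ∈ Ioo 0 T, ∀ μ > 0, ∀ τ > μ + 1,
        MemEnergy Ω T (uτ G T y θ μ τ) ∧ MemEnergy Ω T (uτs G T y θ μ τ) ∧
        MemH (cyl Ω T) (Pτ G T y τ) ∧
        ∀ v₀ : E → ℝ, MemLp v₀ 2 (volume.restrict Ω) →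
        ∀ v : E × ℝ → ℝ, IsPerturbedSolution Ω T a b (uτ G T y θ μ τ) v₀ v →
          indicatorI Ω T a b (uτ G T y θ μ τ) (uτs G T y θ μ τ) v
              ≤ C * mainTerm G Ω D T y θ μ τ + C * remainder G Ω D T y θ μ τ
                + boundaryTerm Ω T v₀ θ μ τ ∧
          C⁻¹ * mainTerm G Ω D T y θ μ τ - C * remainder G Ω D T y θ μ τ
                - boundaryTerm Ω T v₀ θ μ τ
              ≤ indicatorI Ω T a b (uτ G T y θ μ τ) (uτs G T y θ μ τ) v := by
  obtain ⟨Cu, hCu, hup⟩ := density_upper hγ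
  obtain ⟨c, Cl, hc, hCl, hlow⟩ := density_lower hγ hδ₁
  -- The summand `4 * Cu` serves the upper bound, `c + 2 * Cl` the remainder in the lower bound, `2
  -- / c` makes `C⁻¹ ≤ c / 2`, and `1` gives `1 ≤ C`.
  refine ⟨1 + 4 * Cu + 2 / c + c + 2 * Cl, ?_, ?_⟩
  · have : 0 ≤ 2 / c := by positivity
    linarith
  set C := 1 + 4 * Cu + 2 / c + c + 2 * Cl with hC
  intro G hG y ⟨K, hy⟩ _ θ hθ μ hμ τ hτ
  have hu := memEnergy_uτ hΩ_open hG hγ hb_meas hb_ell hT hy (θ := θ) hμ hτ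
  have hus := memEnergy_uτs hΩ_open hG hγ hb_meas hb_ell hT hy (θ := θ) hμ hτ
  have hP := memH_Pτ hΩ_open hG hγ hb_meas hb_ell hT hy hμ hτ
  refine ⟨hu, hus, hP, fun v₀ hv₀ v hv => ?_⟩
  -- With `λ = τ²`, the identities to be used almost everywhere are `∇q_τ = g - P` and `∇q_τ^* = e +
  -- g - P`.
  set g : E × ℝ → E := fun p => weight (τ ^ 2) T p.2 • wgrad (cyl Ω T) (uτ G T y θ μ τ) p with hg
  set e : E × ℝ → E := fun p =>
    (weight (τ ^ 2) T p.2)⁻¹ • wgrad (cyl Ω T) (uτs G T y θ μ τ) p - g p with he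
  set P : E × ℝ → E := fun p =>
    Real.exp (-(τ * μ * |p.2 - θ|)) • wgrad (cyl Ω T) (Pτ G T y τ) p with hPdef
  obtain ⟨hg2, he2⟩ := memLp_weighted hΩ_open hu hus (g := g) (e := e) (fun _ => rfl)
    (fun _ => rfl)
  have hP2 : MemLp P 2 (volume.restrict (cyl Ω T)) :=
    memLp_timeMul hΩ_open (κ := fun t => Real.exp (-(τ * μ * |t - θ|))) (by fun_prop)
      hP.isWeakGrad.2.1
  have hle := restrict_le_restrict_cyl hD
  have hq := ae_mono hle (wgrad_qτ_ae_eq hΩ_open hG hγ hb_meas hb_ell hT hy (θ := θ) hμ hτ)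
  have hr : wgrad (cyl Ω T) (qτs G T y θ μ τ) =ᵐ[volume.restrict D]
      fun p => e p + g p - P p := by
    filter_upwards [ae_mono hle
      (wgrad_qτs_ae_eq hΩ_open hG hγ hb_meas hb_ell hT hy (θ := θ) hμ hτ)] with p hp
    rw [hp, he, sub_add_cancel]
  have hmain : mainTerm G Ω D T y θ μ τ = ∫ p in D, ‖P p‖ ^ 2 := by
    rw [mainTerm]
    refine integral_congr_ae (ae_of_all _ fun p => ?_)
    simp only [hPdef, norm_smul, mul_pow, Real.norm_of_nonneg (Real.exp_pos _).le,
      ← Real.exp_nat_mul]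
    congr 2
    push_cast
    ring
  have hm0 : 0 ≤ mainTerm G Ω D T y θ μ τ := hmain ▸ integral_nonneg fun p => sq_nonneg _
  have hr0 : 0 ≤ remainder G Ω D T y θ μ τ :=
    integral_nonneg fun p => add_nonneg (sq_nonneg _) (sq_nonneg _)
  have hB := endpointBound_le hΩ_open hG hγ hb_meas hb_ell hT hy hμ hτ hΩ_bdd hθ hv₀ hv.initial
  have h2c : 0 < 2 / c := by positivity
  constructor
  · have h1 := indicatorI_le hΩ_open hT hD_meas hD hγ hb_meas hb_ell ha_meas ha_ell hab hv hu hus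
      (sq_nonneg τ) (g := g) (e := e) (fun _ => rfl) (fun _ => rfl) hup
    have h2 := integral_sq_add_sq_le (hg2.mono_measure hle) (he2.mono_measure hle)
      (hP2.mono_measure hle) hq hr hCu
    rw [← hmain, ← remainder] at h2
    have h3 : 4 * Cu ≤ C := by linarith
    have h4 := mul_le_mul_of_nonneg_right h3 hm0
    have h5 := mul_le_mul_of_nonneg_right h3 hr0
    linarith
  · have h1 := le_indicatorI hΩ_open hT hD_meas hD hγ hb_meas hb_ell ha_meas ha_ell hab hv hu hus
      (sq_nonneg τ) (g := g) (e := e) (fun _ => rfl) (fun _ => rfl) hH0b hlow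
    have h2 := le_integral_sq_sub_sq (hg2.mono_measure hle) (he2.mono_measure hle)
      (hP2.mono_measure hle) hq hr hc.le hCl
    rw [← hmain, ← remainder] at h2
    have h3 : c + 2 * Cl ≤ C := by linarith
    have h6 : C⁻¹ ≤ c / 2 := by
      rw [← inv_div]
      exact inv_anti₀ h2c (by linarith)
    have h4 := mul_le_mul_of_nonneg_right h6 hm0
    have h5 := mul_le_mul_of_nonneg_right h3 hr0
    linarith
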